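/- Manifolds are smooth, finite-dimensional, without boundary, Hausdorff and second countable; vector bundles are smooth, real and of finite rank. Let $(\mathcal{A};A^H,A^V;M)$ be a double vector bundle: $A^H\to M$ and $A^V\to M$ are vector bundles, and the manifold $\mathcal{A}$ carries two vector bundle structures, $\widetilde q_V\colon\mathcal{A}\to A^H$ (vertical) and $\widetilde q_H\colon\mathcal{A}\to A^V$ (horizontal), with the same composite projection to $M$, such that the projection, addition and scalar multiplication of each structure on $\mathcal{A}$ are vector bundle morphisms with respect to the other. Let $K\to M$ be its core, the intersection of the kernels of $\widetilde q_V$ and $\widetilde q_H$, and write $\bar k\in\mathcal{A}$ for the element corresponding to $k\in K$. Assume that $\mathcal{A}$ is an $\mathcal{LA}$-vector bundle: $\mathcal{A}\to A^H$ and $A^V\to M$ are Lie algebroids, and the structure maps of $\mathcal{A}\to A^V$, over those of $A^H\to M$, are Lie algebroid morphisms. These are the projection $\mathcal{A}\to A^V$ over $A^H\to M$, the zero section $A^V\to\mathcal{A}$ over $M\to A^H$, the addition $\mathcal{A}\times_{A^V}\mathcal{A}\to\mathcal{A}$ over $A^H\times_M A^H\to A^H$, and the scalar multiplication $\mathcal{A}\to\mathcal{A}$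 over $A^H\to A^H$ by each $t\in\mathbb{R}$. Let $\mathcal{A}^{*V}\to A^H$, with projection $q$, be the dual of the vertical bundle $\mathcal{A}\to A^H$, equipped with its dual Poisson structure, that is, the one determined by $$\{\ell_\xi,\ell_\eta\}=\ell_{[\xi,\eta]},\qquad \{\ell_\xi,f\circ q\}=a(\xi)(f)\circ q,\qquad \{f\circ q,g\circ q\}=0$$ for sections $\xi,\eta$ of $\mathcal{A}\to A^H$ and $f,g\in C^\infty(A^H)$, where $a$ is the anchor and $\ell_\xi(\Phi)=\langle\Phi,\xi(q(\Phi))\rangle$. The manifold $\mathcal{A}^{*V}$ has a second vector bundle structure $q_{K^*}\colon\mathcal{A}^{*V}\to K^*$. Its projection is $\langle q_{K^*}(\Phi),k\rangle=\langle\Phi,0_X+_H\bar k\rangle$ for $\Phi$ over $X\in A^H_m$ and $k\in K_m$, where $0_X$ is the zero of $\mathcal{A}\to A^H$ over $X$ and $+_H$ is the addition of $\mathcal{A}\to A^V$. Its operations, on elements over the same point of $K^*$, are $\langle\Phi+\Phi',\xi+_H\xi'\rangle=\langle\Phi,\xi\rangle+\langle\Phi',\xi'\rangle$ and $\langle t\Phi,t\cdot_H\xi\rangle=t\langle\Phi,\xi\rangle$,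 where $\xi,\xi'\in\mathcal{A}$ lie over the same points of $A^H$ as $\Phi,\Phi'$ respectively, with $\widetilde q_H(\xi)=\widetilde q_H(\xi')$, and where $t\Phi$ lies over the same point of $K^*$ as $\Phi$. Then the Poisson structure on $\mathcal{A}^{*V}$ is also linear with respect to the bundle structure over $K^*$: the bracket of two functions that are linear on the fibres of $q_{K^*}$ is linear on the fibres of $q_{K^*}$; the bracket of such a function with the pullback along $q_{K^*}$ of a smooth function on $K^*$ is again the pullback of a smooth function on $K^*$; and the bracket of two such pullbacks is zero. -/

import Mathlib

open Bundle
open scoped Manifold ContDiff Bundle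

noncomputable section

set_option linter.unusedSectionVars false

/-! ### Fibrewise operations, as (partial) operations on the total space of a vector bundle -/

section Total

variable {B F : Type*} {E : B → Type*} [∀ b, AddCommGroup (E b)] [∀ b, Module ℝ (E b)]

/-- Scalar multiplication on the total space of a vector bundle. -/
def totalSMul (t : ℝ) (e : TotalSpace F E) : TotalSpace F E := ⟨e.proj, t • e.2⟩

open Classical in
/-- Addition on the total space of a vector bundle. It is meaningful for two elements of the
same fibre; the value `e₁` in the other case is irrelevant. -/
def totalAdd (e₁ e₂ : TotalSpace F E) : TotalSpace F E :=
  if h : e₁.proj = e₂.proj then ⟨e₂.proj, (h ▸ e₁.2 : E e₂.proj) + e₂.2⟩ else e₁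

theorem totalAdd_mk (b : B) (x y : E b) :
    totalAdd (⟨b, x⟩ : TotalSpace F E) ⟨b, y⟩ = ⟨b, x + y⟩ := by
  simp [totalAdd]

theorem totalSMul_zero (e : TotalSpace F E) : totalSMul 0 e = zeroSection F E e.proj := by
  simp [totalSMul, zeroSection]

variable [NormedAddCommGroup F] [NormedSpace ℝ F] [∀ b, TopologicalSpace (E b)]

variable (F E) in
/-- The total space of the dual bundle `E* → B`. -/
abbrev DualTotal : Type _ := TotalSpace (F →L[ℝ] ℝ) (fun b => E b →L[ℝ] ℝ)

open Classical in
/-- The pairing `⟨Φ, e⟩` of elements of `E*` and `E` over the same point of the base; the value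
`0` in the other case is irrelevant. -/
def dualPair (Φ : DualTotal F E) (e : TotalSpace F E) : ℝ :=
  if h : e.proj = Φ.proj then Φ.2 (h ▸ e.2 : E Φ.proj) else 0

theorem dualPair_mk (b : B) (Φ : E b →L[ℝ] ℝ) (x : E b) :
    dualPair (⟨b, Φ⟩ : DualTotal F E) ⟨b, x⟩ = Φ x := by
  simp [dualPair]

theorem dualPair_totalAdd {Φ : DualTotal F E} {e₁ e₂ : TotalSpace F E}
    (h₁ : e₁.proj = Φ.proj) (h₂ : e₂.proj = Φ.proj) :
    dualPair Φ (totalAdd e₁ e₂) = dualPair Φ e₁ + dualPair Φ e₂ := by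
  obtain ⟨b, Φ⟩ := Φ
  obtain ⟨b₁, x⟩ := e₁
  obtain ⟨b₂, y⟩ := e₂
  obtain rfl : b₁ = b := h₁
  obtain rfl : b₂ = b₁ := h₂
  rw [totalAdd_mk, dualPair_mk, dualPair_mk, dualPair_mk, map_add]

theorem dualPair_totalSMul {Φ : DualTotal F E} (t : ℝ) {e : TotalSpace F E}
    (h : e.proj = Φ.proj) : dualPair Φ (totalSMul t e) = t * dualPair Φ e := by
  obtain ⟨b, Φ⟩ := Φ
  obtain ⟨b₁, x⟩ := e
  obtain rfl : b₁ = b := h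
  rw [totalSMul, dualPair_mk, dualPair_mk, map_smul, smul_eq_mul]

/-- Linear functionals on the fibres of a vector bundle of finite rank are continuous. -/
theorem continuous_of_linear_fibre [TopologicalSpace B] [TopologicalSpace (TotalSpace F E)]
    [FiberBundle F E] [VectorBundle ℝ F E] [FiniteDimensional ℝ F] {b : B} (l : E b →ₗ[ℝ] ℝ) :
    Continuous l := by
  let c := VectorBundle.continuousLinearEquivAt ℝ F E b
  have h : Continuous (l ∘ₗ c.symm.toLinearMap) := LinearMap.continuous_of_finiteDimensional _
  have h' := h.comp c.continuous
  refine h'.congr fun x => ?_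
  simp

end Total

/-! ### Morphisms of vector bundles, Lie algebroids and their morphisms -/

section Algebroid

variable
  {X : Type*} [NormedAddCommGroup X] [NormedSpace ℝ X] {HB : Type*} [TopologicalSpace HB]
  (I : ModelWithCorners ℝ X HB)
  {B : Type*} [TopologicalSpace B] [ChartedSpace HB B]
  (F : Type*) [NormedAddCommGroup F] [NormedSpace ℝ F]
  (E : B → Type*) [TopologicalSpace (TotalSpace F E)] [∀ b, TopologicalSpace (E b)]
  [∀ b, AddCommGroup (E b)] [∀ b, Module ℝ (E b)]
  [FiberBundle F E] [VectorBundle ℝ F E]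
  {X' : Type*} [NormedAddCommGroup X'] [NormedSpace ℝ X'] {HB' : Type*} [TopologicalSpace HB']
  (I' : ModelWithCorners ℝ X' HB')
  {B' : Type*} [TopologicalSpace B'] [ChartedSpace HB' B']
  {F' : Type*} [NormedAddCommGroup F'] [NormedSpace ℝ F']
  {E' : B' → Type*} [TopologicalSpace (TotalSpace F' E')] [∀ b, TopologicalSpace (E' b)]
  [∀ b, AddCommGroup (E' b)] [∀ b, Module ℝ (E' b)]
  [FiberBundle F' E'] [VectorBundle ℝ F' E']

/-- The derivative of a real function along a tangent vector. -/
def dirDeriv (f : B → ℝ) (b : B) (w : TangentSpace I b) : ℝ := mfderiv I 𝓘(ℝ, ℝ) f b w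

/-- A Lie algebroid structure on a smooth vector bundle `E → B`: an anchor `E → TB` (a smooth
vector bundle morphism over the identity) and a real Lie algebra structure on the smooth sections
of `E`, such that the anchor preserves brackets and `[ξ, f η] = f [ξ, η] + (a(ξ) f) η`. -/
structure LieAlgebroid [IsManifold I ∞ B] [ContMDiffVectorBundle ∞ F E I] where
  anchor : ∀ b : B, E b →ₗ[ℝ] TangentSpace I b
  anchor_smooth : ContMDiff (I.prod 𝓘(ℝ, F)) I.tangent ∞
    (fun e : TotalSpace F E => (⟨e.proj, anchor e.proj e.2⟩ : TangentBundle I B))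
  bracket : Cₛ^∞⟮I; F, E⟯ →ₗ[ℝ] Cₛ^∞⟮I; F, E⟯ →ₗ[ℝ] Cₛ^∞⟮I; F, E⟯
  bracket_self : ∀ ξ, bracket ξ ξ = 0
  jacobi : ∀ ξ η ζ,
    bracket ξ (bracket η ζ) = bracket (bracket ξ η) ζ + bracket η (bracket ξ ζ)
  anchor_bracket : ∀ ξ η b, anchor b (bracket ξ η b) =
    VectorField.mlieBracket I (fun b => anchor b (ξ b)) (fun b => anchor b (η b)) b
  leibniz : ∀ (ξ η η' : Cₛ^∞⟮I; F, E⟯) (f : C^∞⟮I, B; ℝ⟯), (∀ b, η' b = f b • η b) →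
    ∀ b, bracket ξ η' b = f b • bracket ξ η b + dirDeriv I f b (anchor b (ξ b)) • η b

variable {F E}

/-- `φ : E → E'` is a smooth morphism of vector bundles over `f : B → B'`. -/
structure IsVectorBundleHom (φ : TotalSpace F E → TotalSpace F' E') (f : B → B') : Prop where
  smooth_base : ContMDiff I I' ∞ f
  smooth : ContMDiff (I.prod 𝓘(ℝ, F)) (I'.prod 𝓘(ℝ, F')) ∞ φ
  proj : ∀ e, (φ e).proj = f e.proj
  add : ∀ e₁ e₂, e₁.proj = e₂.proj → φ (totalAdd e₁ e₂) = totalAdd (φ e₁) (φ e₂)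
  smul : ∀ (t : ℝ) e, φ (totalSMul t e) = totalSMul t (φ e)

variable {I I'} [IsManifold I ∞ B] [ContMDiffVectorBundle ∞ F E I]
  [IsManifold I' ∞ B'] [ContMDiffVectorBundle ∞ F' E' I']

/-- The anchor as a map of total spaces `E → TB`. -/
def LieAlgebroid.anchorMap (L : LieAlgebroid I F E) (e : TotalSpace F E) : TangentBundle I B :=
  ⟨e.proj, L.anchor e.proj e.2⟩

/-- The bracket condition of Higgins and Mackenzie along a map `f : N → B'` into the base of a Lie
algebroid `E' → B'`. Here `σ, τ, ρ : N → E'` are maps lying over `f`, and `U, W` are vector fields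
on `N` (the anchors of the sections that induce `σ` and `τ`). The condition says that whenever
`σ = ∑ uᵢ (ζᵢ ∘ f)` and `τ = ∑ vⱼ (θⱼ ∘ f)` with `uᵢ, vⱼ ∈ C^∞(N)` and `ζᵢ, θⱼ ∈ Γ(E')`, then
`ρ = ∑ uᵢ vⱼ ([ζᵢ, θⱼ] ∘ f) + ∑ U(vⱼ) (θⱼ ∘ f) - ∑ W(uᵢ) (ζᵢ ∘ f)`. -/
def LieAlgebroid.BracketAlong (L' : LieAlgebroid I' F' E')
    {Y : Type*} [NormedAddCommGroup Y] [NormedSpace ℝ Y] {HN : Type*} [TopologicalSpace HN]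
    (J : ModelWithCorners ℝ Y HN) {N : Type*} [TopologicalSpace N] [ChartedSpace HN N]
    (f : N → B') (U W : ∀ n : N, TangentSpace J n) (σ τ ρ : N → TotalSpace F' E') : Prop :=
  ∀ (p q : ℕ) (u : Fin p → C^∞⟮J, N; ℝ⟯) (ζ : Fin p → Cₛ^∞⟮I'; F', E'⟯)
    (v : Fin q → C^∞⟮J, N; ℝ⟯) (θ : Fin q → Cₛ^∞⟮I'; F', E'⟯),
    (∀ n, σ n = ⟨f n, ∑ i, u i n • ζ i (f n)⟩) →
    (∀ n, τ n = ⟨f n, ∑ j, v j n • θ j (f n)⟩) →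
    ∀ n, ρ n = ⟨f n, (∑ i, ∑ j, (u i n * v j n) • L'.bracket (ζ i) (θ j) (f n))
      + (∑ j, dirDeriv J (v j) n (U n) • θ j (f n))
      - ∑ i, dirDeriv J (u i) n (W n) • ζ i (f n)⟩

/-- `φ : E → E'` over `f : B → B'` is a morphism of Lie algebroids: a vector bundle morphism
which commutes with the anchors and satisfies the bracket condition for all `ξ, η ∈ Γ(E)`. -/
structure IsLieAlgebroidHom (L : LieAlgebroid I F E) (L' : LieAlgebroid I' F' E')
    (φ : TotalSpace F E → TotalSpace F' E') (f : B → B') : Prop where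
  isVectorBundleHom : IsVectorBundleHom I I' φ f
  anchor : ∀ e, tangentMap I I' f (L.anchorMap e) = L'.anchorMap (φ e)
  bracket : ∀ ξ η : Cₛ^∞⟮I; F, E⟯,
    L'.BracketAlong I f (fun b => L.anchor b (ξ b)) (fun b => L.anchor b (η b))
      (fun b => φ ⟨b, ξ b⟩) (fun b => φ ⟨b, η b⟩) (fun b => φ ⟨b, L.bracket ξ η b⟩)

end Algebroid

/-! ### Poisson structures -/

section Poisson

variable
  {Y : Type*} [NormedAddCommGroup Y] [NormedSpace ℝ Y] {HN : Type*} [TopologicalSpace HN]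
  (J : ModelWithCorners ℝ Y HN) (N : Type*) [TopologicalSpace N] [ChartedSpace HN N]

/-- A Poisson structure on a manifold `N`: a Lie bracket on `C^∞(N)` which is a derivation in
each argument. -/
structure PoissonStructure where
  bracket : C^∞⟮J, N; ℝ⟯ →ₗ[ℝ] C^∞⟮J, N; ℝ⟯ →ₗ[ℝ] C^∞⟮J, N; ℝ⟯
  bracket_self : ∀ f, bracket f f = 0
  jacobi : ∀ f g h,
    bracket f (bracket g h) = bracket (bracket f g) h + bracket g (bracket f h)
  leibniz : ∀ f g h, bracket f (g * h) = bracket f g * h + g * bracket f h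

variable {J N}
  {X : Type*} [NormedAddCommGroup X] [NormedSpace ℝ X] {HB : Type*} [TopologicalSpace HB]
  (I : ModelWithCorners ℝ X HB) {B : Type*} [TopologicalSpace B] [ChartedSpace HB B]

/-- Let `q : N → B` be the projection of a vector bundle, and let `lin F` say that the function
`F` is linear on the fibres of `q`. A Poisson structure on `N` is linear if the bracket of two
linear functions is linear, the bracket of a linear function and the pullback of a function on `B`
is the pullback of a function on `B`, and the bracket of two such pullbacks is zero. -/
structure PoissonStructure.IsLinear (P : PoissonStructure J N) (q : N → B)
    (lin : (N → ℝ) → Prop) : Prop where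
  linear_linear : ∀ F G : C^∞⟮J, N; ℝ⟯, lin F → lin G → lin (P.bracket F G)
  linear_pullback : ∀ (F G : C^∞⟮J, N; ℝ⟯) (g : C^∞⟮I, B; ℝ⟯), lin F → (∀ n, G n = g (q n)) →
    ∃ h : C^∞⟮I, B; ℝ⟯, ∀ n, P.bracket F G n = h (q n)
  pullback_pullback : ∀ (F G : C^∞⟮J, N; ℝ⟯) (f g : C^∞⟮I, B; ℝ⟯),
    (∀ n, F n = f (q n)) → (∀ n, G n = g (q n)) → P.bracket F G = 0

end Poisson

/-! ### The dual Poisson structure of a Lie algebroid -/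

section DualPoisson

variable
  {X : Type*} [NormedAddCommGroup X] [NormedSpace ℝ X] {HB : Type*} [TopologicalSpace HB]
  {I : ModelWithCorners ℝ X HB}
  {B : Type*} [TopologicalSpace B] [ChartedSpace HB B]
  {F : Type*} [NormedAddCommGroup F] [NormedSpace ℝ F]
  {E : B → Type*} [TopologicalSpace (TotalSpace F E)] [∀ b, TopologicalSpace (E b)]
  [∀ b, AddCommGroup (E b)] [∀ b, Module ℝ (E b)]
  [FiberBundle F E] [VectorBundle ℝ F E]
  [IsManifold I ∞ B] [ContMDiffVectorBundle ∞ F E I]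

/-- The function `ℓ_ξ : E* → ℝ`, `Φ ↦ ⟨Φ, ξ⟩`, of a section `ξ` of `E`. -/
def sectionFunction (ξ : Cₛ^∞⟮I; F, E⟯) :
    C^∞⟮I.prod 𝓘(ℝ, F →L[ℝ] ℝ), DualTotal F E; ℝ⟯ :=
  ⟨fun Φ => Φ.2 (ξ Φ.proj), by
    have h₁ : ContMDiff (I.prod 𝓘(ℝ, F →L[ℝ] ℝ)) I ∞ (fun Φ : DualTotal F E => Φ.proj) :=
      contMDiff_proj _
    have h₂ : ContMDiff (I.prod 𝓘(ℝ, F →L[ℝ] ℝ)) (I.prod 𝓘(ℝ, ℝ)) ∞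
        (fun Φ : DualTotal F E => TotalSpace.mk' ℝ (E := Bundle.Trivial B ℝ) Φ.proj
          (Φ.2 (ξ Φ.proj))) :=
      ContMDiff.clm_bundle_apply (F₁ := F) (F₂ := ℝ) (E₂ := Bundle.Trivial B ℝ)
        (b := fun Φ : DualTotal F E => Φ.proj) (ϕ := fun Φ => Φ.2)
        (v := fun Φ => ξ Φ.proj) contMDiff_id (ξ.contMDiff.comp h₁)
    intro Φ
    exact (contMDiffAt_totalSpace.1 (h₂ Φ)).2⟩

/-- The pullback `f ∘ q` to `E*` of a function `f` on the base. -/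
def basePullback (f : C^∞⟮I, B; ℝ⟯) :
    C^∞⟮I.prod 𝓘(ℝ, F →L[ℝ] ℝ), DualTotal F E; ℝ⟯ :=
  ⟨fun Φ => f Φ.proj, f.contMDiff.comp (contMDiff_proj _)⟩

/-- `P` is the Poisson structure on `E*` dual to the Lie algebroid `E`: the (unique) Poisson
structure with `{ℓ_ξ, ℓ_η} = ℓ_[ξ, η]`, `{ℓ_ξ, f ∘ q} = a(ξ)(f) ∘ q` and `{f ∘ q, g ∘ q} = 0`. -/
structure LieAlgebroid.IsDualPoisson (L : LieAlgebroid I F E)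
    (P : PoissonStructure (I.prod 𝓘(ℝ, F →L[ℝ] ℝ)) (DualTotal F E)) : Prop where
  section_section : ∀ ξ η : Cₛ^∞⟮I; F, E⟯,
    P.bracket (sectionFunction ξ) (sectionFunction η) = sectionFunction (L.bracket ξ η)
  section_base : ∀ (ξ : Cₛ^∞⟮I; F, E⟯) (f : C^∞⟮I, B; ℝ⟯) (Φ : DualTotal F E),
    P.bracket (sectionFunction ξ) (basePullback f) Φ =
      dirDeriv I f Φ.proj (L.anchor Φ.proj (ξ Φ.proj))
  base_base : ∀ f g : C^∞⟮I, B; ℝ⟯,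
    P.bracket (basePullback (F := F) (E := E) f) (basePullback g) = 0

end DualPoisson

/-! ### Double vector bundles -/

section Double

variable
  (X : Type*) [NormedAddCommGroup X] [NormedSpace ℝ X]
  {M : Type*} [TopologicalSpace M] [ChartedSpace X M]
  (FH : Type*) [NormedAddCommGroup FH] [NormedSpace ℝ FH]
  (H : M → Type*) [TopologicalSpace (TotalSpace FH H)] [∀ m, TopologicalSpace (H m)]
  [∀ m, AddCommGroup (H m)] [∀ m, Module ℝ (H m)] [FiberBundle FH H] [VectorBundle ℝ FH H]
  (FV : Type*) [NormedAddCommGroup FV] [NormedSpace ℝ FV]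
  (V : M → Type*) [TopologicalSpace (TotalSpace FV V)] [∀ m, TopologicalSpace (V m)]
  [∀ m, AddCommGroup (V m)] [∀ m, Module ℝ (V m)] [FiberBundle FV V] [VectorBundle ℝ FV V]
  (FA : Type*) [NormedAddCommGroup FA] [NormedSpace ℝ FA]
  (A : TotalSpace FH H → Type*) [TopologicalSpace (TotalSpace FA A)]
  [∀ x, TopologicalSpace (A x)] [∀ x, AddCommGroup (A x)] [∀ x, Module ℝ (A x)]
  [FiberBundle FA A] [VectorBundle ℝ FA A]
  (FA' : Type*) [NormedAddCommGroup FA'] [NormedSpace ℝ FA']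
  (A' : TotalSpace FV V → Type*) [TopologicalSpace (TotalSpace FA' A')]
  [∀ v, TopologicalSpace (A' v)] [∀ v, AddCommGroup (A' v)] [∀ v, Module ℝ (A' v)]
  [FiberBundle FA' A'] [VectorBundle ℝ FA' A']

/-- A double vector bundle with side bundles `H → M` and `V → M`. The manifold `𝒜` is the total
space of the vector bundle `A → H` (the vertical structure); the second vector bundle structure
`𝒜 → V` (the horizontal structure) is a vector bundle `A' → V` whose total space is identified
with `𝒜` by the diffeomorphism `toHor`. The projection, the addition and the scalar multiplication
of each of the two structures are vector bundle morphisms with respect to the other one. -/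
structure DoubleVectorBundle where
  toHor : TotalSpace FA A ≃ₘ⟮(𝓘(ℝ, X).prod 𝓘(ℝ, FH)).prod 𝓘(ℝ, FA),
    (𝓘(ℝ, X).prod 𝓘(ℝ, FV)).prod 𝓘(ℝ, FA')⟯ TotalSpace FA' A'
  /-- The two composite projections `𝒜 → M` agree. -/
  square : ∀ ξ, (toHor ξ).proj.proj = ξ.proj.proj
  /-- The projection of `𝒜 → V` is linear from `𝒜 → H` to `V → M`. -/
  projHor_add : ∀ ξ η, ξ.proj = η.proj →
    (toHor (totalAdd ξ η)).proj = totalAdd (toHor ξ).proj (toHor η).proj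
  projHor_smul : ∀ (t : ℝ) ξ, (toHor (totalSMul t ξ)).proj = totalSMul t (toHor ξ).proj
  /-- The projection of `𝒜 → H` is linear from `𝒜 → V` to `H → M`. -/
  projVer_add : ∀ ξ η, (toHor ξ).proj = (toHor η).proj →
    (toHor.symm (totalAdd (toHor ξ) (toHor η))).proj = totalAdd ξ.proj η.proj
  projVer_smul : ∀ (t : ℝ) ξ, (toHor.symm (totalSMul t (toHor ξ))).proj = totalSMul t ξ.proj
  /-- The interchange law: each addition is additive for the other one. -/
  interchange : ∀ ξ₁ ξ₂ ξ₃ ξ₄, ξ₁.proj = ξ₂.proj → ξ₃.proj = ξ₄.proj →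
    (toHor ξ₁).proj = (toHor ξ₃).proj → (toHor ξ₂).proj = (toHor ξ₄).proj →
    toHor.symm (totalAdd (toHor (totalAdd ξ₁ ξ₂)) (toHor (totalAdd ξ₃ ξ₄))) =
      totalAdd (toHor.symm (totalAdd (toHor ξ₁) (toHor ξ₃)))
        (toHor.symm (totalAdd (toHor ξ₂) (toHor ξ₄)))
  /-- Vertical scalar multiplication is additive for the horizontal addition. -/
  smulVer_addHor : ∀ (t : ℝ) ξ η, (toHor ξ).proj = (toHor η).proj →
    totalSMul t (toHor.symm (totalAdd (toHor ξ) (toHor η))) =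
      toHor.symm (totalAdd (toHor (totalSMul t ξ)) (toHor (totalSMul t η)))
  /-- Horizontal scalar multiplication is additive for the vertical addition. -/
  smulHor_addVer : ∀ (t : ℝ) ξ η, ξ.proj = η.proj →
    toHor.symm (totalSMul t (toHor (totalAdd ξ η))) =
      totalAdd (toHor.symm (totalSMul t (toHor ξ))) (toHor.symm (totalSMul t (toHor η)))
  /-- The two scalar multiplications commute. -/
  smul_comm : ∀ (s t : ℝ) ξ, totalSMul s (toHor.symm (totalSMul t (toHor ξ))) =
    toHor.symm (totalSMul t (toHor (totalSMul s ξ)))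

namespace DoubleVectorBundle

variable {X FH H FV V FA A FA' A'} (𝒟 : DoubleVectorBundle X FH H FV V FA A FA' A')

/-- The projection `𝒜 → V` of the horizontal structure. -/
def projHor (ξ : TotalSpace FA A) : TotalSpace FV V := (𝒟.toHor ξ).proj

/-- The addition in `𝒜 → V`. -/
def addHor (ξ η : TotalSpace FA A) : TotalSpace FA A :=
  𝒟.toHor.symm (totalAdd (𝒟.toHor ξ) (𝒟.toHor η))

/-- The scalar multiplication in `𝒜 → V`. -/
def smulHor (t : ℝ) (ξ : TotalSpace FA A) : TotalSpace FA A :=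
  𝒟.toHor.symm (totalSMul t (𝒟.toHor ξ))

/-- The zero section of `𝒜 → V`. -/
def zeroHor (v : TotalSpace FV V) : TotalSpace FA A := 𝒟.toHor.symm (zeroSection FA' A' v)

/-! #### The core -/

section Core

variable (FK : Type*) [NormedAddCommGroup FK] [NormedSpace ℝ FK]
  (K : M → Type*) [TopologicalSpace (TotalSpace FK K)] [∀ m, TopologicalSpace (K m)]
  [∀ m, AddCommGroup (K m)] [∀ m, Module ℝ (K m)] [FiberBundle FK K] [VectorBundle ℝ FK K]

/-- An identification `k ↦ k̄` of a vector bundle `K → M` with the core of `𝒜`, that is, with the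
intersection of the kernels of the two projections of `𝒜` (the set of the elements of `𝒜` which
project to zeros of `H` and of `V`), with the vector bundle structure over `M` that the structures
of `𝒜` induce on it. -/
structure Core where
  incl : TotalSpace FK K → TotalSpace FA A
  smooth : ContMDiff (𝓘(ℝ, X).prod 𝓘(ℝ, FK)) ((𝓘(ℝ, X).prod 𝓘(ℝ, FH)).prod 𝓘(ℝ, FA)) ∞ incl
  injective : Function.Injective incl
  proj : ∀ k, (incl k).proj = zeroSection FH H k.proj
  projHor : ∀ k, 𝒟.projHor (incl k) = zeroSection FV V k.proj
  surjective : ∀ (m : M) (ξ : TotalSpace FA A), ξ.proj = zeroSection FH H m →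
    𝒟.projHor ξ = zeroSection FV V m → ∃ k, incl k = ξ
  add : ∀ k l, k.proj = l.proj → incl (totalAdd k l) = totalAdd (incl k) (incl l)
  smul : ∀ (t : ℝ) k, incl (totalSMul t k) = totalSMul t (incl k)

end Core

/-! #### `LA`-vector bundles -/

section LA

variable [IsManifold 𝓘(ℝ, X) ∞ M] [ContMDiffVectorBundle ∞ FH H 𝓘(ℝ, X)]
  [ContMDiffVectorBundle ∞ FV V 𝓘(ℝ, X)]
  [ContMDiffVectorBundle ∞ FA A (𝓘(ℝ, X).prod 𝓘(ℝ, FH))]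

variable (FH H) in
/-- The base `H ×_M H` of the vector bundle `𝒜 ×_V 𝒜 → H ×_M H`. -/
abbrev SideSum : Type _ := TotalSpace (FH × FH) (H ×ᵇ H)

/-- The first projection `H ×_M H → H`. -/
def sideFst (n : SideSum FH H) : TotalSpace FH H := ⟨n.proj, n.2.1⟩

/-- The second projection `H ×_M H → H`. -/
def sideSnd (n : SideSum FH H) : TotalSpace FH H := ⟨n.proj, n.2.2⟩

/-- The addition `H ×_M H → H`. -/
def sideAdd (n : SideSum FH H) : TotalSpace FH H := ⟨n.proj, n.2.1 + n.2.2⟩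

/-- `(σ₁, σ₂)` is a smooth section of the vector bundle `𝒜 ×_V 𝒜 → H ×_M H`. -/
structure IsFibreProductSection (σ₁ σ₂ : SideSum FH H → TotalSpace FA A) : Prop where
  smooth_fst : ContMDiff (𝓘(ℝ, X).prod 𝓘(ℝ, FH × FH))
    ((𝓘(ℝ, X).prod 𝓘(ℝ, FH)).prod 𝓘(ℝ, FA)) ∞ σ₁
  smooth_snd : ContMDiff (𝓘(ℝ, X).prod 𝓘(ℝ, FH × FH))
    ((𝓘(ℝ, X).prod 𝓘(ℝ, FH)).prod 𝓘(ℝ, FA)) ∞ σ₂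
  proj_fst : ∀ n, (σ₁ n).proj = sideFst n
  proj_snd : ∀ n, (σ₂ n).proj = sideSnd n
  projHor_eq : ∀ n, 𝒟.projHor (σ₁ n) = 𝒟.projHor (σ₂ n)

/-- The vector field `U` on `H ×_M H` is the anchor of the section `(σ₁, σ₂)` of `𝒜 ×_V 𝒜`. -/
def IsFibreProductAnchor (L : LieAlgebroid (𝓘(ℝ, X).prod 𝓘(ℝ, FH)) FA A)
    (σ₁ σ₂ : SideSum FH H → TotalSpace FA A)
    (U : ∀ n : SideSum FH H, TangentSpace (𝓘(ℝ, X).prod 𝓘(ℝ, FH × FH)) n) : Prop :=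
  ∀ n, tangentMap (𝓘(ℝ, X).prod 𝓘(ℝ, FH × FH)) (𝓘(ℝ, X).prod 𝓘(ℝ, FH)) sideFst ⟨n, U n⟩ =
      L.anchorMap (σ₁ n) ∧
    tangentMap (𝓘(ℝ, X).prod 𝓘(ℝ, FH × FH)) (𝓘(ℝ, X).prod 𝓘(ℝ, FH)) sideSnd ⟨n, U n⟩ =
      L.anchorMap (σ₂ n)

/-- The horizontal addition `𝒜 ×_V 𝒜 → 𝒜`, over `H ×_M H → H`, is a morphism of Lie algebroids.
The Lie algebroid structure of the fibre product `𝒜 ×_V 𝒜` is the one for which both projections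
to `𝒜` are morphisms: the anchor is given componentwise, and the bracket of the sections
`(σ₁, σ₂)` and `(τ₁, τ₂)` is the section `(ρ₁, ρ₂)` that satisfies the bracket condition along
both projections `H ×_M H → H`. -/
structure AddHorIsLieAlgebroidHom (L : LieAlgebroid (𝓘(ℝ, X).prod 𝓘(ℝ, FH)) FA A) : Prop where
  anchor : ∀ (ξ η : TotalSpace FA A)
    (w : TangentBundle (𝓘(ℝ, X).prod 𝓘(ℝ, FH × FH)) (SideSum FH H)),
    𝒟.projHor ξ = 𝒟.projHor η →
    tangentMap (𝓘(ℝ, X).prod 𝓘(ℝ, FH × FH)) (𝓘(ℝ, X).prod 𝓘(ℝ, FH)) sideFst w =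
      L.anchorMap ξ →
    tangentMap (𝓘(ℝ, X).prod 𝓘(ℝ, FH × FH)) (𝓘(ℝ, X).prod 𝓘(ℝ, FH)) sideSnd w =
      L.anchorMap η →
    tangentMap (𝓘(ℝ, X).prod 𝓘(ℝ, FH × FH)) (𝓘(ℝ, X).prod 𝓘(ℝ, FH)) sideAdd w =
      L.anchorMap (𝒟.addHor ξ η)
  bracket : ∀ (σ₁ σ₂ τ₁ τ₂ ρ₁ ρ₂ : SideSum FH H → TotalSpace FA A)
    (U W : ∀ n : SideSum FH H, TangentSpace (𝓘(ℝ, X).prod 𝓘(ℝ, FH × FH)) n),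
    𝒟.IsFibreProductSection σ₁ σ₂ → 𝒟.IsFibreProductSection τ₁ τ₂ →
    𝒟.IsFibreProductSection ρ₁ ρ₂ →
    IsFibreProductAnchor L σ₁ σ₂ U → IsFibreProductAnchor L τ₁ τ₂ W →
    L.BracketAlong (𝓘(ℝ, X).prod 𝓘(ℝ, FH × FH)) sideFst U W σ₁ τ₁ ρ₁ →
    L.BracketAlong (𝓘(ℝ, X).prod 𝓘(ℝ, FH × FH)) sideSnd U W σ₂ τ₂ ρ₂ →
    L.BracketAlong (𝓘(ℝ, X).prod 𝓘(ℝ, FH × FH)) sideAdd U W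
      (fun n => 𝒟.addHor (σ₁ n) (σ₂ n)) (fun n => 𝒟.addHor (τ₁ n) (τ₂ n))
      (fun n => 𝒟.addHor (ρ₁ n) (ρ₂ n))

/-- A double vector bundle with Lie algebroid structures on `𝒜 → H` and `V → M` is an
`LA`-vector bundle if the structure maps of `𝒜 → V`, over those of `H → M`, are morphisms of Lie
algebroids. -/
structure IsLAVectorBundle (L : LieAlgebroid (𝓘(ℝ, X).prod 𝓘(ℝ, FH)) FA A)
    (LV : LieAlgebroid 𝓘(ℝ, X) FV V) : Prop where
  proj : IsLieAlgebroidHom L LV 𝒟.projHor TotalSpace.proj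
  zero : IsLieAlgebroidHom LV L 𝒟.zeroHor (zeroSection FH H)
  add : 𝒟.AddHorIsLieAlgebroidHom L
  smul : ∀ t : ℝ, IsLieAlgebroidHom L L (𝒟.smulHor t) (totalSMul t)

end LA

/-! #### The second vector bundle structure on the vertical dual -/

section VerticalDual

theorem projHor_zero (x : TotalSpace FH H) :
    𝒟.projHor (zeroSection FA A x) = zeroSection FV V x.proj := by
  have h := 𝒟.projHor_smul 0 (zeroSection FA A x)
  rw [totalSMul_zero, totalSMul_zero, 𝒟.square] at h
  exact h

variable {𝒟} {FK : Type*} [NormedAddCommGroup FK] [NormedSpace ℝ FK]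
  {K : M → Type*} [TopologicalSpace (TotalSpace FK K)] [∀ m, TopologicalSpace (K m)]
  [∀ m, AddCommGroup (K m)] [∀ m, Module ℝ (K m)] [FiberBundle FK K] [VectorBundle ℝ FK K]
  (C : 𝒟.Core FK K)

namespace Core

/-- The element `0_x + k̄` of the fibre of `𝒜 → H` over `x ∈ H_m`, for `k ∈ K_m`, where `0_x` is
the zero of `𝒜 → H` over `x` and the addition is that of `𝒜 → V`. -/
def translate (x : TotalSpace FH H) (k : K x.proj) : TotalSpace FA A :=
  𝒟.addHor (zeroSection FA A x) (C.incl ⟨x.proj, k⟩)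

theorem translate_projHor (x : TotalSpace FH H) (k : K x.proj) :
    𝒟.projHor (zeroSection FA A x) = 𝒟.projHor (C.incl ⟨x.proj, k⟩) := by
  rw [projHor_zero, C.projHor]

theorem translate_proj (x : TotalSpace FH H) (k : K x.proj) : (C.translate x k).proj = x := by
  refine (𝒟.projVer_add _ _ (C.translate_projHor x k)).trans ?_
  rw [C.proj]
  exact (totalAdd_mk x.proj x.2 0).trans (by rw [add_zero])

theorem translate_add (x : TotalSpace FH H) (k l : K x.proj) :
    C.translate x (k + l) = totalAdd (C.translate x k) (C.translate x l) := by
  have h := 𝒟.interchange (zeroSection FA A x) (zeroSection FA A x)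
    (C.incl ⟨x.proj, k⟩) (C.incl ⟨x.proj, l⟩) rfl (by rw [C.proj, C.proj])
    (C.translate_projHor x k) (C.translate_projHor x l)
  have h0 : totalAdd (zeroSection FA A x) (zeroSection FA A x) = zeroSection FA A x :=
    (totalAdd_mk x 0 0).trans (by rw [add_zero]; rfl)
  have hk : totalAdd (⟨x.proj, k⟩ : TotalSpace FK K) ⟨x.proj, l⟩ = ⟨x.proj, k + l⟩ :=
    totalAdd_mk _ _ _
  rw [← C.add ⟨x.proj, k⟩ ⟨x.proj, l⟩ rfl, hk, h0] at h
  exact h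

theorem translate_smul (x : TotalSpace FH H) (t : ℝ) (k : K x.proj) :
    C.translate x (t • k) = totalSMul t (C.translate x k) := by
  have h := 𝒟.smulVer_addHor t (zeroSection FA A x) (C.incl ⟨x.proj, k⟩)
    (C.translate_projHor x k)
  rw [← C.smul] at h
  have h0 : totalSMul t (zeroSection FA A x) = zeroSection FA A x :=
    congrArg (TotalSpace.mk x) (smul_zero t)
  rw [h0] at h
  exact h.symm

/-- The linear functional `k ↦ ⟨Φ, 0_x + k̄⟩` on `K_m`, where `Φ` is an element of the dual of the
fibre of `𝒜 → H` over `x ∈ H_m`. -/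
def dualProjFun (Φ : DualTotal FA A) : K Φ.proj.proj →ₗ[ℝ] ℝ where
  toFun k := dualPair Φ (C.translate Φ.proj k)
  map_add' k l := by
    rw [C.translate_add]
    exact dualPair_totalAdd (C.translate_proj _ _) (C.translate_proj _ _)
  map_smul' t k := by
    rw [C.translate_smul]
    exact dualPair_totalSMul t (C.translate_proj _ _)

variable [FiniteDimensional ℝ FK]

/-- The projection `𝒜^{*V} → K*` of the second vector bundle structure on the dual `𝒜^{*V}` of
the vertical bundle `𝒜 → H`: it maps `Φ` to the functional `k ↦ ⟨Φ, 0_x + k̄⟩`. -/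
def dualProj (Φ : DualTotal FA A) : DualTotal FK K :=
  ⟨Φ.proj.proj, ⟨C.dualProjFun Φ, continuous_of_linear_fibre (F := FK) (C.dualProjFun Φ)⟩⟩

/-- `Φ₃` is the sum of `Φ₁` and `Φ₂` in `𝒜^{*V} → K*`: here `Φ₁` and `Φ₂` lie over the same point
of `K*`, and `⟨Φ₃, ξ₁ + ξ₂⟩ = ⟨Φ₁, ξ₁⟩ + ⟨Φ₂, ξ₂⟩` for all `ξ₁`, `ξ₂` for which the sum `ξ₁ + ξ₂`
in `𝒜 → V` is defined and which lie over the same points of `H` as `Φ₁` and `Φ₂`. -/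
structure IsDualSum (Φ₁ Φ₂ Φ₃ : DualTotal FA A) : Prop where
  dualProj_eq : C.dualProj Φ₁ = C.dualProj Φ₂
  proj : Φ₃.proj = totalAdd Φ₁.proj Φ₂.proj
  pair : ∀ ξ₁ ξ₂ : TotalSpace FA A, ξ₁.proj = Φ₁.proj → ξ₂.proj = Φ₂.proj →
    𝒟.projHor ξ₁ = 𝒟.projHor ξ₂ →
    dualPair Φ₃ (𝒟.addHor ξ₁ ξ₂) = dualPair Φ₁ ξ₁ + dualPair Φ₂ ξ₂

/-- `Φ'` is the product of `t` and `Φ` in `𝒜^{*V} → K*`: it lies over the same point of `K*`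
as `Φ`, and `⟨Φ', t ξ⟩ = t ⟨Φ, ξ⟩` where `t ξ` is the scalar multiple in `𝒜 → V`. -/
structure IsDualSMul (t : ℝ) (Φ Φ' : DualTotal FA A) : Prop where
  dualProj_eq : C.dualProj Φ' = C.dualProj Φ
  proj : Φ'.proj = totalSMul t Φ.proj
  pair : ∀ ξ : TotalSpace FA A, ξ.proj = Φ.proj →
    dualPair Φ' (𝒟.smulHor t ξ) = t * dualPair Φ ξ

/-- The function `f` on `𝒜^{*V}` is linear on the fibres of `𝒜^{*V} → K*`. -/
structure IsDualLinear (f : DualTotal FA A → ℝ) : Prop where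
  add : ∀ Φ₁ Φ₂ Φ₃, C.IsDualSum Φ₁ Φ₂ Φ₃ → f Φ₃ = f Φ₁ + f Φ₂
  smul : ∀ (t : ℝ) Φ Φ', C.IsDualSMul t Φ Φ' → f Φ' = t * f Φ

end Core

end VerticalDual

end DoubleVectorBundle

end Double

end

/-!
The dual Poisson structure of an `LA`-vector bundle is linear over `K*` because a bundle structure
can be read off from its scalar multiplication. Let `h_t` be scalar multiplication by `t ≠ 0` in
`𝒜^{*V} → K*`. It is the composite of fibrewise multiplication by `t` in `𝒜^{*V} → H` with the dual
of the horizontal scalar multiplication of `𝒜`, which is an automorphism of the Lie algebroid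
`𝒜 → H`. The dual of an automorphism preserves the Poisson structure and the fibrewise
multiplication scales it, so `{F ∘ h_t, G ∘ h_t} = t {F, G} ∘ h_t`
(`DoubleVectorBundle.bracket_comp_dualSMul`). This is verified on the functions `ℓ_ξ` and `f ∘ q`;
it suffices to do so since the difference of both sides is a point derivation in `F` and in `G`,
and by Hadamard's lemma a point derivation that vanishes on these functions is zero
(`dual_pointDerivation_eq_zero`).

Functions that are linear on the fibres of `𝒜^{*V} → K*` satisfy `F ∘ h_t = t F`, and pullbacks
satisfy `G ∘ h_t = G`. Hence the bracket of two linear functions is again homogeneous of degree one,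
the bracket of a linear function with a pullback is invariant, and the bracket of two pullbacks
satisfies `{F, G} = t {F, G} ∘ h_t`. In the last case the right-hand side tends to zero with `t`.

In the other two cases homogeneity has to be turned back into linearity, and invariance into
descent to `K*`. This uses that linear combinations `s Φ₁ + t Φ₂` in a fibre of `𝒜^{*V} → K*` depend
smoothly on `(s, t)` near zero (`DoubleVectorBundle.Core.exists_dual_comb`): a smooth homogeneous
function agrees along them with its derivative at zero, and an invariant function has the same value
at `Φ` as at the zero of its fibre. As the zeros form a smooth section
(`DoubleVectorBundle.Core.exists_contMDiff_isDualZero`), the function on `K*` so obtained is smooth.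
Both facts are proved with frames of `𝒜 → H` built from the double vector bundle structure, the
existence of which rests on the surjectivity of `𝒜 → H ×_M V`
(`DoubleVectorBundle.exists_proj_projHor`).
-/

open Filter Topology MeasureTheory

set_option linter.unusedSectionVars false

/-! ### Point derivations -/

/-- **Hadamard's lemma**, coordinate-free. The factor is `G y = ∫₀¹ f'(x₀ + s (y - x₀)) ds`. It is
written as the value at `0` of the convolution of the indicator function of `[0, 1]` with a
compactly supported function of `s`, because convolutions depend smoothly on parameters. -/
theorem exists_contDiff_eq_add_apply_sub {E : Type*} [NormedAddCommGroup E] [NormedSpace ℝ E]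
    {f : E → ℝ} (hf : ContDiff ℝ ∞ f) (x₀ : E) :
    ∃ G : E → (E →L[ℝ] ℝ), ContDiff ℝ ∞ G ∧ ∀ y, f y = f x₀ + G y (y - x₀) := by
  -- the cutoff equals `1` where the convolution needs it, and makes the support compact
  let χ : ContDiffBump (0 : ℝ) := ⟨2, 3, by norm_num, by norm_num⟩
  let g : E → ℝ → (E →L[ℝ] ℝ) := fun y s => χ s • fderiv ℝ f (x₀ - s • (y - x₀))
  let i : ℝ → ℝ := (Set.Icc (0 : ℝ) 1).indicator 1
  have hi : LocallyIntegrable i volume := by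
    apply Integrable.locallyIntegrable
    rw [integrable_indicator_iff measurableSet_Icc]
    exact integrableOn_const (by simp)
  have hg : ContDiff ℝ ∞ ↿g := by
    have h1 : ContDiff ℝ ∞ (fderiv ℝ f) := hf.fderiv_right (by simp)
    have h2 : ContDiff ℝ ∞ (χ : ℝ → ℝ) := χ.contDiff
    change ContDiff ℝ ∞ (fun p : E × ℝ => χ p.2 • fderiv ℝ f (x₀ - p.2 • (p.1 - x₀)))
    fun_prop
  have hG := contDiffOn_convolution_right_with_param_comp (n := ⊤) (μ := volume)
    (ContinuousLinearMap.lsmul ℝ ℝ : ℝ →L[ℝ] (E →L[ℝ] ℝ) →L[ℝ] (E →L[ℝ] ℝ))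
    (v := fun _ : E => (0 : ℝ)) contDiffOn_const (f := i) (g := g) isOpen_univ
    (isCompact_closedBall (0 : ℝ) 3) (fun p x _ hx => by
      have : χ x = 0 := χ.zero_of_le_dist (by
        simp only [Metric.mem_closedBall, not_le] at hx
        exact hx.le)
      simp [g, this]) hi hg.contDiffOn
  rw [contDiffOn_univ] at hG
  refine ⟨_, hG, fun y => ?_⟩
  have h1 : ∀ t : ℝ, HasDerivAt (fun t : ℝ => f (x₀ + t • (y - x₀)))
      (fderiv ℝ f (x₀ + t • (y - x₀)) (y - x₀)) t := fun t => by
    have h2 : HasDerivAt (fun t : ℝ => x₀ + t • (y - x₀)) (y - x₀) t := by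
      simpa using ((hasDerivAt_id t).smul_const (y - x₀)).const_add x₀
    exact (hf.differentiable (by simp) _).hasFDerivAt.comp_hasDerivAt t h2
  have hc : Continuous (fun t : ℝ => fderiv ℝ f (x₀ + t • (y - x₀))) :=
    (hf.continuous_fderiv (by simp)).comp (by fun_prop)
  have h3 := intervalIntegral.integral_eq_sub_of_hasDerivAt (a := 0) (b := 1) (fun t _ => h1 t)
    ((hc.clm_apply continuous_const).intervalIntegrable _ _)
  have h4 : (convolution i (g y) (ContinuousLinearMap.lsmul ℝ ℝ) volume) 0 =
      ∫ t in (0 : ℝ)..1, fderiv ℝ f (x₀ + t • (y - x₀)) := by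
    rw [intervalIntegral.integral_of_le zero_le_one, ← integral_Icc_eq_integral_Ioc,
      ← integral_indicator measurableSet_Icc]
    refine integral_congr_ae (Eventually.of_forall fun t => ?_)
    by_cases ht : t ∈ Set.Icc (0 : ℝ) 1
    · have : χ (-t) = 1 := χ.one_of_mem_closedBall (by
        simp only [Metric.mem_closedBall, dist_zero_right, norm_neg, Real.norm_eq_abs]
        rw [abs_of_nonneg ht.1]
        exact ht.2.trans (by norm_num [χ]))
      simp [i, g, ht, this]
    · simp [i, ht]
  rw [h4, ContinuousLinearMap.intervalIntegral_apply (hc.intervalIntegrable _ _), h3]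
  simp

section PointDerivation

variable {Y : Type*} [NormedAddCommGroup Y] [NormedSpace ℝ Y] [FiniteDimensional ℝ Y]
  {HN : Type*} [TopologicalSpace HN] {J : ModelWithCorners ℝ Y HN}
  {N : Type*} [TopologicalSpace N] [ChartedSpace HN N] [IsManifold J ∞ N] [T2Space N]

/-- Germs of smooth functions extend to global smooth functions. -/
theorem exists_contMDiffMap_eventuallyEq {u : Set N} (hu : IsOpen u) {p : N} (hp : p ∈ u)
    {f : N → ℝ} (hf : ContMDiffOn J 𝓘(ℝ, ℝ) ∞ f u) :
    ∃ g : C^∞⟮J, N; ℝ⟯, g =ᶠ[𝓝 p] f := by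
  obtain ⟨χ, -, hχ⟩ := (SmoothBumpFunction.nhds_basis_tsupport (I := J) p).mem_iff.1
    (hu.mem_nhds hp)
  refine ⟨⟨fun x => χ x • f x, fun x => ?_⟩, ?_⟩
  · by_cases hx : x ∈ tsupport χ
    · exact χ.contMDiffAt.smul (hf.contMDiffAt (hu.mem_nhds (hχ hx)))
    · refine contMDiffAt_const (c := (0 : ℝ)) |>.congr_of_eventuallyEq ?_
      filter_upwards [(isClosed_tsupport χ).isOpen_compl.mem_nhds hx] with y hy
      simp [image_eq_zero_of_notMem_tsupport hy]
  · filter_upwards [χ.eventuallyEq_one] with x hx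
    change χ x • f x = f x
    simp [hx]

variable {p : N} {d : C^∞⟮J, N; ℝ⟯ →ₗ[ℝ] ℝ}

/-- A point derivation only depends on germs: if `c` is a bump function at `p` supported where
`f = g`, then `c (f - g) = 0`, and the product rule at `p` gives `d (f - g) = 0`. -/
theorem pointDerivation_congr (hd : ∀ f g, d (f * g) = f p * d g + g p * d f)
    {f g : C^∞⟮J, N; ℝ⟯} (h : f =ᶠ[𝓝 p] g) : d f = d g := by
  rw [← sub_eq_zero, ← map_sub]
  obtain ⟨χ, -, hχ⟩ := (SmoothBumpFunction.nhds_basis_support (I := J) h).mem_iff.1 h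
  let c : C^∞⟮J, N; ℝ⟯ := ⟨χ, χ.contMDiff⟩
  have h0 : c * (f - g) = 0 := by
    ext x
    change χ x * (f x - g x) = 0
    by_cases hx : x ∈ Function.support χ
    · have : f x = g x := hχ hx
      rw [this, sub_self, mul_zero]
    · rw [Function.notMem_support.1 hx, zero_mul]
  have h1 := hd c (f - g)
  have h2 : (f - g) p = 0 := sub_eq_zero.2 h.self_of_nhds
  have h3 : c p = 1 := χ.eq_one
  rw [h0, map_zero, h2, h3] at h1
  linarith

/-- A point derivation that vanishes on the coordinates of a chart vanishes: by Hadamard's lemma,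
every function is, near `p`, a constant plus a sum of products of functions vanishing at `p` with
the increments of the coordinates. -/
theorem pointDerivation_eq_zero [J.Boundaryless]
    (hd : ∀ f g, d (f * g) = f p * d g + g p * d f)
    (h : ∀ (l : Y →L[ℝ] ℝ) (g : C^∞⟮J, N; ℝ⟯),
      g =ᶠ[𝓝 p] (fun y => l (extChartAt J p y)) → d g = 0) (f : C^∞⟮J, N; ℝ⟯) : d f = 0 := by
  have hone : d 1 = 0 := by
    have h1 := hd 1 1
    have h2 : (1 : C^∞⟮J, N; ℝ⟯) p = 1 := rfl
    rw [mul_one, h2] at h1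
    linarith
  set y₀ := extChartAt J p p with hy₀
  have hchart : ContMDiffOn J 𝓘(ℝ, Y) ∞ (extChartAt J p) (chartAt HN p).source :=
    contMDiffOn_extChartAt
  have hsrc : (chartAt HN p).source ∈ 𝓝 p := chart_source_mem_nhds HN p
  have hcont : Tendsto (extChartAt J p) (𝓝 p) (𝓝 y₀) := continuousAt_extChartAt p
  obtain ⟨F, hF⟩ := exists_contMDiffMap_eventuallyEq (J := 𝓘(ℝ, Y))
    (isOpen_extChartAt_target (I := J) p) (mem_extChartAt_target p)
    (f.contMDiff.comp_contMDiffOn (contMDiffOn_extChartAt_symm p))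
  obtain ⟨G, hG, hFG⟩ := exists_contDiff_eq_add_apply_sub F.contMDiff.contDiff y₀
  let b := Module.finBasis ℝ Y
  have hx : ∀ i, ∃ x : C^∞⟮J, N; ℝ⟯,
      x =ᶠ[𝓝 p] (fun y => LinearMap.toContinuousLinearMap (b.coord i) (extChartAt J p y)) :=
    fun i => exists_contMDiffMap_eventuallyEq (chartAt HN p).open_source (mem_chart_source HN p)
      ((ContinuousLinearMap.contMDiff _).comp_contMDiffOn hchart)
  have hg : ∀ i, ∃ g : C^∞⟮J, N; ℝ⟯, g =ᶠ[𝓝 p] (fun y => G (extChartAt J p y) (b i)) := fun i => by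
    refine exists_contMDiffMap_eventuallyEq (chartAt HN p).open_source (mem_chart_source HN p) ?_
    have : ContDiff ℝ ∞ (fun y => G y (b i)) := hG.clm_apply contDiff_const
    exact this.contMDiff.comp_contMDiffOn hchart
  choose x hx using hx
  choose g hg using hg
  have hloc : f =ᶠ[𝓝 p] ((F y₀) • (1 : C^∞⟮J, N; ℝ⟯) +
      ∑ i, (x i - (b.coord i y₀) • (1 : C^∞⟮J, N; ℝ⟯)) * g i : C^∞⟮J, N; ℝ⟯) := by
    filter_upwards [hcont.eventually hF, hsrc, eventually_all.2 hx, eventually_all.2 hg]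
      with y hy hys hxy hgy
    have h1 : f y = F (extChartAt J p y) := by
      rw [hy, Function.comp_apply, (extChartAt J p).left_inv (by rwa [extChartAt_source])]
    have hsum : ∀ s : Fin (Module.finrank ℝ Y) → C^∞⟮J, N; ℝ⟯, (∑ i, s i) y = ∑ i, s i y :=
      fun s => map_sum (ContMDiffMap.evalRingHom (I := J) y) s Finset.univ
    change _ = F y₀ * 1 + (∑ i, (x i - (b.coord i y₀) • (1 : C^∞⟮J, N; ℝ⟯)) * g i) y
    rw [hsum, h1, hFG, mul_one]
    congr 1
    conv_lhs => rw [← b.sum_repr (extChartAt J p y - y₀), map_sum]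
    refine Finset.sum_congr rfl fun i _ => ?_
    change _ = (x i y - b.coord i y₀ * 1) * g i y
    rw [hxy, hgy, map_smul]
    simp
  rw [pointDerivation_congr hd hloc, map_add, map_smul, hone, map_sum, smul_zero, zero_add]
  refine Finset.sum_eq_zero fun i _ => ?_
  have h0 : (x i - (b.coord i y₀) • (1 : C^∞⟮J, N; ℝ⟯)) p = 0 := by
    change x i p - b.coord i y₀ * 1 = 0
    rw [(hx i).self_of_nhds, mul_one]
    exact sub_self _
  rw [hd, h0, map_sub, map_smul, hone, h _ _ (hx i)]
  simp

end PointDerivation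

/-- The total space of a fibre bundle with Hausdorff base and fibre is Hausdorff. -/
theorem FiberBundle.t2Space_totalSpace {B F : Type*} {E : B → Type*} [TopologicalSpace B]
    [TopologicalSpace F] [TopologicalSpace (TotalSpace F E)] [∀ b, TopologicalSpace (E b)]
    [FiberBundle F E] [T2Space B] [T2Space F] : T2Space (TotalSpace F E) := by
  refine ⟨fun x y hxy => ?_⟩
  by_cases h : x.proj = y.proj
  · let e := trivializationAt F E x.proj
    have hx : x ∈ e.source := FiberBundle.mem_trivializationAt_proj_source
    have hy : y ∈ e.source := by
      rw [e.mem_source, ← h]; exact FiberBundle.mem_baseSet_trivializationAt' _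
    have hne : e x ≠ e y := fun h' => hxy (e.injOn hx hy h')
    obtain ⟨u, v, hu, hv, hxu, hyv, huv⟩ := t2_separation hne
    refine ⟨e.source ∩ e ⁻¹' u, e.source ∩ e ⁻¹' v,
      e.toOpenPartialHomeomorph.isOpen_inter_preimage hu,
      e.toOpenPartialHomeomorph.isOpen_inter_preimage hv, ⟨hx, hxu⟩, ⟨hy, hyv⟩, ?_⟩
    exact (huv.preimage e).mono Set.inter_subset_right Set.inter_subset_right
  · obtain ⟨u, v, hu, hv, hxu, hyv, huv⟩ := t2_separation h
    have hc := FiberBundle.continuous_proj F E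
    exact ⟨_, _, hu.preimage hc, hv.preimage hc, hxu, hyv, huv.preimage _⟩

/-! ### Generators of the functions on a dual bundle -/

section DualGenerators

variable
  {X : Type*} [NormedAddCommGroup X] [NormedSpace ℝ X] [FiniteDimensional ℝ X]
  {HB : Type*} [TopologicalSpace HB] {I : ModelWithCorners ℝ X HB}
  {B : Type*} [TopologicalSpace B] [ChartedSpace HB B] [T2Space B]
  {F : Type*} [NormedAddCommGroup F] [NormedSpace ℝ F] [FiniteDimensional ℝ F]
  {E : B → Type*} [TopologicalSpace (TotalSpace F E)] [∀ b, TopologicalSpace (E b)]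
  [∀ b, AddCommGroup (E b)] [∀ b, Module ℝ (E b)]
  [FiberBundle F E] [VectorBundle ℝ F E]
  [IsManifold I ∞ B] [ContMDiffVectorBundle ∞ F E I]

variable (I) in
/-- Every frame vector of a local trivialization extends to a global section. -/
theorem exists_contMDiffSection_eventuallyEq (b : B) (v : F) :
    ∃ ξ : Cₛ^∞⟮I; F, E⟯, ∀ᶠ y in 𝓝 b, ξ y = (trivializationAt F E b).symm y v := by
  let e := trivializationAt F E b
  have hb : b ∈ e.baseSet := FiberBundle.mem_baseSet_trivializationAt' b
  obtain ⟨χ, -, hχ⟩ := (SmoothBumpFunction.nhds_basis_tsupport (I := I) b).mem_iff.1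
    (e.open_baseSet.mem_nhds hb)
  have hs : ContMDiffOn I (I.prod 𝓘(ℝ, F)) ∞
      (fun y => TotalSpace.mk' F y (e.symm y v)) e.baseSet := by
    refine (e.contMDiffOn_symm.comp
      (contMDiffOn_id.prodMk (contMDiffOn_const (c := v))) fun y hy => ?_).congr fun y hy => ?_
    · exact e.mem_target.2 hy
    · exact (e.mk_symm hy v)
  refine ⟨⟨fun y => χ y • e.symm y v, ?_⟩, ?_⟩
  · exact ContMDiffOn.smul_section_of_tsupport χ.contMDiff.contMDiffOn e.open_baseSet hχ hs
  · filter_upwards [χ.eventuallyEq_one] with x hx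
    change χ x • e.symm x v = _
    simp [hx, e]

/-- In finite dimension every functional on the dual space is the evaluation at a vector. -/
theorem exists_eq_apply_of_finiteDimensional (l : (F →L[ℝ] ℝ) →ₗ[ℝ] ℝ) :
    ∃ v : F, ∀ ψ, l ψ = ψ v := by
  let l' : Module.Dual ℝ (Module.Dual ℝ F) :=
    l ∘ₗ (LinearMap.toContinuousLinearMap (𝕜 := ℝ) (E := F) (F' := ℝ)).toLinearMap
  refine ⟨(Module.evalEquiv ℝ F).symm l', fun ψ => ?_⟩
  have h := congrArg (fun m : Module.Dual ℝ (Module.Dual ℝ F) => m ψ.toLinearMap)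
    ((Module.evalEquiv ℝ F).apply_symm_apply l')
  rw [Module.evalEquiv_apply, Module.Dual.eval_apply] at h
  exact h.symm

theorem dual_extChartAt_fst (Φ Ψ : DualTotal F E) :
    (extChartAt (I.prod 𝓘(ℝ, F →L[ℝ] ℝ)) Φ Ψ).1 = extChartAt I Φ.proj Ψ.proj := by
  rw [FiberBundle.extChartAt]
  rfl

theorem dual_extChartAt_snd_apply {Φ Ψ : DualTotal F E}
    (h : Ψ.proj ∈ (trivializationAt F E Φ.proj).baseSet) (v : F) :
    (extChartAt (I.prod 𝓘(ℝ, F →L[ℝ] ℝ)) Φ Ψ).2 v =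
      Ψ.2 ((trivializationAt F E Φ.proj).symm Ψ.proj v) := by
  rw [FiberBundle.extChartAt]
  change (trivializationAt (F →L[ℝ] ℝ) (fun b => E b →L[ℝ] ℝ) Φ.proj Ψ).2 v = _
  rw [hom_trivializationAt_apply]
  simp [ContinuousLinearMap.inCoordinates, Trivialization.symmL_apply, h]

/-- The functions `ℓ_ξ` and `f ∘ q` generate the smooth functions on the dual bundle to first
order: a point derivation which vanishes on them vanishes. -/
theorem dual_pointDerivation_eq_zero [I.Boundaryless] {p : DualTotal F E}
    {d : C^∞⟮I.prod 𝓘(ℝ, F →L[ℝ] ℝ), DualTotal F E; ℝ⟯ →ₗ[ℝ] ℝ}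
    (hd : ∀ f g, d (f * g) = f p * d g + g p * d f)
    (hsec : ∀ ξ : Cₛ^∞⟮I; F, E⟯, d (sectionFunction ξ) = 0)
    (hbase : ∀ f : C^∞⟮I, B; ℝ⟯, d (basePullback f) = 0)
    (f : C^∞⟮I.prod 𝓘(ℝ, F →L[ℝ] ℝ), DualTotal F E; ℝ⟯) : d f = 0 := by
  have : T2Space (DualTotal F E) := FiberBundle.t2Space_totalSpace
  refine pointDerivation_eq_zero hd (fun l g hg => ?_) f
  obtain ⟨v, hv⟩ := exists_eq_apply_of_finiteDimensional (F := F)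
    (l.toLinearMap ∘ₗ LinearMap.inr ℝ X (F →L[ℝ] ℝ))
  obtain ⟨ξ, hξ⟩ := exists_contMDiffSection_eventuallyEq I (E := E) p.proj v
  obtain ⟨u, hu⟩ := exists_contMDiffMap_eventuallyEq (J := I) (chartAt HB p.proj).open_source
    (mem_chart_source HB p.proj)
    (f := fun y => l.comp (ContinuousLinearMap.inl ℝ X (F →L[ℝ] ℝ)) (extChartAt I p.proj y))
    ((ContinuousLinearMap.contMDiff _).comp_contMDiffOn contMDiffOn_extChartAt)
  have hq : Tendsto (fun Φ : DualTotal F E => Φ.proj) (𝓝 p) (𝓝 p.proj) :=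
    (FiberBundle.continuous_proj (F →L[ℝ] ℝ) (fun b => E b →L[ℝ] ℝ)).continuousAt
  have hbs : ∀ᶠ y in 𝓝 p.proj, y ∈ (trivializationAt F E p.proj).baseSet :=
    (trivializationAt F E p.proj).open_baseSet.mem_nhds (FiberBundle.mem_baseSet_trivializationAt' _)
  -- a coordinate of the dual bundle is the sum of a coordinate of the base and of some `ℓ_ξ`
  have h : g =ᶠ[𝓝 p] (basePullback u + sectionFunction ξ :
      C^∞⟮I.prod 𝓘(ℝ, F →L[ℝ] ℝ), DualTotal F E; ℝ⟯) := by
    filter_upwards [hg, hq.eventually hξ, hq.eventually hu, hq.eventually hbs]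
      with Φ h1 h2 h3 h4
    change g Φ = u Φ.proj + Φ.2 (ξ Φ.proj)
    rw [h1, h2, h3, ← dual_extChartAt_snd_apply (I := I) h4 v, ← dual_extChartAt_fst (I := I) p Φ,
      ← hv]
    generalize extChartAt (I.prod 𝓘(ℝ, F →L[ℝ] ℝ)) p Φ = z
    obtain ⟨z₁, z₂⟩ := z
    change l (z₁, z₂) = l (z₁, 0) + l (0, z₂)
    rw [← map_add]
    simp
  rw [pointDerivation_congr hd h, map_add, hsec, hbase, add_zero]

end DualGenerators

/-! ### Smooth frames and the dual bundle -/

section Frames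

variable {Y : Type*} [NormedAddCommGroup Y] [NormedSpace ℝ Y]
  {HN : Type*} [TopologicalSpace HN] {J : ModelWithCorners ℝ Y HN}
  {N : Type*} [TopologicalSpace N] [ChartedSpace HN N]
  {W : Type*} [NormedAddCommGroup W] [NormedSpace ℝ W] [FiniteDimensional ℝ W]

/-- A family of operators on a finite-dimensional space is smooth if it is so on every vector. -/
theorem contMDiffAt_clm_of_apply {F : Type*} [NormedAddCommGroup F] [NormedSpace ℝ F]
    {T : N → (W →L[ℝ] F)} {n₀ : N} (h : ∀ w, ContMDiffAt J 𝓘(ℝ, F) ∞ (fun n => T n w) n₀) :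
    ContMDiffAt J 𝓘(ℝ, W →L[ℝ] F) ∞ T n₀ := by
  let b := Module.finBasis ℝ W
  have h1 : T = fun n => ∑ i, ContinuousLinearMap.smulRightL ℝ W F
      (LinearMap.toContinuousLinearMap (b.coord i)) (T n (b i)) := by
    funext n
    ext w
    conv_lhs => rw [← b.sum_repr w, map_sum]
    simp
  rw [h1]
  have h2 : ∀ i, ContMDiffAt J 𝓘(ℝ, W →L[ℝ] F) ∞ (fun n => ContinuousLinearMap.smulRightL ℝ W F
      (LinearMap.toContinuousLinearMap (b.coord i)) (T n (b i))) n₀ := fun i =>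
    (ContinuousLinearMap.contMDiff _).contMDiffAt.comp n₀ (h (b i))
  exact contMDiffAt_finsetSum (t := Finset.univ) fun i _ => h2 i

variable
  {X : Type*} [NormedAddCommGroup X] [NormedSpace ℝ X]
  {HB : Type*} [TopologicalSpace HB] {I : ModelWithCorners ℝ X HB}
  {B : Type*} [TopologicalSpace B] [ChartedSpace HB B]
  {F : Type*} [NormedAddCommGroup F] [NormedSpace ℝ F]
  {E : B → Type*} [TopologicalSpace (TotalSpace F E)] [∀ b, TopologicalSpace (E b)]
  [∀ b, AddCommGroup (E b)] [∀ b, Module ℝ (E b)]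
  [FiberBundle F E] [VectorBundle ℝ F E]

/-- Let `S n : W → E_{b n}` be linear maps depending smoothly on `n`, with `S n₀` bijective. Near
`n₀` they stay onto, and elements of the dual bundle with prescribed smooth pairings with the frame
`S` exist and depend smoothly on `n`. -/
theorem exists_dual_of_frame {b : N → B} {S : ∀ n, W →ₗ[ℝ] E (b n)} {c : N → (W →ₗ[ℝ] ℝ)}
    {n₀ : N} (hb : ContMDiffAt J I ∞ b n₀)
    (hS : ∀ w, ContMDiffAt J (I.prod 𝓘(ℝ, F)) ∞ (fun n => TotalSpace.mk' F (b n) (S n w)) n₀)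
    (hbij : Function.Bijective (S n₀)) (hc : ∀ w, ContMDiffAt J 𝓘(ℝ, ℝ) ∞ (fun n => c n w) n₀) :
    ∃ Ψ : ∀ n, E (b n) →L[ℝ] ℝ,
      ContMDiffAt J (I.prod 𝓘(ℝ, F →L[ℝ] ℝ)) ∞ (fun n => (⟨b n, Ψ n⟩ : DualTotal F E)) n₀ ∧
      ∀ᶠ n in 𝓝 n₀, Function.Surjective (S n) ∧ ∀ w, Ψ n (S n w) = c n w := by
  let e := trivializationAt F E (b n₀)
  have hmem : b n₀ ∈ e.baseSet := FiberBundle.mem_baseSet_trivializationAt' _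
  have hbs : ∀ᶠ n in 𝓝 n₀, b n ∈ e.baseSet :=
    hb.continuousAt.eventually (e.open_baseSet.mem_nhds hmem)
  -- the frame read in a trivialization; being invertible is an open condition
  let T : N → (W →L[ℝ] F) := fun n =>
    LinearMap.toContinuousLinearMap ((e.linearMapAt ℝ (b n)).comp (S n))
  have hTs : ContMDiffAt J 𝓘(ℝ, W →L[ℝ] F) ∞ T n₀ := by
    refine contMDiffAt_clm_of_apply fun w => ?_
    refine (contMDiffAt_totalSpace.1 (hS w)).2.congr_of_eventuallyEq ?_
    filter_upwards [hbs] with n hn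
    change e.linearMapAt ℝ (b n) (S n w) = _
    rw [Trivialization.coe_linearMapAt_of_mem _ hn]
  have hT₀ : Function.Bijective (T n₀) := by
    have h1 : ⇑(T n₀) = e.linearEquivAt ℝ (b n₀) hmem ∘ S n₀ := by
      funext w
      change e.linearMapAt ℝ (b n₀) (S n₀ w) = _
      rw [Trivialization.coe_linearMapAt_of_mem _ hmem]
      rfl
    rw [h1]
    exact (e.linearEquivAt ℝ (b n₀) hmem).bijective.comp hbij
  let T₀ : W ≃L[ℝ] F := (LinearEquiv.ofBijective (T n₀).toLinearMap hT₀).toContinuousLinearEquiv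
  have hT₀' : (T₀ : W →L[ℝ] F) = T n₀ := by ext w; rfl
  have hinv : ∀ᶠ n in 𝓝 n₀, (T n) ∈ Set.range ((↑) : (W ≃L[ℝ] F) → (W →L[ℝ] F)) := by
    apply hTs.continuousAt.eventually
    rw [← hT₀']
    exact T₀.nhds
  let ψ : N → (F →L[ℝ] ℝ) := fun n =>
    (LinearMap.toContinuousLinearMap (c n)).comp (ContinuousLinearMap.inverse (T n))
  have hψ : ContMDiffAt J 𝓘(ℝ, F →L[ℝ] ℝ) ∞ ψ n₀ := by
    have h1 : ContMDiffAt J 𝓘(ℝ, W →L[ℝ] ℝ) ∞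
        (fun n => LinearMap.toContinuousLinearMap (c n)) n₀ :=
      contMDiffAt_clm_of_apply hc
    have h2 : ContMDiffAt J 𝓘(ℝ, F →L[ℝ] W) ∞ (fun n => ContinuousLinearMap.inverse (T n)) n₀ := by
      have h3 : ContDiffAt ℝ ∞ (ContinuousLinearMap.inverse : (W →L[ℝ] F) → _) (T n₀) := by
        rw [← hT₀']
        exact contDiffAt_map_inverse T₀
      exact h3.contMDiffAt.comp n₀ hTs
    exact h1.clm_comp h2
  refine ⟨fun n => (ψ n).comp (e.continuousLinearMapAt ℝ (b n)), ?_, ?_⟩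
  · rw [contMDiffAt_totalSpace]
    refine ⟨hb, hψ.congr_of_eventuallyEq ?_⟩
    filter_upwards [hbs] with n hn
    ext v
    rw [hom_trivializationAt_apply]
    change ContinuousLinearMap.inCoordinates F E ℝ (Bundle.Trivial B ℝ) (b n₀) (b n) (b n₀) (b n)
      ((ψ n).comp (e.continuousLinearMapAt ℝ (b n))) v = ψ n v
    simp only [ContinuousLinearMap.inCoordinates, Trivial.fiberBundle_trivializationAt',
      Trivial.continuousLinearMapAt_trivialization, ContinuousLinearMap.id_comp,
      ContinuousLinearMap.comp_assoc, ContinuousLinearMap.comp_apply]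
    exact congrArg (ψ n) (e.continuousLinearMapAt_symmL hn v)
  · filter_upwards [hbs, hinv] with n hn ⟨T', hT'⟩
    have hTn : ∀ w, e.continuousLinearMapAt ℝ (b n) (S n w) = T' w := fun w => by
      change T n w = _
      rw [← hT']; rfl
    refine ⟨fun x => ?_, fun w => ?_⟩
    · refine ⟨T'.symm (e.continuousLinearMapAt ℝ (b n) x), ?_⟩
      apply (e.continuousLinearEquivAt ℝ (b n) hn).injective
      have := hTn (T'.symm (e.continuousLinearMapAt ℝ (b n) x))
      rw [T'.apply_symm_apply] at this
      simpa [Trivialization.coe_linearMapAt_of_mem _ hn] using this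
    · change c n (ContinuousLinearMap.inverse (T n) (e.continuousLinearMapAt ℝ (b n) (S n w))) = _
      rw [hTn, ← hT', ContinuousLinearMap.inverse_equiv]
      simp

/-- A map to the dual bundle is smooth if its pairings with a smooth frame are. -/
theorem contMDiffAt_dual_of_frame {b : N → B} {S : ∀ n, W →ₗ[ℝ] E (b n)}
    {Ψ : ∀ n, E (b n) →L[ℝ] ℝ} {n₀ : N} (hb : ContMDiffAt J I ∞ b n₀)
    (hS : ∀ w, ContMDiffAt J (I.prod 𝓘(ℝ, F)) ∞ (fun n => TotalSpace.mk' F (b n) (S n w)) n₀)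
    (hbij : Function.Bijective (S n₀))
    (hc : ∀ w, ContMDiffAt J 𝓘(ℝ, ℝ) ∞ (fun n => Ψ n (S n w)) n₀) :
    ContMDiffAt J (I.prod 𝓘(ℝ, F →L[ℝ] ℝ)) ∞ (fun n => (⟨b n, Ψ n⟩ : DualTotal F E)) n₀ := by
  obtain ⟨Ψ', h1, h2⟩ := exists_dual_of_frame (c := fun n => (Ψ n).toLinearMap.comp (S n))
    hb hS hbij hc
  refine h1.congr_of_eventuallyEq ?_
  filter_upwards [h2] with n hn
  congr 1
  ext x
  obtain ⟨w, rfl⟩ := hn.1 x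
  exact (hn.2 w).symm

end Frames

section DualPairing

variable {Y : Type*} [NormedAddCommGroup Y] [NormedSpace ℝ Y]
  {HN : Type*} [TopologicalSpace HN] {J : ModelWithCorners ℝ Y HN}
  {N : Type*} [TopologicalSpace N] [ChartedSpace HN N]
  {X : Type*} [NormedAddCommGroup X] [NormedSpace ℝ X]
  {HB : Type*} [TopologicalSpace HB] {I : ModelWithCorners ℝ X HB}
  {B : Type*} [TopologicalSpace B] [ChartedSpace HB B]
  {F : Type*} [NormedAddCommGroup F] [NormedSpace ℝ F]
  {E : B → Type*} [TopologicalSpace (TotalSpace F E)] [∀ b, TopologicalSpace (E b)]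
  [∀ b, AddCommGroup (E b)] [∀ b, Module ℝ (E b)]
  [FiberBundle F E] [VectorBundle ℝ F E]

theorem dualTotal_ext {Φ Ψ : DualTotal F E} (hp : Φ.proj = Ψ.proj)
    (h : ∀ e : TotalSpace F E, e.proj = Φ.proj → dualPair Φ e = dualPair Ψ e) : Φ = Ψ := by
  obtain ⟨b, Φ⟩ := Φ
  obtain ⟨b', Ψ⟩ := Ψ
  obtain rfl : b = b' := hp
  congr 1
  ext x
  have := h ⟨b, x⟩ rfl
  rwa [dualPair_mk, dualPair_mk] at this

theorem ContMDiffAt.dual_apply {Ψ : N → DualTotal F E} {σ : ∀ n, E (Ψ n).proj} {n₀ : N}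
    (hΨ : ContMDiffAt J (I.prod 𝓘(ℝ, F →L[ℝ] ℝ)) ∞ Ψ n₀)
    (hσ : ContMDiffAt J (I.prod 𝓘(ℝ, F)) ∞ (fun n => TotalSpace.mk' F (Ψ n).proj (σ n)) n₀) :
    ContMDiffAt J 𝓘(ℝ, ℝ) ∞ (fun n => (Ψ n).2 (σ n)) n₀ := by
  have h : ContMDiffAt J (I.prod 𝓘(ℝ, ℝ)) ∞
      (fun n => TotalSpace.mk' ℝ (E := Bundle.Trivial B ℝ) (Ψ n).proj ((Ψ n).2 (σ n))) n₀ :=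
    ContMDiffAt.clm_bundle_apply (F₁ := F) (F₂ := ℝ) (E₂ := Bundle.Trivial B ℝ)
      (b := fun n => (Ψ n).proj) (ϕ := fun n => (Ψ n).2) (v := σ) hΨ hσ
  exact (contMDiffAt_totalSpace.1 h).2

theorem contMDiffAt_symmₗ [ContMDiffVectorBundle ∞ F E I] (e : Trivialization F (π F E))
    [MemTrivializationAtlas e] {b : B} (hb : b ∈ e.baseSet) (v : F) :
    ContMDiffAt I (I.prod 𝓘(ℝ, F)) ∞ (fun y => TotalSpace.mk' F y (e.symmₗ ℝ y v)) b := by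
  have h1 := (e.contMDiffOn_symm (n := ∞) (IB := I)).contMDiffAt
    (e.open_target.mem_nhds ((e.mem_target (x := (b, v))).2 hb))
  refine (h1.comp b (contMDiffAt_id.prodMk contMDiffAt_const)).congr_of_eventuallyEq ?_
  filter_upwards [e.open_baseSet.mem_nhds hb] with y hy
  rw [e.coe_symmₗ (R := ℝ) hy]
  exact e.mk_symm hy v

theorem symmₗ_bijective (e : Trivialization F (π F E)) [MemTrivializationAtlas e] {b : B}
    (hb : b ∈ e.baseSet) : Function.Bijective (e.symmₗ ℝ b) := by
  rw [e.coe_symmₗ (R := ℝ) hb]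
  exact (e.linearEquivAt ℝ b hb).symm.bijective

end DualPairing

/-! ### Fibrewise operations on total spaces -/

section Fibres

variable {B F : Type*} {E : B → Type*} [∀ b, AddCommGroup (E b)] [∀ b, Module ℝ (E b)]
  {W : Type*} [AddCommGroup W] [Module ℝ W]

theorem TotalSpace.mk_snd_cast {b : B} (e : TotalSpace F E) (h : e.proj = b) :
    (⟨b, h ▸ e.2⟩ : TotalSpace F E) = e := by
  subst h; rfl

/-- A map into the total space of a vector bundle which takes values in one fibre and is linear
for the fibrewise operations, as a linear map into that fibre. -/
noncomputable def toFibre (φ : W → TotalSpace F E) (b : B) (hproj : ∀ w, (φ w).proj = b)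
    (hadd : ∀ w w', φ (w + w') = totalAdd (φ w) (φ w'))
    (hsmul : ∀ (t : ℝ) w, φ (t • w) = totalSMul t (φ w)) : W →ₗ[ℝ] E b where
  toFun w := hproj w ▸ (φ w).2
  map_add' w w' := by
    apply TotalSpace.mk_injective (F := F) b
    rw [← totalAdd_mk, TotalSpace.mk_snd_cast, TotalSpace.mk_snd_cast, TotalSpace.mk_snd_cast, hadd]
  map_smul' t w := by
    apply TotalSpace.mk_injective (F := F) b
    change _ = totalSMul t ⟨b, _⟩
    rw [TotalSpace.mk_snd_cast, TotalSpace.mk_snd_cast, hsmul]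

section

variable {φ : W → TotalSpace F E} {b : B} {hproj : ∀ w, (φ w).proj = b}
    {hadd : ∀ w w', φ (w + w') = totalAdd (φ w) (φ w')}
    {hsmul : ∀ (t : ℝ) w, φ (t • w) = totalSMul t (φ w)}

theorem mk_toFibre (w : W) : (⟨b, toFibre φ b hproj hadd hsmul w⟩ : TotalSpace F E) = φ w :=
  TotalSpace.mk_snd_cast _ _

theorem toFibre_bijective (hinj : ∀ w, φ w = zeroSection F E b → w = 0)
    (hsurj : ∀ e : TotalSpace F E, e.proj = b → ∃ w, φ w = e) :
    Function.Bijective (toFibre φ b hproj hadd hsmul) := by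
  constructor
  · rw [injective_iff_map_eq_zero]
    intro w hw
    apply hinj
    rw [← mk_toFibre (hproj := hproj) (hadd := hadd) (hsmul := hsmul), hw]
    rfl
  · intro x
    obtain ⟨w, hw⟩ := hsurj ⟨b, x⟩ rfl
    exact ⟨w, TotalSpace.mk_injective b (by rw [mk_toFibre, hw])⟩

end

theorem totalAdd_proj (e₁ e₂ : TotalSpace F E) (h : e₁.proj = e₂.proj) :
    (totalAdd e₁ e₂).proj = e₁.proj := by
  obtain ⟨b, x⟩ := e₁
  obtain ⟨b', y⟩ := e₂
  obtain rfl : b = b' := h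
  rw [totalAdd_mk]

theorem totalAdd_zero (e : TotalSpace F E) : totalAdd e (zeroSection F E e.proj) = e :=
  (totalAdd_mk e.proj e.2 0).trans (by rw [add_zero])

theorem zero_totalAdd (e : TotalSpace F E) : totalAdd (zeroSection F E e.proj) e = e :=
  (totalAdd_mk e.proj 0 e.2).trans (by rw [zero_add])

theorem totalAdd_totalAdd_totalAdd_comm (e₁ e₂ e₃ e₄ : TotalSpace F E) (h₂ : e₂.proj = e₁.proj)
    (h₃ : e₃.proj = e₁.proj) (h₄ : e₄.proj = e₁.proj) :
    totalAdd (totalAdd e₁ e₂) (totalAdd e₃ e₄) = totalAdd (totalAdd e₁ e₃) (totalAdd e₂ e₄) := by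
  obtain ⟨b, x⟩ := e₁
  obtain ⟨b₂, y⟩ := e₂
  obtain ⟨b₃, z⟩ := e₃
  obtain ⟨b₄, w⟩ := e₄
  obtain rfl : b₂ = b := h₂
  obtain rfl : b₃ = b₂ := h₃
  obtain rfl : b₄ = b₃ := h₄
  simp only [totalAdd_mk, add_add_add_comm]

theorem totalSMul_totalAdd (t : ℝ) (e₁ e₂ : TotalSpace F E) (h : e₁.proj = e₂.proj) :
    totalSMul t (totalAdd e₁ e₂) = totalAdd (totalSMul t e₁) (totalSMul t e₂) := by
  obtain ⟨b, x⟩ := e₁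
  obtain ⟨b', y⟩ := e₂
  obtain rfl : b = b' := h
  rw [totalAdd_mk]
  change (⟨b, t • (x + y)⟩ : TotalSpace F E) = totalAdd ⟨b, t • x⟩ ⟨b, t • y⟩
  rw [totalAdd_mk, smul_add]

theorem totalSMul_totalSMul (s t : ℝ) (e : TotalSpace F E) :
    totalSMul s (totalSMul t e) = totalSMul (s * t) e := by
  simp only [totalSMul, mul_smul]
  rfl

theorem totalSMul_one (e : TotalSpace F E) : totalSMul 1 e = e := by
  simp only [totalSMul, one_smul]

theorem add_totalSMul (s t : ℝ) (e : TotalSpace F E) :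
    totalSMul (s + t) e = totalAdd (totalSMul s e) (totalSMul t e) := by
  obtain ⟨b, x⟩ := e
  simp only [totalSMul, totalAdd_mk, add_smul]

theorem totalSMul_zeroSection (t : ℝ) (b : B) :
    totalSMul t (zeroSection F E b) = zeroSection F E b :=
  congrArg (TotalSpace.mk b) (smul_zero t)

/-- Cancelling in a fibre: `e = e₁ + (e - e₁)`. -/
theorem totalAdd_neg_cancel (e e₁ : TotalSpace F E) (h : e₁.proj = e.proj) :
    totalAdd e₁ (totalAdd e (totalSMul (-1) e₁)) = e := by
  obtain ⟨b, x⟩ := e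
  obtain ⟨b', y⟩ := e₁
  obtain rfl : b' = b := h
  simp [totalSMul, totalAdd_mk]

end Fibres

section SmoothFibres

variable {Y : Type*} [NormedAddCommGroup Y] [NormedSpace ℝ Y]
  {HN : Type*} [TopologicalSpace HN] {J : ModelWithCorners ℝ Y HN}
  {N : Type*} [TopologicalSpace N] [ChartedSpace HN N]
  {X : Type*} [NormedAddCommGroup X] [NormedSpace ℝ X]
  {HB : Type*} [TopologicalSpace HB] {I : ModelWithCorners ℝ X HB}
  {B : Type*} [TopologicalSpace B] [ChartedSpace HB B]
  {F : Type*} [NormedAddCommGroup F] [NormedSpace ℝ F]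
  {E : B → Type*} [TopologicalSpace (TotalSpace F E)] [∀ b, TopologicalSpace (E b)]
  [∀ b, AddCommGroup (E b)] [∀ b, Module ℝ (E b)]
  [FiberBundle F E] [VectorBundle ℝ F E]

theorem ContMDiffAt.totalAdd {f g : N → TotalSpace F E} {n₀ : N}
    (hf : ContMDiffAt J (I.prod 𝓘(ℝ, F)) ∞ f n₀) (hg : ContMDiffAt J (I.prod 𝓘(ℝ, F)) ∞ g n₀)
    (h : ∀ n, (f n).proj = (g n).proj) :
    ContMDiffAt J (I.prod 𝓘(ℝ, F)) ∞ (fun n => totalAdd (f n) (g n)) n₀ := by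
  have hp : ∀ n, (_root_.totalAdd (f n) (g n)).proj = (f n).proj := fun n => totalAdd_proj _ _ (h n)
  rw [contMDiffAt_totalSpace] at hf hg ⊢
  refine ⟨hf.1.congr_of_eventuallyEq (Eventually.of_forall hp), ?_⟩
  rw [← h n₀] at hg
  refine (hf.2.add hg.2).congr_of_eventuallyEq ?_
  rw [hp n₀]
  let e := trivializationAt F E (f n₀).proj
  filter_upwards [hf.1.continuousAt.eventually
    (e.open_baseSet.mem_nhds (FiberBundle.mem_baseSet_trivializationAt' _))] with n hn
  have key : ∀ e₁ e₂ : TotalSpace F E, e₁.proj = e₂.proj → e₁.proj ∈ e.baseSet →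
      (e (_root_.totalAdd e₁ e₂)).2 = (e e₁).2 + (e e₂).2 := by
    rintro ⟨b, x⟩ ⟨b', y⟩ hb hm
    obtain rfl : b = b' := hb
    rw [totalAdd_mk]
    exact (e.linear ℝ hm).map_add x y
  exact key _ _ (h n) hn

theorem Bundle.Trivialization.eq_of_snd_eq (e : Trivialization F (π F E)) {x y : TotalSpace F E}
    (h : x.proj = y.proj) (hy : y.proj ∈ e.baseSet) (h' : (e x).2 = (e y).2) : x = y := by
  have hx : x.proj ∈ e.baseSet := by rwa [h]
  refine e.injOn (e.mem_source.2 hx) (e.mem_source.2 hy) (Prod.ext ?_ h')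
  exact (e.coe_fst' hx).trans (h.trans (e.coe_fst' hy).symm)

/-- Linear maps into a fixed fibre are smooth. -/
theorem contMDiff_mk_linearMap {G : Type*} [NormedAddCommGroup G] [NormedSpace ℝ G]
    [FiniteDimensional ℝ G] {b : B} (l : G →ₗ[ℝ] E b) :
    ContMDiff 𝓘(ℝ, G) (I.prod 𝓘(ℝ, F)) ∞ (fun g => TotalSpace.mk' F b (l g)) := by
  intro g
  rw [contMDiffAt_totalSpace]
  refine ⟨contMDiffAt_const, ?_⟩
  let e := trivializationAt F E b
  have hb : b ∈ e.baseSet := FiberBundle.mem_baseSet_trivializationAt' _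
  refine (LinearMap.toContinuousLinearMap
    ((e.linearMapAt ℝ b).comp l)).contMDiff.contMDiffAt.congr_of_eventuallyEq
    (Eventually.of_forall fun g => ?_)
  change _ = e.linearMapAt ℝ b (l g)
  rw [Trivialization.coe_linearMapAt_of_mem _ hb]

theorem contMDiff_totalSMul_const {b : B} (x : E b) :
    ContMDiff 𝓘(ℝ, ℝ) (I.prod 𝓘(ℝ, F)) ∞ (fun t : ℝ => totalSMul t (TotalSpace.mk' F b x)) :=
  contMDiff_mk_linearMap (LinearMap.toSpanSingleton ℝ (E b) x)

/-- A smooth map `σ : B → E` with `q ∘ σ = id`, as a section. -/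
noncomputable def ContMDiffSection.ofMap {σ : B → TotalSpace F E}
    (hσ : ContMDiff I (I.prod 𝓘(ℝ, F)) ∞ σ) (hproj : ∀ b, (σ b).proj = b) : Cₛ^∞⟮I; F, E⟯ where
  toFun b := hproj b ▸ (σ b).2
  contMDiff_toFun := by
    have : (fun b => TotalSpace.mk' F b (hproj b ▸ (σ b).2 : E b)) = σ :=
      funext fun b => TotalSpace.mk_snd_cast _ _
    rwa [← this] at hσ

theorem ContMDiffSection.mk_ofMap {σ : B → TotalSpace F E}
    (hσ : ContMDiff I (I.prod 𝓘(ℝ, F)) ∞ σ) (hproj : ∀ b, (σ b).proj = b) (b : B) :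
    (⟨b, ContMDiffSection.ofMap hσ hproj b⟩ : TotalSpace F E) = σ b :=
  TotalSpace.mk_snd_cast _ _

end SmoothFibres

/-! ### Conformal maps of a dual bundle -/

section Conformal

variable
  {X : Type*} [NormedAddCommGroup X] [NormedSpace ℝ X] [FiniteDimensional ℝ X]
  {HB : Type*} [TopologicalSpace HB] {I : ModelWithCorners ℝ X HB} [I.Boundaryless]
  {B : Type*} [TopologicalSpace B] [ChartedSpace HB B] [T2Space B]
  {F : Type*} [NormedAddCommGroup F] [NormedSpace ℝ F] [FiniteDimensional ℝ F]
  {E : B → Type*} [TopologicalSpace (TotalSpace F E)] [∀ b, TopologicalSpace (E b)]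
  [∀ b, AddCommGroup (E b)] [∀ b, Module ℝ (E b)]
  [FiberBundle F E] [VectorBundle ℝ F E]
  [IsManifold I ∞ B] [ContMDiffVectorBundle ∞ F E I]

theorem PoissonStructure.bracket_skew {Y : Type*} [NormedAddCommGroup Y] [NormedSpace ℝ Y]
    {HN : Type*} [TopologicalSpace HN] {J : ModelWithCorners ℝ Y HN}
    {N : Type*} [TopologicalSpace N] [ChartedSpace HN N] (P : PoissonStructure J N)
    (f g : C^∞⟮J, N; ℝ⟯) : P.bracket f g = -P.bracket g f := by
  have h := P.bracket_self (f + g)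
  rw [map_add, map_add, LinearMap.add_apply, LinearMap.add_apply, P.bracket_self, P.bracket_self,
    zero_add, add_zero] at h
  exact eq_neg_of_add_eq_zero_right h

/-- A map of a dual bundle to itself scales a Poisson structure by `t` as soon as it does so on the
functions `ℓ_ξ` and `f ∘ q`: the difference of the two sides is a point derivation in each of the
two functions. -/
theorem PoissonStructure.bracket_comp_of_generators
    (P : PoissonStructure (I.prod 𝓘(ℝ, F →L[ℝ] ℝ)) (DualTotal F E))
    (h : C^∞⟮I.prod 𝓘(ℝ, F →L[ℝ] ℝ), DualTotal F E; I.prod 𝓘(ℝ, F →L[ℝ] ℝ), DualTotal F E⟯)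
    (t : ℝ) (p : DualTotal F E)
    (hss : ∀ ξ η : Cₛ^∞⟮I; F, E⟯,
      P.bracket ((sectionFunction ξ).comp h) ((sectionFunction η).comp h) p =
        t * P.bracket (sectionFunction ξ) (sectionFunction η) (h p))
    (hsb : ∀ (ξ : Cₛ^∞⟮I; F, E⟯) (f : C^∞⟮I, B; ℝ⟯),
      P.bracket ((sectionFunction ξ).comp h) ((basePullback f).comp h) p =
        t * P.bracket (sectionFunction ξ) (basePullback f) (h p))
    (hbb : ∀ f g : C^∞⟮I, B; ℝ⟯,
      P.bracket ((basePullback f).comp h) ((basePullback g).comp h) p =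
        t * P.bracket (basePullback f) (basePullback g) (h p))
    (f g : C^∞⟮I.prod 𝓘(ℝ, F →L[ℝ] ℝ), DualTotal F E; ℝ⟯) :
    P.bracket (f.comp h) (g.comp h) p = t * P.bracket f g (h p) := by
  let d : C^∞⟮I.prod 𝓘(ℝ, F →L[ℝ] ℝ), DualTotal F E; ℝ⟯ →
      C^∞⟮I.prod 𝓘(ℝ, F →L[ℝ] ℝ), DualTotal F E; ℝ⟯ →ₗ[ℝ] ℝ := fun u =>
    { toFun := fun v => P.bracket (u.comp h) (v.comp h) p - t * P.bracket u v (h p)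
      map_add' := fun v w => by
        have h1 : (v + w).comp h = v.comp h + w.comp h := rfl
        rw [h1, map_add, map_add]
        change (P.bracket (u.comp h) (v.comp h) p + P.bracket (u.comp h) (w.comp h) p) -
          t * (P.bracket u v (h p) + P.bracket u w (h p)) = _
        ring
      map_smul' := fun c v => by
        have h1 : (c • v).comp h = c • v.comp h := rfl
        rw [h1, map_smul, map_smul]
        change c * P.bracket (u.comp h) (v.comp h) p - t * (c * P.bracket u v (h p)) =
          c * (P.bracket (u.comp h) (v.comp h) p - t * P.bracket u v (h p))
        ring }
  have hd : ∀ u v w, d u (v * w) = v (h p) * d u w + w (h p) * d u v := fun u v w => by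
    have h1 : (v * w).comp h = v.comp h * w.comp h := rfl
    change P.bracket (u.comp h) ((v * w).comp h) p - t * P.bracket u (v * w) (h p) =
      v (h p) * (P.bracket (u.comp h) (w.comp h) p - t * P.bracket u w (h p)) +
        w (h p) * (P.bracket (u.comp h) (v.comp h) p - t * P.bracket u v (h p))
    rw [h1, P.leibniz, P.leibniz]
    change (P.bracket (u.comp h) (v.comp h) p * w (h p) +
      v (h p) * P.bracket (u.comp h) (w.comp h) p) -
        t * (P.bracket u v (h p) * w (h p) + v (h p) * P.bracket u w (h p)) = _
    ring
  have hskew : ∀ u v, d u v = -d v u := fun u v => by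
    change P.bracket (u.comp h) (v.comp h) p - t * P.bracket u v (h p) =
      -(P.bracket (v.comp h) (u.comp h) p - t * P.bracket v u (h p))
    rw [P.bracket_skew (u.comp h), P.bracket_skew u]
    change -P.bracket (v.comp h) (u.comp h) p - t * -P.bracket v u (h p) = _
    ring
  have hs : ∀ (ξ : Cₛ^∞⟮I; F, E⟯) v, d (sectionFunction ξ) v = 0 := fun ξ =>
    dual_pointDerivation_eq_zero (hd _) (fun η => sub_eq_zero.2 (hss ξ η))
      (fun f => sub_eq_zero.2 (hsb ξ f))
  have hb : ∀ (f : C^∞⟮I, B; ℝ⟯) v, d (basePullback f) v = 0 := fun f =>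
    dual_pointDerivation_eq_zero (hd _) (fun η => by rw [hskew, hs, neg_zero])
      (fun g => sub_eq_zero.2 (hbb f g))
  exact sub_eq_zero.1 (dual_pointDerivation_eq_zero (hd f)
    (fun η => by rw [hskew, hs, neg_zero]) (fun g => by rw [hskew, hb, neg_zero]) g)

end Conformal

/-! ### Differentiable functions homogeneous along a line -/

/-- If `φ` is homogeneous of degree one along the line of `v` near `0`, with slope `a`, then `a` is its
derivative at `0` in the direction `v`; nothing is assumed about the value at `0`. -/
theorem DifferentiableAt.eq_zero_and_fderiv_apply {G : Type*} [NormedAddCommGroup G]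
    [NormedSpace ℝ G] {φ : G → ℝ} (hφ : DifferentiableAt ℝ φ 0) {v : G} {a : ℝ}
    (h : ∀ᶠ r in 𝓝[≠] (0 : ℝ), φ (r • v) = r * a) : φ 0 = 0 ∧ fderiv ℝ φ 0 v = a := by
  have hd : HasDerivAt (fun r : ℝ => φ (r • v)) (fderiv ℝ φ 0 v) 0 := by
    have h1 : HasDerivAt (fun r : ℝ => r • v) v 0 := by
      simpa using (hasDerivAt_id (0 : ℝ)).smul_const v
    have h2 : HasFDerivAt φ (fderiv ℝ φ 0) ((0 : ℝ) • v) := by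
      rw [zero_smul]
      exact hφ.hasFDerivAt
    exact h2.comp_hasDerivAt (0 : ℝ) h1
  have h0 : φ 0 = 0 := by
    have h1 : Tendsto (fun r : ℝ => φ (r • v)) (𝓝[≠] 0) (𝓝 (φ 0)) := by
      have := hd.continuousAt.tendsto.mono_left (nhdsWithin_le_nhds (s := {0}ᶜ))
      rwa [zero_smul] at this
    have h2 : Tendsto (fun r : ℝ => r * a) (𝓝[≠] 0) (𝓝 0) := by
      have : Continuous fun r : ℝ => r * a := by fun_prop
      simpa using (this.tendsto 0).mono_left (nhdsWithin_le_nhds (s := {0}ᶜ))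
    exact tendsto_nhds_unique h1 (h2.congr' (h.mono fun r hr => hr.symm))
  refine ⟨h0, hd.unique ?_⟩
  have h1 : HasDerivAt (fun r : ℝ => r * a) a 0 := by
    simpa using (hasDerivAt_id (0 : ℝ)).mul_const a
  refine h1.congr_of_eventuallyEq ?_
  filter_upwards [eventually_nhdsWithin_iff.1 h] with r hr
  rcases eq_or_ne r 0 with rfl | hr0
  · rw [zero_smul, h0, zero_mul]
  · exact hr hr0

namespace DoubleVectorBundle

section Double

variable
  {X : Type*} [NormedAddCommGroup X] [NormedSpace ℝ X]
  {M : Type*} [TopologicalSpace M] [ChartedSpace X M]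
  {FH : Type*} [NormedAddCommGroup FH] [NormedSpace ℝ FH]
  {H : M → Type*} [TopologicalSpace (TotalSpace FH H)] [∀ m, TopologicalSpace (H m)]
  [∀ m, AddCommGroup (H m)] [∀ m, Module ℝ (H m)] [FiberBundle FH H] [VectorBundle ℝ FH H]
  {FV : Type*} [NormedAddCommGroup FV] [NormedSpace ℝ FV]
  {V : M → Type*} [TopologicalSpace (TotalSpace FV V)] [∀ m, TopologicalSpace (V m)]
  [∀ m, AddCommGroup (V m)] [∀ m, Module ℝ (V m)] [FiberBundle FV V] [VectorBundle ℝ FV V]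
  {FA : Type*} [NormedAddCommGroup FA] [NormedSpace ℝ FA]
  {A : TotalSpace FH H → Type*} [TopologicalSpace (TotalSpace FA A)]
  [∀ x, TopologicalSpace (A x)] [∀ x, AddCommGroup (A x)] [∀ x, Module ℝ (A x)]
  [FiberBundle FA A] [VectorBundle ℝ FA A]
  {FA' : Type*} [NormedAddCommGroup FA'] [NormedSpace ℝ FA']
  {A' : TotalSpace FV V → Type*} [TopologicalSpace (TotalSpace FA' A')]
  [∀ v, TopologicalSpace (A' v)] [∀ v, AddCommGroup (A' v)] [∀ v, Module ℝ (A' v)]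
  [FiberBundle FA' A'] [VectorBundle ℝ FA' A']
  {FK : Type*} [NormedAddCommGroup FK] [NormedSpace ℝ FK]
  {K : M → Type*} [TopologicalSpace (TotalSpace FK K)] [∀ m, TopologicalSpace (K m)]
  [∀ m, AddCommGroup (K m)] [∀ m, Module ℝ (K m)] [FiberBundle FK K] [VectorBundle ℝ FK K]

/-! ### Algebra of double vector bundles -/

section Algebra

variable (𝒟 : DoubleVectorBundle X FH H FV V FA A FA' A')

theorem projHor_proj (ξ : TotalSpace FA A) : (𝒟.projHor ξ).proj = ξ.proj.proj := 𝒟.square ξ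

theorem smulHor_proj (t : ℝ) (ξ : TotalSpace FA A) :
    (𝒟.smulHor t ξ).proj = totalSMul t ξ.proj := 𝒟.projVer_smul t ξ

theorem addHor_proj {ξ η : TotalSpace FA A} (h : 𝒟.projHor ξ = 𝒟.projHor η) :
    (𝒟.addHor ξ η).proj = totalAdd ξ.proj η.proj := 𝒟.projVer_add ξ η h

theorem projHor_smulHor (t : ℝ) (ξ : TotalSpace FA A) :
    𝒟.projHor (𝒟.smulHor t ξ) = 𝒟.projHor ξ := by
  simp only [projHor, smulHor, Diffeomorph.apply_symm_apply, totalSMul]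

theorem projHor_addHor {ξ η : TotalSpace FA A} (h : 𝒟.projHor ξ = 𝒟.projHor η) :
    𝒟.projHor (𝒟.addHor ξ η) = 𝒟.projHor ξ := by
  simp only [projHor, addHor, Diffeomorph.apply_symm_apply]
  exact totalAdd_proj _ _ h

theorem projHor_zeroHor (v : TotalSpace FV V) : 𝒟.projHor (𝒟.zeroHor v) = v := by
  simp only [projHor, zeroHor, Diffeomorph.apply_symm_apply, zeroSection]

theorem smulHor_smulHor (s t : ℝ) (ξ : TotalSpace FA A) :
    𝒟.smulHor s (𝒟.smulHor t ξ) = 𝒟.smulHor (s * t) ξ := by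
  simp only [smulHor, Diffeomorph.apply_symm_apply, totalSMul_totalSMul]

theorem smulHor_one (ξ : TotalSpace FA A) : 𝒟.smulHor 1 ξ = ξ := by
  simp only [smulHor, totalSMul_one, Diffeomorph.symm_apply_apply]

theorem smulHor_zero (ξ : TotalSpace FA A) : 𝒟.smulHor 0 ξ = 𝒟.zeroHor (𝒟.projHor ξ) := by
  simp only [smulHor, totalSMul_zero, zeroHor, projHor]

theorem smulHor_inv_smulHor {t : ℝ} (ht : t ≠ 0) (ξ : TotalSpace FA A) :
    𝒟.smulHor t⁻¹ (𝒟.smulHor t ξ) = ξ := by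
  rw [smulHor_smulHor, inv_mul_cancel₀ ht, smulHor_one]

theorem smulHor_smulHor_inv {t : ℝ} (ht : t ≠ 0) (ξ : TotalSpace FA A) :
    𝒟.smulHor t (𝒟.smulHor t⁻¹ ξ) = ξ := by
  rw [smulHor_smulHor, mul_inv_cancel₀ ht, smulHor_one]

theorem addHor_zeroHor {ξ : TotalSpace FA A} {v : TotalSpace FV V} (h : 𝒟.projHor ξ = v) :
    𝒟.addHor ξ (𝒟.zeroHor v) = ξ := by
  subst h
  simp only [addHor, zeroHor, projHor, Diffeomorph.apply_symm_apply, totalAdd_zero,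
    Diffeomorph.symm_apply_apply]

theorem zeroHor_addHor {ξ : TotalSpace FA A} {v : TotalSpace FV V} (h : 𝒟.projHor ξ = v) :
    𝒟.addHor (𝒟.zeroHor v) ξ = ξ := by
  subst h
  simp only [addHor, zeroHor, projHor, Diffeomorph.apply_symm_apply, zero_totalAdd,
    Diffeomorph.symm_apply_apply]

theorem add_smulHor (s t : ℝ) (ξ : TotalSpace FA A) :
    𝒟.smulHor (s + t) ξ = 𝒟.addHor (𝒟.smulHor s ξ) (𝒟.smulHor t ξ) := by
  simp only [addHor, smulHor, Diffeomorph.apply_symm_apply, add_totalSMul]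

theorem smulHor_addHor (t : ℝ) {ξ η : TotalSpace FA A} (h : 𝒟.projHor ξ = 𝒟.projHor η) :
    𝒟.smulHor t (𝒟.addHor ξ η) = 𝒟.addHor (𝒟.smulHor t ξ) (𝒟.smulHor t η) := by
  simp only [addHor, smulHor, Diffeomorph.apply_symm_apply]
  rw [totalSMul_totalAdd t _ _ h]

theorem addHor_addHor_addHor_comm {ξ₁ ξ₂ ξ₃ ξ₄ : TotalSpace FA A}
    (h₂ : 𝒟.projHor ξ₂ = 𝒟.projHor ξ₁) (h₃ : 𝒟.projHor ξ₃ = 𝒟.projHor ξ₁)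
    (h₄ : 𝒟.projHor ξ₄ = 𝒟.projHor ξ₁) :
    𝒟.addHor (𝒟.addHor ξ₁ ξ₂) (𝒟.addHor ξ₃ ξ₄) = 𝒟.addHor (𝒟.addHor ξ₁ ξ₃) (𝒟.addHor ξ₂ ξ₄) := by
  simp only [addHor, Diffeomorph.apply_symm_apply]
  rw [totalAdd_totalAdd_totalAdd_comm _ _ _ _ h₂ h₃ h₄]

theorem smulHor_totalAdd (t : ℝ) {ξ η : TotalSpace FA A} (h : ξ.proj = η.proj) :
    𝒟.smulHor t (totalAdd ξ η) = totalAdd (𝒟.smulHor t ξ) (𝒟.smulHor t η) :=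
  𝒟.smulHor_addVer t ξ η h

theorem smulHor_totalSMul (s t : ℝ) (ξ : TotalSpace FA A) :
    𝒟.smulHor t (totalSMul s ξ) = totalSMul s (𝒟.smulHor t ξ) :=
  (𝒟.smul_comm s t ξ).symm

theorem projHor_totalAdd {ξ η : TotalSpace FA A} (h : ξ.proj = η.proj) :
    𝒟.projHor (totalAdd ξ η) = totalAdd (𝒟.projHor ξ) (𝒟.projHor η) := 𝒟.projHor_add ξ η h

theorem projHor_totalSMul (t : ℝ) (ξ : TotalSpace FA A) :
    𝒟.projHor (totalSMul t ξ) = totalSMul t (𝒟.projHor ξ) := 𝒟.projHor_smul t ξ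

theorem smulHor_zeroSection (t : ℝ) (x : TotalSpace FH H) :
    𝒟.smulHor t (zeroSection FA A x) = zeroSection FA A (totalSMul t x) := by
  have h := 𝒟.smulHor_totalSMul 0 t (zeroSection FA A x)
  rw [totalSMul_zero, totalSMul_zero, smulHor_proj] at h
  exact h

theorem zeroHor_proj (v : TotalSpace FV V) : (𝒟.zeroHor v).proj = zeroSection FH H v.proj := by
  have h := 𝒟.smulHor_proj 0 (𝒟.zeroHor v)
  rw [smulHor_zero, projHor_zeroHor, totalSMul_zero, ← projHor_proj 𝒟, projHor_zeroHor] at h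
  exact h

theorem zeroHor_zeroSection (m : M) :
    𝒟.zeroHor (zeroSection FV V m) = zeroSection FA A (zeroSection FH H m) := by
  have h := 𝒟.smulHor_zeroSection 0 (zeroSection FH H m)
  rw [smulHor_zero, projHor_zero, totalSMul_zeroSection] at h
  exact h

theorem zeroHor_totalAdd {v w : TotalSpace FV V} (h : v.proj = w.proj) :
    𝒟.zeroHor (totalAdd v w) = totalAdd (𝒟.zeroHor v) (𝒟.zeroHor w) := by
  have hp : (𝒟.zeroHor v).proj = (𝒟.zeroHor w).proj := by rw [zeroHor_proj, zeroHor_proj, h]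
  have h1 := 𝒟.smulHor_totalAdd 0 hp
  simpa only [smulHor_zero, projHor_totalAdd _ hp, projHor_zeroHor] using h1

theorem zeroHor_totalSMul (t : ℝ) (v : TotalSpace FV V) :
    𝒟.zeroHor (totalSMul t v) = totalSMul t (𝒟.zeroHor v) := by
  have h1 := 𝒟.smulHor_totalSMul t 0 (𝒟.zeroHor v)
  simpa only [smulHor_zero, projHor_totalSMul, projHor_zeroHor] using h1

theorem addHor_totalAdd {ξ₁ ξ₂ ξ₃ ξ₄ : TotalSpace FA A} (h₁₂ : ξ₁.proj = ξ₂.proj)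
    (h₃₄ : ξ₃.proj = ξ₄.proj) (h₁₃ : 𝒟.projHor ξ₁ = 𝒟.projHor ξ₃)
    (h₂₄ : 𝒟.projHor ξ₂ = 𝒟.projHor ξ₄) :
    𝒟.addHor (totalAdd ξ₁ ξ₂) (totalAdd ξ₃ ξ₄) =
      totalAdd (𝒟.addHor ξ₁ ξ₃) (𝒟.addHor ξ₂ ξ₄) :=
  𝒟.interchange ξ₁ ξ₂ ξ₃ ξ₄ h₁₂ h₃₄ h₁₃ h₂₄

theorem addHor_totalSMul (t : ℝ) {ξ η : TotalSpace FA A} (h : 𝒟.projHor ξ = 𝒟.projHor η) :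
    𝒟.addHor (totalSMul t ξ) (totalSMul t η) = totalSMul t (𝒟.addHor ξ η) :=
  (𝒟.smulVer_addHor t ξ η h).symm

theorem contMDiff_projHor : ContMDiff ((𝓘(ℝ, X).prod 𝓘(ℝ, FH)).prod 𝓘(ℝ, FA))
    (𝓘(ℝ, X).prod 𝓘(ℝ, FV)) ∞ 𝒟.projHor :=
  (contMDiff_proj A').comp 𝒟.toHor.contMDiff

theorem contMDiff_smulHor_scalar (ξ : TotalSpace FA A) :
    ContMDiff 𝓘(ℝ, ℝ) ((𝓘(ℝ, X).prod 𝓘(ℝ, FH)).prod 𝓘(ℝ, FA)) ∞ (fun t : ℝ => 𝒟.smulHor t ξ) :=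
  𝒟.toHor.symm.contMDiff.comp (contMDiff_totalSMul_const (𝒟.toHor ξ).2)

theorem contMDiffAt_addHor {Y : Type*} [NormedAddCommGroup Y] [NormedSpace ℝ Y]
    {HN : Type*} [TopologicalSpace HN] {J : ModelWithCorners ℝ Y HN}
    {N : Type*} [TopologicalSpace N] [ChartedSpace HN N] {f g : N → TotalSpace FA A} {n₀ : N}
    (hf : ContMDiffAt J ((𝓘(ℝ, X).prod 𝓘(ℝ, FH)).prod 𝓘(ℝ, FA)) ∞ f n₀)
    (hg : ContMDiffAt J ((𝓘(ℝ, X).prod 𝓘(ℝ, FH)).prod 𝓘(ℝ, FA)) ∞ g n₀)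
    (h : ∀ n, 𝒟.projHor (f n) = 𝒟.projHor (g n)) :
    ContMDiffAt J ((𝓘(ℝ, X).prod 𝓘(ℝ, FH)).prod 𝓘(ℝ, FA)) ∞
      (fun n => 𝒟.addHor (f n) (g n)) n₀ :=
  𝒟.toHor.symm.contMDiff.contMDiffAt.comp n₀
    (ContMDiffAt.totalAdd (𝒟.toHor.contMDiff.contMDiffAt.comp n₀ hf)
      (𝒟.toHor.contMDiff.contMDiffAt.comp n₀ hg) h)

/-- The projection `𝒜 → V` on a fibre of `𝒜 → H`. -/
noncomputable def projHorLin (x : TotalSpace FH H) : A x →ₗ[ℝ] V x.proj :=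
  toFibre (fun a => 𝒟.projHor ⟨x, a⟩) x.proj (fun _ => 𝒟.projHor_proj _)
    (fun a a' => by
      rw [← 𝒟.projHor_totalAdd (ξ := ⟨x, a⟩) (η := ⟨x, a'⟩) rfl, totalAdd_mk])
    (fun t a => (𝒟.projHor_totalSMul t ⟨x, a⟩))

theorem mk_projHorLin (x : TotalSpace FH H) (a : A x) :
    (⟨x.proj, 𝒟.projHorLin x a⟩ : TotalSpace FV V) = 𝒟.projHor ⟨x, a⟩ := mk_toFibre _

/-- The zero section of `𝒜 → V` on a fibre of `V → M`, a linear map into a fibre of `𝒜 → H`. -/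
noncomputable def zeroHorLin (m : M) : V m →ₗ[ℝ] A (zeroSection FH H m) :=
  toFibre (fun v => 𝒟.zeroHor ⟨m, v⟩) _ (fun _ => 𝒟.zeroHor_proj _)
    (fun v w => by
      rw [← 𝒟.zeroHor_totalAdd (v := ⟨m, v⟩) (w := ⟨m, w⟩) rfl, totalAdd_mk])
    (fun t v => (𝒟.zeroHor_totalSMul t ⟨m, v⟩))

theorem mk_zeroHorLin (m : M) (v : V m) :
    (⟨_, 𝒟.zeroHorLin m v⟩ : TotalSpace FA A) = 𝒟.zeroHor ⟨m, v⟩ := mk_toFibre _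

/-- The double projection `𝒜 → H ×_M V` is onto. Along the zero section of `H` the zeros of
`𝒜 → V` are preimages, so nearby fibres still map onto those of `V`; horizontal scalar
multiplication carries this to all of `H`. -/
theorem exists_proj_projHor [FiniteDimensional ℝ FV]
    [ContMDiffVectorBundle ∞ FA A (𝓘(ℝ, X).prod 𝓘(ℝ, FH))] (x : TotalSpace FH H)
    (v : TotalSpace FV V) (h : v.proj = x.proj) :
    ∃ ξ : TotalSpace FA A, ξ.proj = x ∧ 𝒟.projHor ξ = v := by
  obtain ⟨m, x⟩ := x
  obtain ⟨m', v⟩ := v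
  obtain rfl : m' = m := h
  rename' m' => m
  let x₀ := zeroSection FH H m
  let e := trivializationAt FA A x₀
  let eV := trivializationAt FV V m
  have hx₀ : x₀ ∈ e.baseSet := FiberBundle.mem_baseSet_trivializationAt' _
  have hm : m ∈ eV.baseSet := FiberBundle.mem_baseSet_trivializationAt' _
  let y : ℝ → TotalSpace FH H := fun t => totalSMul t ⟨m, x⟩
  have hy₀ : y 0 = x₀ := totalSMul_zero _
  have hy : ContMDiff 𝓘(ℝ, ℝ) (𝓘(ℝ, X).prod 𝓘(ℝ, FH)) ∞ y := contMDiff_totalSMul_const x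
  -- `a w` is the coordinate vector of the zero of `𝒜 → V` over `w`
  let a : FV →ₗ[ℝ] FA := e.linearMapAt ℝ x₀ ∘ₗ 𝒟.zeroHorLin m ∘ₗ eV.symmₗ ℝ m
  let f : ℝ → FV → TotalSpace FA A := fun t w => ⟨y t, e.symmₗ ℝ (y t) (a w)⟩
  -- `T t` is the projection to `V` of the vectors over `t x` with coordinates `a w`
  let T : ℝ → (FV →L[ℝ] FV) := fun t => LinearMap.toContinuousLinearMap
    (eV.linearMapAt ℝ m ∘ₗ 𝒟.projHorLin (y t) ∘ₗ e.symmₗ ℝ (y t) ∘ₗ a)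
  have hT : ∀ t w, T t w = (eV (𝒟.projHor (f t w))).2 := fun t w => by
    rw [← 𝒟.mk_projHorLin]
    change eV.linearMapAt ℝ m _ = _
    rw [Trivialization.coe_linearMapAt_of_mem _ hm]
    rfl
  have hyb : ∀ᶠ t in 𝓝 (0 : ℝ), y t ∈ e.baseSet :=
    hy.continuous.continuousAt.eventually (e.open_baseSet.mem_nhds (by rwa [hy₀]))
  have hf : ∀ t w, y t ∈ e.baseSet →
      f t w = e.toOpenPartialHomeomorph.symm (y t, a w) := fun t w ht => by
    rw [← e.mk_symm ht, ← e.coe_symmₗ (R := ℝ) ht]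
  have hf₀ : ∀ w, f 0 w = 𝒟.zeroHor ⟨m, eV.symmₗ ℝ m w⟩ := fun w => by
    rw [hf 0 w (by rwa [hy₀]), hy₀, ← mk_zeroHorLin]
    change e.toOpenPartialHomeomorph.symm (x₀, e.linearMapAt ℝ x₀ _) = _
    rw [Trivialization.coe_linearMapAt_of_mem _ hx₀]
    exact e.symm_apply_mk_proj (x := ⟨x₀, 𝒟.zeroHorLin m (eV.symmₗ ℝ m w)⟩) (e.mem_source.2 hx₀)
  have hT₀ : T 0 = ContinuousLinearMap.id ℝ FV := by
    ext w
    rw [hT, hf₀, projHor_zeroHor]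
    rw [eV.coe_symmₗ (R := ℝ) hm, eV.apply_mk_symm hm]
    rfl
  have hTs : ContMDiffAt 𝓘(ℝ, ℝ) 𝓘(ℝ, FV →L[ℝ] FV) ∞ T 0 := by
    refine contMDiffAt_clm_of_apply fun w => ?_
    have h1 : ContMDiffAt 𝓘(ℝ, ℝ) ((𝓘(ℝ, X).prod 𝓘(ℝ, FH)).prod 𝓘(ℝ, FA)) ∞
        (fun t => f t w) 0 := by
      have h2 := e.contMDiffOn_symm (n := ∞) (IB := 𝓘(ℝ, X).prod 𝓘(ℝ, FH))
      have h3 : (y 0, a w) ∈ e.target := e.mem_target.2 (by rwa [hy₀])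
      refine ((h2.contMDiffAt (e.open_target.mem_nhds h3)).comp (0 : ℝ)
        (hy.contMDiffAt.prodMk contMDiffAt_const)).congr_of_eventuallyEq ?_
      filter_upwards [hyb] with t ht using hf t w ht
    have h2 := (contMDiffAt_totalSpace.1 (𝒟.contMDiff_projHor.contMDiffAt.comp (0 : ℝ) h1)).2
    refine h2.congr_of_eventuallyEq (Eventually.of_forall fun t => ?_)
    refine (hT t w).trans ?_
    have h3 : (𝒟.projHor (f 0 w)).proj = m := by rw [hf₀, projHor_zeroHor]
    simp only [Function.comp_apply, h3]
    rfl
  have hopen : ∀ᶠ t in 𝓝 (0 : ℝ), T t ∈ Set.range ((↑) : (FV ≃L[ℝ] FV) → (FV →L[ℝ] FV)) := by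
    apply hTs.continuousAt.eventually
    rw [hT₀]
    exact (ContinuousLinearEquiv.refl ℝ FV).nhds
  obtain ⟨t, ⟨⟨T', hT'⟩, -⟩, ht⟩ := ((hopen.and hyb).filter_mono nhdsWithin_le_nhds |>.and
    (self_mem_nhdsWithin (a := (0 : ℝ)) (s := {0}ᶜ))).exists
  have ht : t ≠ 0 := ht
  -- for small `t ≠ 0` the fibre over `t x` maps onto `V`, and scaling back leads to `x`
  refine ⟨𝒟.smulHor t⁻¹ (f t (T'.symm (eV ⟨m, v⟩).2)), ?_, ?_⟩
  · rw [smulHor_proj]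
    change totalSMul t⁻¹ (totalSMul t ⟨m, x⟩) = _
    rw [totalSMul_totalSMul, inv_mul_cancel₀ ht, totalSMul_one]
  · rw [projHor_smulHor]
    have h1 := hT t (T'.symm (eV ⟨m, v⟩).2)
    rw [← hT'] at h1
    simp only [ContinuousLinearEquiv.coe_coe, ContinuousLinearEquiv.apply_symm_apply] at h1
    have h2 : (𝒟.projHor (f t (T'.symm (eV ⟨m, v⟩).2))).proj = m := 𝒟.projHor_proj _
    exact eV.eq_of_snd_eq h2 hm h1.symm

end Algebra

/-! ### The core -/

section CoreAlgebra

variable {𝒟 : DoubleVectorBundle X FH H FV V FA A FA' A'} (C : 𝒟.Core FK K)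

/-- On the core the two additions coincide. -/
theorem addHor_eq_totalAdd (𝒟 : DoubleVectorBundle X FH H FV V FA A FA' A') {m : M}
    {ξ η : TotalSpace FA A} (hξ : ξ.proj = zeroSection FH H m) (hη : η.proj = zeroSection FH H m)
    (hξ' : 𝒟.projHor ξ = zeroSection FV V m) (hη' : 𝒟.projHor η = zeroSection FV V m) :
    𝒟.addHor ξ η = totalAdd ξ η := by
  let z := zeroSection FA A (zeroSection FH H m)
  have hz : 𝒟.projHor z = zeroSection FV V m := 𝒟.projHor_zero _
  have h := 𝒟.addHor_totalAdd (ξ₁ := ξ) (ξ₂ := z) (ξ₃ := z) (ξ₄ := η) hξ hη.symm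
    (by rw [hξ', hz]) (by rw [hη', hz])
  have h1 : totalAdd ξ z = ξ := by
    have := totalAdd_zero ξ
    rwa [hξ] at this
  have h2 : totalAdd z η = η := by
    have := zero_totalAdd η
    rwa [hη] at this
  have h3 : z = 𝒟.zeroHor (zeroSection FV V m) := (𝒟.zeroHor_zeroSection m).symm
  rw [h1, h2, h3, 𝒟.addHor_zeroHor hξ', 𝒟.zeroHor_addHor hη'] at h
  exact h

theorem Core.incl_zero (m : M) :
    C.incl (zeroSection FK K m) = zeroSection FA A (zeroSection FH H m) := by
  have h := C.smul 0 (zeroSection FK K m)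
  rw [totalSMul_zero, totalSMul_zero, C.proj] at h
  exact h

/-- On the core the two scalar multiplications coincide: `t ↦ t · k̄` is additive, because the two
additions agree, and continuous, hence linear. -/
theorem Core.smulHor_incl (t : ℝ) (k : TotalSpace FK K) :
    𝒟.smulHor t (C.incl k) = C.incl (totalSMul t k) := by
  rw [C.smul]
  let x₀ := zeroSection FH H k.proj
  let e := trivializationAt FA A x₀
  have hx₀ : x₀ ∈ e.baseSet := FiberBundle.mem_baseSet_trivializationAt' _
  have hp : ∀ s, (𝒟.smulHor s (C.incl k)).proj = x₀ := fun s => by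
    rw [smulHor_proj, C.proj, totalSMul_zeroSection]
  have hh : ∀ s, 𝒟.projHor (𝒟.smulHor s (C.incl k)) = zeroSection FV V k.proj := fun s => by
    rw [projHor_smulHor, C.projHor]
  have hadd : ∀ ξ η : TotalSpace FA A, ξ.proj = x₀ → η.proj = x₀ →
      (e (totalAdd ξ η)).2 = (e ξ).2 + (e η).2 := by
    rintro ⟨b, x⟩ ⟨b', y⟩ hb hb'
    obtain rfl : b = x₀ := hb
    obtain rfl : b' = x₀ := hb'
    rw [totalAdd_mk]
    exact (e.linear ℝ hx₀).map_add x y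
  have hsmul : ∀ (s : ℝ) (ξ : TotalSpace FA A), ξ.proj = x₀ →
      (e (totalSMul s ξ)).2 = s • (e ξ).2 := by
    rintro s ⟨b, x⟩ hb
    obtain rfl : b = x₀ := hb
    exact (e.linear ℝ hx₀).map_smul s x
  let φ : ℝ →+ FA := AddMonoidHom.mk' (fun s => (e (𝒟.smulHor s (C.incl k))).2) fun s s' => by
    rw [add_smulHor, 𝒟.addHor_eq_totalAdd (hp s) (hp s') (hh s) (hh s'), hadd _ _ (hp s) (hp s')]
  have hφ : Continuous φ := by
    rw [continuous_iff_continuousAt]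
    intro s
    have h1 := (contMDiffAt_totalSpace.1 (𝒟.contMDiff_smulHor_scalar (C.incl k) s)).2
    simp only [hp] at h1
    exact h1.continuousAt
  have h1 := map_real_smul φ hφ t 1
  refine e.eq_of_snd_eq ((hp t).trans (C.proj k).symm) (by
    change (C.incl k).proj ∈ e.baseSet
    rw [C.proj]
    exact hx₀) ?_
  rw [hsmul t _ (C.proj k)]
  simp only [φ, AddMonoidHom.mk'_apply, smul_eq_mul, mul_one, smulHor_one] at h1
  exact h1

/-- Along the zero section of `H`, the fibres of `𝒜 → H` split: every element is the sum of a zero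
of `𝒜 → V` and a core element. -/
theorem Core.exists_eq_totalAdd (m : M) (ξ : TotalSpace FA A)
    (hξ : ξ.proj = zeroSection FH H m) :
    ∃ (v : V m) (k : K m), totalAdd (𝒟.zeroHor ⟨m, v⟩) (C.incl ⟨m, k⟩) = ξ := by
  have hm : (𝒟.projHor ξ).proj = m := by rw [projHor_proj, hξ]; rfl
  obtain ⟨v, hv⟩ : ∃ v : V m, 𝒟.projHor ξ = ⟨m, v⟩ := by
    rw [← hm]; exact ⟨(𝒟.projHor ξ).2, rfl⟩
  have hz : (𝒟.zeroHor ⟨m, v⟩).proj = ξ.proj := by rw [zeroHor_proj, hξ]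
  have hz' : ξ.proj = (totalSMul (-1) (𝒟.zeroHor ⟨m, v⟩)).proj := hz.symm
  obtain ⟨⟨m', k⟩, hk⟩ := C.surjective m (totalAdd ξ (totalSMul (-1) (𝒟.zeroHor ⟨m, v⟩)))
    (by rw [totalAdd_proj _ _ hz', hξ])
    (by rw [projHor_totalAdd _ hz', projHor_totalSMul, projHor_zeroHor, hv]
        simp [totalSMul, totalAdd_mk, zeroSection])
  obtain rfl : m' = m := by
    have h1 := 𝒟.projHor_proj (C.incl ⟨m', k⟩)
    rw [C.projHor, hk, totalAdd_proj _ _ hz', hξ] at h1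
    exact h1
  exact ⟨v, k, by rw [hk, totalAdd_neg_cancel _ _ hz]⟩

theorem Core.eq_zero_of_totalAdd {m : M} {v : V m} {k : K m}
    (h : totalAdd (𝒟.zeroHor ⟨m, v⟩) (C.incl ⟨m, k⟩) =
      zeroSection FA A (zeroSection FH H m)) : v = 0 ∧ k = 0 := by
  have hp : (𝒟.zeroHor ⟨m, v⟩).proj = (C.incl ⟨m, k⟩).proj := by rw [zeroHor_proj, C.proj]
  have h1 := congrArg 𝒟.projHor h
  rw [projHor_totalAdd _ hp, projHor_zeroHor, C.projHor, projHor_zero] at h1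
  have hv : v = 0 := by
    have h2 := (totalAdd_zero (⟨m, v⟩ : TotalSpace FV V)).symm.trans h1
    exact TotalSpace.mk_injective m h2
  subst hv
  refine ⟨rfl, ?_⟩
  have h3 : 𝒟.zeroHor ⟨m, 0⟩ = zeroSection FA A (zeroSection FH H m) := 𝒟.zeroHor_zeroSection m
  have h4 := zero_totalAdd (C.incl ⟨m, k⟩)
  rw [C.proj] at h4
  rw [h3, h4, ← C.incl_zero] at h
  exact TotalSpace.mk_injective m (C.injective h)

theorem Core.translate_zeroSection (m : M) (k : K m) :
    C.translate (zeroSection FH H m) k = C.incl ⟨m, k⟩ := by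
  unfold Core.translate
  rw [← 𝒟.zeroHor_zeroSection]
  exact 𝒟.zeroHor_addHor (C.projHor _)

theorem Core.projHor_translate (x : TotalSpace FH H) (k : K x.proj) :
    𝒟.projHor (C.translate x k) = zeroSection FV V x.proj := by
  rw [Core.translate, 𝒟.projHor_addHor (C.translate_projHor x k), projHor_zero]

theorem Core.smulHor_translate (t : ℝ) (x : TotalSpace FH H) (k : K x.proj) :
    𝒟.smulHor t (C.translate x k) = C.translate (totalSMul t x) (t • k) := by
  rw [Core.translate, 𝒟.smulHor_addHor t (C.translate_projHor x k), smulHor_zeroSection,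
    C.smulHor_incl]
  rfl

end CoreAlgebra

/-! ### Scalar multiplication in the second structure on the dual -/

section DualSMul

variable (𝒟 : DoubleVectorBundle X FH H FV V FA A FA' A')

/-- Horizontal scalar multiplication by `t` on a fibre of `𝒜 → H`. -/
noncomputable def smulHorLin (t : ℝ) (x : TotalSpace FH H) : A x →ₗ[ℝ] A (totalSMul t x) :=
  toFibre (fun a => 𝒟.smulHor t ⟨x, a⟩) _ (fun _ => 𝒟.smulHor_proj _ _)
    (fun a a' => by
      rw [← 𝒟.smulHor_totalAdd t (ξ := ⟨x, a⟩) (η := ⟨x, a'⟩) rfl, totalAdd_mk])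
    (fun s a => 𝒟.smulHor_totalSMul s t ⟨x, a⟩)

theorem mk_smulHorLin (t : ℝ) (x : TotalSpace FH H) (a : A x) :
    (⟨_, 𝒟.smulHorLin t x a⟩ : TotalSpace FA A) = 𝒟.smulHor t ⟨x, a⟩ := mk_toFibre _

theorem smulHorLin_bijective {t : ℝ} (ht : t ≠ 0) (x : TotalSpace FH H) :
    Function.Bijective (𝒟.smulHorLin t x) := by
  refine toFibre_bijective (fun a ha => ?_) fun ξ hξ => ?_
  · have h := 𝒟.smulHor_inv_smulHor ht ⟨x, a⟩
    rw [ha, smulHor_zeroSection, totalSMul_totalSMul, inv_mul_cancel₀ ht, totalSMul_one] at h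
    exact (TotalSpace.mk_injective x h).symm
  · have h : (𝒟.smulHor t⁻¹ ξ).proj = x := by
      rw [smulHor_proj, hξ, totalSMul_totalSMul, inv_mul_cancel₀ ht, totalSMul_one]
    subst h
    exact ⟨(𝒟.smulHor t⁻¹ ξ).2, 𝒟.smulHor_smulHor_inv ht ξ⟩

variable [FiniteDimensional ℝ FA]

/-- Scalar multiplication by `t ≠ 0` in the bundle `𝒜^{*V} → K*`: the functional `Φ` over `x` goes
to `ξ ↦ t ⟨Φ, t⁻¹ ξ⟩` over `t x`. -/
noncomputable def dualSMul {t : ℝ} (ht : t ≠ 0) (Φ : DualTotal FA A) : DualTotal FA A :=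
  ⟨totalSMul t Φ.proj, ⟨t • Φ.2.toLinearMap ∘ₗ
      (LinearEquiv.ofBijective _ (𝒟.smulHorLin_bijective ht Φ.proj)).symm.toLinearMap,
    continuous_of_linear_fibre (F := FA) _⟩⟩

theorem dualSMul_apply {t : ℝ} (ht : t ≠ 0) (Φ : DualTotal FA A) (a : A Φ.proj) :
    (𝒟.dualSMul ht Φ).2 (𝒟.smulHorLin t Φ.proj a) = t * Φ.2 a := by
  change t * Φ.2 ((LinearEquiv.ofBijective _ (𝒟.smulHorLin_bijective ht Φ.proj)).symm _) = _
  congr 2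
  exact (LinearEquiv.ofBijective _ (𝒟.smulHorLin_bijective ht Φ.proj)).symm_apply_apply a

theorem dualPair_dualSMul {t : ℝ} (ht : t ≠ 0) (Φ : DualTotal FA A) (ξ : TotalSpace FA A)
    (hξ : ξ.proj = Φ.proj) :
    dualPair (𝒟.dualSMul ht Φ) (𝒟.smulHor t ξ) = t * dualPair Φ ξ := by
  obtain ⟨x, Φ⟩ := Φ
  obtain ⟨x', a⟩ := ξ
  obtain rfl : x' = x := hξ
  rw [← mk_smulHorLin, dualPair_mk]
  exact (dualPair_mk _ _ _).trans (𝒟.dualSMul_apply ht ⟨x', Φ⟩ a)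

theorem contMDiff_dualSMul [ContMDiffVectorBundle ∞ FA A (𝓘(ℝ, X).prod 𝓘(ℝ, FH))]
    {t : ℝ} (ht : t ≠ 0)
    (hs : IsVectorBundleHom (𝓘(ℝ, X).prod 𝓘(ℝ, FH)) (𝓘(ℝ, X).prod 𝓘(ℝ, FH))
      (𝒟.smulHor t) (totalSMul t)) :
    ContMDiff ((𝓘(ℝ, X).prod 𝓘(ℝ, FH)).prod 𝓘(ℝ, FA →L[ℝ] ℝ))
      ((𝓘(ℝ, X).prod 𝓘(ℝ, FH)).prod 𝓘(ℝ, FA →L[ℝ] ℝ)) ∞ (𝒟.dualSMul ht) := by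
  intro Φ₀
  let e := trivializationAt FA A Φ₀.proj
  have he : Φ₀.proj ∈ e.baseSet := FiberBundle.mem_baseSet_trivializationAt' _
  have hproj : ContMDiffAt ((𝓘(ℝ, X).prod 𝓘(ℝ, FH)).prod 𝓘(ℝ, FA →L[ℝ] ℝ))
      (𝓘(ℝ, X).prod 𝓘(ℝ, FH)) ∞ (fun Φ : DualTotal FA A => Φ.proj) Φ₀ :=
    contMDiffAt_proj _
  have hframe : ∀ w : FA, ContMDiffAt ((𝓘(ℝ, X).prod 𝓘(ℝ, FH)).prod 𝓘(ℝ, FA →L[ℝ] ℝ))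
      ((𝓘(ℝ, X).prod 𝓘(ℝ, FH)).prod 𝓘(ℝ, FA)) ∞
      (fun Φ : DualTotal FA A => TotalSpace.mk' FA Φ.proj (e.symmₗ ℝ Φ.proj w)) Φ₀ := fun w =>
    (contMDiffAt_symmₗ e he w).comp Φ₀ hproj
  refine contMDiffAt_dual_of_frame (b := fun Φ : DualTotal FA A => totalSMul t Φ.proj)
    (S := fun Φ => 𝒟.smulHorLin t Φ.proj ∘ₗ e.symmₗ ℝ Φ.proj)
    (Ψ := fun Φ => (𝒟.dualSMul ht Φ).2) (hs.smooth_base.contMDiffAt.comp Φ₀ hproj)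
    (fun w => ?_) ((𝒟.smulHorLin_bijective ht _).comp (symmₗ_bijective e he)) (fun w => ?_)
  · refine (hs.smooth.contMDiffAt.comp Φ₀ (hframe w)).congr_of_eventuallyEq
      (Eventually.of_forall fun Φ => ?_)
    exact 𝒟.mk_smulHorLin t Φ.proj _
  · have h1 := contMDiffAt_const (c := t) |>.mul (ContMDiffAt.dual_apply contMDiffAt_id (hframe w))
    refine h1.congr_of_eventuallyEq (Eventually.of_forall fun Φ => ?_)
    exact 𝒟.dualSMul_apply ht Φ _

variable {𝒟} (C : 𝒟.Core FK K) [FiniteDimensional ℝ FK]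

theorem Core.dualProj_dualSMul {t : ℝ} (ht : t ≠ 0) (Φ : DualTotal FA A) :
    C.dualProj (𝒟.dualSMul ht Φ) = C.dualProj Φ := by
  have key : ∀ k : K Φ.proj.proj, dualPair (𝒟.dualSMul ht Φ)
      (C.translate (totalSMul t Φ.proj) k) = dualPair Φ (C.translate Φ.proj k) := fun k => by
    have h1 := (C.smulHor_translate t Φ.proj (t⁻¹ • k)).trans
      (congrArg (C.translate (totalSMul t Φ.proj)) (smul_inv_smul₀ ht k))
    refine (congrArg (dualPair (𝒟.dualSMul ht Φ)) h1.symm).trans ?_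
    rw [dualPair_dualSMul _ _ _ _ (C.translate_proj _ _), C.translate_smul,
      dualPair_totalSMul _ (C.translate_proj _ _), mul_inv_cancel_left₀ ht]
  exact congrArg (TotalSpace.mk Φ.proj.proj) (ContinuousLinearMap.ext key)

theorem Core.isDualSMul_dualSMul {t : ℝ} (ht : t ≠ 0) (Φ : DualTotal FA A) :
    C.IsDualSMul t Φ (𝒟.dualSMul ht Φ) :=
  ⟨C.dualProj_dualSMul ht Φ, rfl, fun ξ hξ => 𝒟.dualPair_dualSMul ht Φ ξ hξ⟩

end DualSMul

/-! ### Scaling of the Poisson bracket -/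

section ConformalDual

variable
  [FiniteDimensional ℝ X] [FiniteDimensional ℝ FH] [FiniteDimensional ℝ FA] [T2Space M]
  [IsManifold 𝓘(ℝ, X) ∞ M] [ContMDiffVectorBundle ∞ FH H 𝓘(ℝ, X)]
  [ContMDiffVectorBundle ∞ FA A (𝓘(ℝ, X).prod 𝓘(ℝ, FH))]
  (𝒟 : DoubleVectorBundle X FH H FV V FA A FA' A')
  {L : LieAlgebroid (𝓘(ℝ, X).prod 𝓘(ℝ, FH)) FA A}

/-- The pullback `x ↦ t⁻¹ · ξ(t x)` of a section of `𝒜 → H` by horizontal scalar multiplication. -/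
noncomputable def sectionPullback (hs : ∀ t : ℝ, IsLieAlgebroidHom L L (𝒟.smulHor t) (totalSMul t))
    {t : ℝ} (ht : t ≠ 0) (ξ : Cₛ^∞⟮𝓘(ℝ, X).prod 𝓘(ℝ, FH); FA, A⟯) :
    Cₛ^∞⟮𝓘(ℝ, X).prod 𝓘(ℝ, FH); FA, A⟯ :=
  ContMDiffSection.ofMap (σ := fun x => 𝒟.smulHor t⁻¹ ⟨totalSMul t x, ξ (totalSMul t x)⟩)
    ((hs t⁻¹).isVectorBundleHom.smooth.comp
      (ξ.contMDiff.comp (hs t).isVectorBundleHom.smooth_base))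
    (fun x => by
      rw [smulHor_proj]
      change totalSMul t⁻¹ (totalSMul t x) = x
      rw [totalSMul_totalSMul, inv_mul_cancel₀ ht, totalSMul_one])

variable (hs : ∀ t : ℝ, IsLieAlgebroidHom L L (𝒟.smulHor t) (totalSMul t))
  {t : ℝ} (ht : t ≠ 0)

include hs in
theorem smulHor_sectionPullback (ξ : Cₛ^∞⟮𝓘(ℝ, X).prod 𝓘(ℝ, FH); FA, A⟯)
    (x : TotalSpace FH H) :
    𝒟.smulHor t ⟨x, 𝒟.sectionPullback hs ht ξ x⟩ = ⟨totalSMul t x, ξ (totalSMul t x)⟩ := by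
  rw [sectionPullback, ContMDiffSection.mk_ofMap, smulHor_smulHor_inv _ ht]

theorem smulHorLin_sectionPullback (ξ : Cₛ^∞⟮𝓘(ℝ, X).prod 𝓘(ℝ, FH); FA, A⟯)
    (x : TotalSpace FH H) :
    𝒟.smulHorLin t x (𝒟.sectionPullback hs ht ξ x) = ξ (totalSMul t x) :=
  TotalSpace.mk_injective (F := FA) _
    ((𝒟.mk_smulHorLin t x _).trans (𝒟.smulHor_sectionPullback hs ht ξ x))

/-- Pulling back sections by horizontal scalar multiplication preserves the bracket: in the bracket
condition for the morphism, each pulled back section has an expansion with a single term and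
coefficient `1`. -/
theorem smulHorLin_bracket_sectionPullback (ξ η : Cₛ^∞⟮𝓘(ℝ, X).prod 𝓘(ℝ, FH); FA, A⟯)
    (x : TotalSpace FH H) :
    𝒟.smulHorLin t x (L.bracket (𝒟.sectionPullback hs ht ξ) (𝒟.sectionPullback hs ht η) x) =
      L.bracket ξ η (totalSMul t x) := by
  apply TotalSpace.mk_injective (F := FA) (totalSMul t x)
  rw [mk_smulHorLin]
  have h := (hs t).bracket (𝒟.sectionPullback hs ht ξ) (𝒟.sectionPullback hs ht η) 1 1
    (fun _ => 1) (fun _ => ξ) (fun _ => 1) (fun _ => η)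
    (fun n => by
      refine (𝒟.smulHor_sectionPullback hs ht _ n).trans ?_
      simp only [Finset.univ_unique, Finset.sum_singleton]
      exact congrArg _ (one_smul ℝ _).symm)
    (fun n => by
      refine (𝒟.smulHor_sectionPullback hs ht _ n).trans ?_
      simp only [Finset.univ_unique, Finset.sum_singleton]
      exact congrArg _ (one_smul ℝ _).symm) x
  have hc : ∀ w, dirDeriv (𝓘(ℝ, X).prod 𝓘(ℝ, FH))
      (1 : C^∞⟮𝓘(ℝ, X).prod 𝓘(ℝ, FH), TotalSpace FH H; ℝ⟯) x w = 0 := fun w => by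
    have : mfderiv (𝓘(ℝ, X).prod 𝓘(ℝ, FH)) 𝓘(ℝ, ℝ) (fun _ : TotalSpace FH H => (1 : ℝ)) x = 0 :=
      mfderiv_const
    exact congrArg (fun l => l w) this
  have h1 : (1 : C^∞⟮𝓘(ℝ, X).prod 𝓘(ℝ, FH), TotalSpace FH H; ℝ⟯) x = 1 := rfl
  refine h.trans ?_
  simp only [hc, h1, Finset.univ_unique, Finset.sum_singleton, one_mul, one_smul, zero_smul,
    add_zero, sub_zero]

theorem sectionFunction_dualSMul (ξ : Cₛ^∞⟮𝓘(ℝ, X).prod 𝓘(ℝ, FH); FA, A⟯)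
    (Φ : DualTotal FA A) :
    sectionFunction ξ (𝒟.dualSMul ht Φ) =
      t * sectionFunction (𝒟.sectionPullback hs ht ξ) Φ := by
  change (𝒟.dualSMul ht Φ).2 (ξ (totalSMul t Φ.proj)) = t * Φ.2 _
  rw [← 𝒟.dualSMul_apply ht, smulHorLin_sectionPullback]

theorem dirDeriv_comp_totalSMul (f : C^∞⟮𝓘(ℝ, X).prod 𝓘(ℝ, FH), TotalSpace FH H; ℝ⟯)
    (ξ : Cₛ^∞⟮𝓘(ℝ, X).prod 𝓘(ℝ, FH); FA, A⟯) (x : TotalSpace FH H) :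
    dirDeriv (𝓘(ℝ, X).prod 𝓘(ℝ, FH)) (fun y => f (totalSMul t y)) x
        (L.anchor x (𝒟.sectionPullback hs ht ξ x)) =
      dirDeriv (𝓘(ℝ, X).prod 𝓘(ℝ, FH)) f (totalSMul t x)
        (L.anchor (totalSMul t x) (ξ (totalSMul t x))) := by
  have h := (hs t).anchor ⟨x, 𝒟.sectionPullback hs ht ξ x⟩
  rw [smulHor_sectionPullback] at h
  have h1 := TotalSpace.mk_injective _ h
  rw [dirDeriv, dirDeriv, ← h1]
  have hf : MDifferentiableAt (𝓘(ℝ, X).prod 𝓘(ℝ, FH)) 𝓘(ℝ, ℝ) f (totalSMul t x) :=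
    f.contMDiff.mdifferentiable (by simp) _
  have hg : MDifferentiableAt (𝓘(ℝ, X).prod 𝓘(ℝ, FH)) (𝓘(ℝ, X).prod 𝓘(ℝ, FH))
      (totalSMul t : TotalSpace FH H → TotalSpace FH H) x :=
    (hs t).isVectorBundleHom.smooth_base.mdifferentiable (by simp) _
  have h2 := mfderiv_comp x hf hg
  exact congrArg (fun l => l (L.anchor x (𝒟.sectionPullback hs ht ξ x))) h2

/-- `dualSMul` as a smooth map. -/
noncomputable def dualSMulMap :
    C^∞⟮(𝓘(ℝ, X).prod 𝓘(ℝ, FH)).prod 𝓘(ℝ, FA →L[ℝ] ℝ), DualTotal FA A;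
      (𝓘(ℝ, X).prod 𝓘(ℝ, FH)).prod 𝓘(ℝ, FA →L[ℝ] ℝ), DualTotal FA A⟯ :=
  ⟨𝒟.dualSMul ht, 𝒟.contMDiff_dualSMul ht (hs t).isVectorBundleHom⟩

/-- Scalar multiplication by `t` in `𝒜^{*V} → K*` multiplies the dual Poisson bracket by `t`. It is
the composite of fibrewise multiplication by `t` in `𝒜^{*V} → H`, for which this holds because the
bracket of `ℓ_ξ` and `ℓ_η` is linear again, with the dual of a Lie algebroid automorphism. -/
theorem bracket_comp_dualSMul
    {P : PoissonStructure ((𝓘(ℝ, X).prod 𝓘(ℝ, FH)).prod 𝓘(ℝ, FA →L[ℝ] ℝ)) (DualTotal FA A)}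
    (hP : L.IsDualPoisson P)
    (f g : C^∞⟮(𝓘(ℝ, X).prod 𝓘(ℝ, FH)).prod 𝓘(ℝ, FA →L[ℝ] ℝ), DualTotal FA A; ℝ⟯)
    (Φ : DualTotal FA A) :
    P.bracket (f.comp (𝒟.dualSMulMap hs ht)) (g.comp (𝒟.dualSMulMap hs ht)) Φ =
      t * P.bracket f g (𝒟.dualSMul ht Φ) := by
  have : T2Space (TotalSpace FH H) := FiberBundle.t2Space_totalSpace
  have hsec : ∀ ξ : Cₛ^∞⟮𝓘(ℝ, X).prod 𝓘(ℝ, FH); FA, A⟯,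
      (sectionFunction ξ).comp (𝒟.dualSMulMap hs ht) =
        t • sectionFunction (𝒟.sectionPullback hs ht ξ) := fun ξ =>
    ContMDiffMap.ext fun Φ => 𝒟.sectionFunction_dualSMul hs ht ξ Φ
  let scale : C^∞⟮𝓘(ℝ, X).prod 𝓘(ℝ, FH), TotalSpace FH H; 𝓘(ℝ, X).prod 𝓘(ℝ, FH),
    TotalSpace FH H⟯ := ⟨totalSMul t, (hs t).isVectorBundleHom.smooth_base⟩
  have hbase : ∀ f : C^∞⟮𝓘(ℝ, X).prod 𝓘(ℝ, FH), TotalSpace FH H; ℝ⟯,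
      (basePullback (F := FA) (E := A) f).comp (𝒟.dualSMulMap hs ht) =
        basePullback (f.comp scale) := fun f => rfl
  refine P.bracket_comp_of_generators (𝒟.dualSMulMap hs ht) t Φ (fun ξ η => ?_) (fun ξ f => ?_)
    (fun f g => ?_) f g
  · rw [hsec, hsec, map_smul, map_smul, LinearMap.smul_apply, hP.section_section,
      hP.section_section]
    change t * (t * Φ.2 _) = t * (𝒟.dualSMul ht Φ).2 (L.bracket ξ η (totalSMul t Φ.proj))
    rw [← 𝒟.smulHorLin_bracket_sectionPullback hs ht, dualSMul_apply]
  · rw [hsec, hbase, map_smul, LinearMap.smul_apply, hP.section_base]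
    change t * P.bracket _ _ Φ = _
    rw [hP.section_base]
    exact congrArg (t * ·) (𝒟.dirDeriv_comp_totalSMul hs ht f ξ Φ.proj)
  · rw [hbase, hbase, hP.base_base, hP.base_base]
    exact (mul_zero t).symm

end ConformalDual

/-! ### Linear combinations in the second structure on the dual -/

section Families

variable {𝒟 : DoubleVectorBundle X FH H FV V FA A FA' A'}

/-- Every fibre of `𝒜 → H` contains a linear lift of the fibre of `V`. -/
theorem exists_rightInverse_projHorLin (𝒟 : DoubleVectorBundle X FH H FV V FA A FA' A')
    [FiniteDimensional ℝ FV] [ContMDiffVectorBundle ∞ FA A (𝓘(ℝ, X).prod 𝓘(ℝ, FH))] {m : M}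
    (x : H m) :
    ∃ r : V m →ₗ[ℝ] A ⟨m, x⟩, ∀ v, 𝒟.projHor ⟨⟨m, x⟩, r v⟩ = ⟨m, v⟩ := by
  obtain ⟨r, hr⟩ := (𝒟.projHorLin ⟨m, x⟩).exists_rightInverse_of_surjective
    (LinearMap.range_eq_top.2 fun v => by
      obtain ⟨⟨x', a⟩, hx, ha⟩ := 𝒟.exists_proj_projHor ⟨m, x⟩ ⟨m, v⟩ rfl
      obtain rfl : x' = ⟨m, x⟩ := hx
      exact ⟨a, TotalSpace.mk_injective (F := FV) m ((𝒟.mk_projHorLin _ a).trans ha)⟩)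
  refine ⟨r, fun v => ?_⟩
  rw [← 𝒟.mk_projHorLin]
  exact congrArg (TotalSpace.mk m) (LinearMap.congr_fun hr v)

/-- The horizontal linear combination `s r₁ + t r₂` of two linear lifts `V_m → 𝒜`. -/
noncomputable def combHorLin (𝒟 : DoubleVectorBundle X FH H FV V FA A FA' A') {m : M}
    {x₁ x₂ : H m} {r₁ : V m →ₗ[ℝ] A ⟨m, x₁⟩} {r₂ : V m →ₗ[ℝ] A ⟨m, x₂⟩}
    (h₁ : ∀ v, 𝒟.projHor ⟨⟨m, x₁⟩, r₁ v⟩ = ⟨m, v⟩) (h₂ : ∀ v, 𝒟.projHor ⟨⟨m, x₂⟩, r₂ v⟩ = ⟨m, v⟩)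
    (s t : ℝ) : V m →ₗ[ℝ] A ⟨m, s • x₁ + t • x₂⟩ :=
  toFibre (fun v => 𝒟.addHor (𝒟.smulHor s ⟨_, r₁ v⟩) (𝒟.smulHor t ⟨_, r₂ v⟩)) _
    (fun v => by
      rw [𝒟.addHor_proj (by rw [projHor_smulHor, projHor_smulHor, h₁, h₂]), smulHor_proj,
        smulHor_proj]
      exact totalAdd_mk m (s • x₁) (t • x₂))
    (fun v w => by
      rw [map_add, map_add, ← totalAdd_mk (F := FA), ← totalAdd_mk (F := FA),
        𝒟.smulHor_totalAdd s (ξ := ⟨_, r₁ v⟩) (η := ⟨_, r₁ w⟩) rfl,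
        𝒟.smulHor_totalAdd t (ξ := ⟨_, r₂ v⟩) (η := ⟨_, r₂ w⟩) rfl, 𝒟.addHor_totalAdd]
      · rw [smulHor_proj, smulHor_proj]
      · rw [smulHor_proj, smulHor_proj]
      · rw [projHor_smulHor, projHor_smulHor, h₁, h₂]
      · rw [projHor_smulHor, projHor_smulHor, h₁, h₂])
    (fun c v => by
      have e₁ : (⟨⟨m, x₁⟩, r₁ (c • v)⟩ : TotalSpace FA A) = totalSMul c ⟨_, r₁ v⟩ := by
        rw [map_smul]; rfl
      have e₂ : (⟨⟨m, x₂⟩, r₂ (c • v)⟩ : TotalSpace FA A) = totalSMul c ⟨_, r₂ v⟩ := by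
        rw [map_smul]; rfl
      rw [e₁, e₂, smulHor_totalSMul, smulHor_totalSMul, addHor_totalSMul]
      rw [projHor_smulHor, projHor_smulHor, h₁, h₂])

theorem mk_combHorLin {m : M}
    {x₁ x₂ : H m} {r₁ : V m →ₗ[ℝ] A ⟨m, x₁⟩} {r₂ : V m →ₗ[ℝ] A ⟨m, x₂⟩}
    (h₁ : ∀ v, 𝒟.projHor ⟨⟨m, x₁⟩, r₁ v⟩ = ⟨m, v⟩) (h₂ : ∀ v, 𝒟.projHor ⟨⟨m, x₂⟩, r₂ v⟩ = ⟨m, v⟩)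
    (s t : ℝ) (v : V m) : (⟨_, 𝒟.combHorLin h₁ h₂ s t v⟩ : TotalSpace FA A) =
      𝒟.addHor (𝒟.smulHor s ⟨_, r₁ v⟩) (𝒟.smulHor t ⟨_, r₂ v⟩) := mk_toFibre _

variable (C : 𝒟.Core FK K)

/-- `k ↦ 0_x + k̄` as a linear map. -/
noncomputable def Core.translateLin (x : TotalSpace FH H) : K x.proj →ₗ[ℝ] A x :=
  toFibre (fun k => C.translate x k) x (fun k => C.translate_proj x k)
    (fun k l => C.translate_add x k l) (fun t k => C.translate_smul x t k)

theorem Core.mk_translateLin (x : TotalSpace FH H) (k : K x.proj) :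
    (⟨x, C.translateLin x k⟩ : TotalSpace FA A) = C.translate x k := mk_toFibre _

theorem Core.translate_zero {m : M} {x : H m} (hx : x = 0) (k : K m) :
    C.translate ⟨m, x⟩ k = C.incl ⟨m, k⟩ := by
  subst hx
  exact C.translate_zeroSection m k

theorem addHor_zeroSection (𝒟 : DoubleVectorBundle X FH H FV V FA A FA' A')
    {x y : TotalSpace FH H} (h : x.proj = y.proj) :
    𝒟.addHor (zeroSection FA A x) (zeroSection FA A y) = zeroSection FA A (totalAdd x y) := by
  have h0 : 𝒟.projHor (zeroSection FA A x) = 𝒟.projHor (zeroSection FA A y) := by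
    rw [projHor_zero, projHor_zero, h]
  have h1 := 𝒟.addHor_totalSMul 0 h0
  rw [totalSMul_zero, totalSMul_zero, totalSMul_zero, 𝒟.addHor_proj h0] at h1
  exact h1

theorem dualPair_zeroSection (Φ : DualTotal FA A) :
    dualPair Φ (zeroSection FA A Φ.proj) = 0 :=
  (dualPair_mk _ _ _).trans (map_zero _)

variable [FiniteDimensional ℝ FK]

theorem Core.dualPair_translate {Φ : DualTotal FA A} {m : M} {x : H m} {κ : K m →L[ℝ] ℝ}
    (hp : Φ.proj = ⟨m, x⟩) (hκ : C.dualProj Φ = ⟨m, κ⟩) (k : K m) :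
    dualPair Φ (C.translate ⟨m, x⟩ k) = κ k := by
  obtain ⟨x', Φ⟩ := Φ
  obtain rfl : x' = ⟨m, x⟩ := hp
  exact congrArg (fun l => l k) (TotalSpace.mk_injective m hκ)

/-- A sum in `𝒜^{*V} → K*` lies over the same point of `K*` as its terms: the translate of a core
element to `x₁ + x₂` is the horizontal sum of its translate to `x₁` and of the zero over `x₂`. -/
theorem Core.IsDualSum.dualProj_eq_left {C : 𝒟.Core FK K} {Φ₁ Φ₂ Φ₃ : DualTotal FA A}
    (h : C.IsDualSum Φ₁ Φ₂ Φ₃) : C.dualProj Φ₃ = C.dualProj Φ₁ := by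
  have hm : Φ₂.proj.proj = Φ₁.proj.proj := (congrArg TotalSpace.proj h.dualProj_eq).symm
  obtain ⟨⟨m, x₁⟩, Φ₁⟩ := Φ₁
  obtain ⟨⟨m', x₂⟩, Φ₂⟩ := Φ₂
  obtain ⟨x₃, Φ₃⟩ := Φ₃
  obtain rfl : m' = m := hm
  have hp : x₃ = ⟨m', x₁ + x₂⟩ := h.proj.trans (totalAdd_mk _ _ _)
  subst hp
  refine congrArg (TotalSpace.mk m') (ContinuousLinearMap.ext fun k => ?_)
  change dualPair ⟨_, Φ₃⟩ (C.translate ⟨m', x₁ + x₂⟩ k) =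
    dualPair ⟨_, Φ₁⟩ (C.translate ⟨m', x₁⟩ k)
  have hz : 𝒟.projHor (zeroSection FA A (⟨m', x₁⟩ : TotalSpace FH H)) = zeroSection FV V m' :=
    𝒟.projHor_zero _
  have hz' : 𝒟.projHor (zeroSection FA A (⟨m', x₂⟩ : TotalSpace FH H)) = zeroSection FV V m' :=
    𝒟.projHor_zero _
  have h1 : C.translate ⟨m', x₁ + x₂⟩ k =
      𝒟.addHor (C.translate ⟨m', x₁⟩ k) (zeroSection FA A ⟨m', x₂⟩) := by
    have h2 := 𝒟.addHor_addHor_addHor_comm (ξ₁ := zeroSection FA A ⟨m', x₁⟩)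
      (ξ₂ := zeroSection FA A ⟨m', x₂⟩) (ξ₃ := C.incl ⟨m', k⟩)
      (ξ₄ := 𝒟.zeroHor (zeroSection FV V m')) (by rw [hz, hz']) (by rw [C.projHor, hz])
      (by rw [projHor_zeroHor, hz])
    rw [𝒟.addHor_zeroHor (C.projHor _), 𝒟.addHor_zeroHor hz',
      𝒟.addHor_zeroSection (x := ⟨m', x₁⟩) (y := ⟨m', x₂⟩) rfl,
      totalAdd_mk] at h2
    exact h2
  rw [h1, h.pair _ _ (C.translate_proj _ _) rfl ((C.projHor_translate _ _).trans hz'.symm)]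
  have h3 := dualPair_zeroSection (⟨⟨m', x₂⟩, Φ₂⟩ : DualTotal FA A)
  exact (congrArg (_ + ·) h3).trans (add_zero _)

/-- `Ψ` is the zero of the bundle `𝒜^{*V} → K*` over `κ`: it lies over a zero of `H`, where the fibre
of `𝒜 → H` is the sum of `V` (as zeros of `𝒜 → V`) and the core, and it vanishes on the former and
restricts to `κ` on the latter. -/
structure Core.IsDualZero (κ : DualTotal FK K) (Ψ : DualTotal FA A) : Prop where
  proj : Ψ.proj = zeroSection FH H κ.proj
  pair_zeroHor : ∀ v : V κ.proj, dualPair Ψ (𝒟.zeroHor ⟨κ.proj, v⟩) = 0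
  pair_incl : ∀ k : K κ.proj, dualPair Ψ (C.incl ⟨κ.proj, k⟩) = κ.2 k

theorem Core.IsDualZero.unique {C : 𝒟.Core FK K} {κ : DualTotal FK K} {Ψ Ψ' : DualTotal FA A}
    (h : C.IsDualZero κ Ψ) (h' : C.IsDualZero κ Ψ') : Ψ = Ψ' := by
  refine dualTotal_ext (h.proj.trans h'.proj.symm) fun ξ hξ => ?_
  obtain ⟨v, k, rfl⟩ := C.exists_eq_totalAdd κ.proj ξ (hξ.trans h.proj)
  rw [dualPair_totalAdd, dualPair_totalAdd, h.pair_zeroHor, h'.pair_zeroHor, h.pair_incl,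
    h'.pair_incl]
  · rw [zeroHor_proj, h'.proj]
  · rw [C.proj, h'.proj]
  · rw [zeroHor_proj, h.proj]
  · rw [C.proj, h.proj]

variable [FiniteDimensional ℝ FV]

/-- Two elements `Φ₁`, `Φ₂` of a fibre of `𝒜^{*V} → K*` have linear combinations `s Φ₁ + t Φ₂`
which, near `(s, t) = (0, 0)`, depend smoothly on `(s, t)`. They are obtained from their pairings
with the frame of `𝒜 → H` formed by the combinations `s ξ₁ + t ξ₂` of lifts of elements of `V_m` and
by the translates of core elements. -/
theorem Core.exists_dual_comb [ContMDiffVectorBundle ∞ FA A (𝓘(ℝ, X).prod 𝓘(ℝ, FH))]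
    {m : M} {x₁ x₂ : H m} (Φ₁ : A ⟨m, x₁⟩ →L[ℝ] ℝ)
    (Φ₂ : A ⟨m, x₂⟩ →L[ℝ] ℝ) (hq : C.dualProj ⟨_, Φ₁⟩ = C.dualProj ⟨_, Φ₂⟩) :
    ∃ Ψ : ℝ × ℝ → DualTotal FA A,
      ContMDiffAt 𝓘(ℝ, ℝ × ℝ) ((𝓘(ℝ, X).prod 𝓘(ℝ, FH)).prod 𝓘(ℝ, FA →L[ℝ] ℝ)) ∞ Ψ 0 ∧
      C.IsDualZero (C.dualProj ⟨_, Φ₁⟩) (Ψ 0) ∧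
      (∀ᶠ r in 𝓝 (0 : ℝ), ∀ Φ, C.IsDualSMul r ⟨_, Φ₁⟩ Φ → Φ = Ψ (r, 0)) ∧
      (∀ᶠ r in 𝓝 (0 : ℝ), ∀ Φ, C.IsDualSMul r ⟨_, Φ₂⟩ Φ → Φ = Ψ (0, r)) ∧
      ∀ Φ₃, C.IsDualSum ⟨_, Φ₁⟩ ⟨_, Φ₂⟩ Φ₃ →
        ∀ᶠ r in 𝓝 (0 : ℝ), ∀ Φ, C.IsDualSMul r Φ₃ Φ → Φ = Ψ (r, r) := by
  obtain ⟨r₁, h₁⟩ := 𝒟.exists_rightInverse_projHorLin x₁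
  obtain ⟨r₂, h₂⟩ := 𝒟.exists_rightInverse_projHorLin x₂
  let cV : FV ≃ₗ[ℝ] V m := (VectorBundle.continuousLinearEquivAt ℝ FV V m).symm.toLinearEquiv
  let cK : FK ≃ₗ[ℝ] K m := (VectorBundle.continuousLinearEquivAt ℝ FK K m).symm.toLinearEquiv
  let κ : K m →L[ℝ] ℝ := (C.dualProj ⟨_, Φ₁⟩).2
  have hκ₁ : C.dualProj ⟨_, Φ₁⟩ = ⟨m, κ⟩ := rfl
  have hκ₂ : C.dualProj ⟨_, Φ₂⟩ = ⟨m, κ⟩ := hq.symm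
  -- the base point of `s Φ₁ + t Φ₂`, the frame `S` over it, and the prescribed pairings `c`
  let b : ℝ × ℝ → TotalSpace FH H := fun n => ⟨m, n.1 • x₁ + n.2 • x₂⟩
  have hb : ContMDiff 𝓘(ℝ, ℝ × ℝ) (𝓘(ℝ, X).prod 𝓘(ℝ, FH)) ∞ b :=
    contMDiff_mk_linearMap ((LinearMap.toSpanSingleton ℝ (H m) x₁).coprod
      (LinearMap.toSpanSingleton ℝ (H m) x₂))
  let S : ∀ n : ℝ × ℝ, FV × FK →ₗ[ℝ] A (b n) := fun n =>
    (𝒟.combHorLin h₁ h₂ n.1 n.2 ∘ₗ cV.toLinearMap).coprod (C.translateLin (b n) ∘ₗ cK.toLinearMap)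
  let comb : ℝ × ℝ → V m → TotalSpace FA A := fun n v =>
    𝒟.addHor (𝒟.smulHor n.1 ⟨_, r₁ v⟩) (𝒟.smulHor n.2 ⟨_, r₂ v⟩)
  have hcomb : ∀ n v, (comb n v).proj = b n := fun n v => by
    exact (congrArg TotalSpace.proj (mk_combHorLin h₁ h₂ n.1 n.2 v)).symm
  have hS : ∀ n w, (⟨b n, S n w⟩ : TotalSpace FA A) =
      totalAdd (comb n (cV w.1)) (C.translate (b n) (cK w.2)) := fun n w => by
    have h3 := mk_combHorLin h₁ h₂ n.1 n.2 (cV w.1)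
    have h4 := C.mk_translateLin (b n) (cK w.2)
    exact ((congrArg₂ totalAdd h3.symm h4.symm).trans (totalAdd_mk _ _ _)).symm
  let c : ℝ × ℝ → (FV × FK →ₗ[ℝ] ℝ) := fun n =>
    (n.1 • (Φ₁.toLinearMap ∘ₗ r₁ ∘ₗ cV.toLinearMap) +
      n.2 • (Φ₂.toLinearMap ∘ₗ r₂ ∘ₗ cV.toLinearMap)).coprod (κ.toLinearMap ∘ₗ cK.toLinearMap)
  have hb₀ : (0 : ℝ) • x₁ + (0 : ℝ) • x₂ = 0 := by simp
  have hb₀' : b 0 = zeroSection FH H m := congrArg (TotalSpace.mk m) hb₀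
  have hcomb₀ : ∀ v, comb 0 v = 𝒟.zeroHor ⟨m, v⟩ := fun v => by
    change 𝒟.addHor (𝒟.smulHor 0 _) (𝒟.smulHor 0 _) = _
    rw [smulHor_zero, smulHor_zero, h₁, h₂]
    exact 𝒟.zeroHor_addHor (𝒟.projHor_zeroHor _)
  have htr₀ : ∀ k : K m, C.translate (b 0) k = C.incl ⟨m, k⟩ := fun k => C.translate_zero hb₀ k
  have hfst : ContMDiffAt 𝓘(ℝ, ℝ × ℝ) 𝓘(ℝ, ℝ) ∞ (Prod.fst : ℝ × ℝ → ℝ) 0 :=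
    contDiff_fst.contMDiff.contMDiffAt
  have hsnd : ContMDiffAt 𝓘(ℝ, ℝ × ℝ) 𝓘(ℝ, ℝ) ∞ (Prod.snd : ℝ × ℝ → ℝ) 0 :=
    contDiff_snd.contMDiff.contMDiffAt
  obtain ⟨Ψ, hΨ, hΨ'⟩ := exists_dual_of_frame (b := b) (S := S) (c := c) (n₀ := (0 : ℝ × ℝ))
    (J := 𝓘(ℝ, ℝ × ℝ)) (F := FA) hb.contMDiffAt
    (fun w => by
      have h3 : (fun n => TotalSpace.mk' FA (b n) (S n w)) =
        fun n => totalAdd (comb n (cV w.1)) (C.translate (b n) (cK w.2)) := funext fun n => hS n w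
      rw [h3]
      refine ContMDiffAt.totalAdd ?_ ?_ fun n => by rw [hcomb, C.translate_proj]
      · refine 𝒟.contMDiffAt_addHor ((𝒟.contMDiff_smulHor_scalar _).contMDiffAt.comp _ hfst)
          ((𝒟.contMDiff_smulHor_scalar _).contMDiffAt.comp _ hsnd) fun n => ?_
        rw [projHor_smulHor, projHor_smulHor, h₁, h₂]
      · exact 𝒟.contMDiffAt_addHor ((contMDiff_zeroSection ℝ A).contMDiffAt.comp _ hb.contMDiffAt)
          (contMDiffAt_const (c := C.incl ⟨m, cK w.2⟩)) fun n => C.translate_projHor (b n) (cK w.2))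
    (by
      constructor
      · rw [injective_iff_map_eq_zero]
        intro w hw
        have h3 := hS 0 w
        rw [hw, hcomb₀, htr₀] at h3
        have h4 := C.eq_zero_of_totalAdd (h3.symm.trans
          (congrArg (zeroSection FA A) hb₀'))
        exact Prod.ext (cV.map_eq_zero_iff.1 h4.1) (cK.map_eq_zero_iff.1 h4.2)
      · intro a
        obtain ⟨v, k, h3⟩ := C.exists_eq_totalAdd m ⟨b 0, a⟩ hb₀'
        refine ⟨(cV.symm v, cK.symm k), TotalSpace.mk_injective (F := FA) (b 0) ?_⟩
        rw [hS, hcomb₀, htr₀, cV.apply_symm_apply, cK.apply_symm_apply, h3])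
    (fun w => by
      have : (fun n => c n w) = fun n => n.1 * Φ₁ (r₁ (cV w.1)) + n.2 * Φ₂ (r₂ (cV w.1)) +
        κ (cK w.2) := rfl
      rw [this]
      exact ((hfst.mul contMDiffAt_const).add (hsnd.mul contMDiffAt_const)).add contMDiffAt_const)
  -- the frame spans, so an element over `b n` and `κ` is determined by its pairings with lifts
  have huniq : ∀ᶠ n in 𝓝 (0 : ℝ × ℝ), ∀ Φ : DualTotal FA A, Φ.proj = b n →
      C.dualProj Φ = ⟨m, κ⟩ →
      (∀ v, dualPair Φ (comb n v) = n.1 * Φ₁ (r₁ v) + n.2 * Φ₂ (r₂ v)) → Φ = ⟨b n, Ψ n⟩ := by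
    filter_upwards [hΨ'] with n hn Φ hp hκ hv
    refine dualTotal_ext hp fun ξ hξ => ?_
    obtain ⟨y, a⟩ := ξ
    obtain rfl : y = b n := hξ.trans hp
    obtain ⟨w, rfl⟩ := hn.1 a
    rw [dualPair_mk, hn.2, hS, dualPair_totalAdd ((hcomb _ _).trans hp.symm)
      ((C.translate_proj _ _).trans hp.symm), hv]
    exact congrArg (_ + ·) (C.dualPair_translate hp hκ (cK w.2))
  have hΨ₀ := hΨ'.self_of_nhds
  have htend : ∀ v : ℝ × ℝ, Tendsto (fun r : ℝ => r • v) (𝓝 0) (𝓝 0) := fun v => by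
    have : Continuous (fun r : ℝ => r • v) := by fun_prop
    simpa using this.tendsto 0
  refine ⟨fun n => ⟨b n, Ψ n⟩, hΨ, ⟨hb₀', fun v => ?_, fun k => ?_⟩, ?_, ?_, fun Φ₃ h₃ => ?_⟩
  · have h3 : 𝒟.combHorLin h₁ h₂ 0 0 v = S 0 (cV.symm v, 0) := by
      simp only [S, LinearMap.coprod_apply, LinearMap.comp_apply, LinearEquiv.coe_coe, map_zero,
        add_zero]
      exact congrArg _ (cV.apply_symm_apply v).symm
    have h4 : (⟨b 0, S 0 (cV.symm v, 0)⟩ : TotalSpace FA A) = 𝒟.zeroHor ⟨m, v⟩ := by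
      rw [← h3]
      exact (mk_combHorLin h₁ h₂ 0 0 v).trans (hcomb₀ v)
    have h5 : dualPair (⟨b 0, Ψ 0⟩ : DualTotal FA A) (𝒟.zeroHor ⟨m, v⟩) = 0 := by
      rw [← h4, dualPair_mk, hΨ₀.2]
      simp [c]
    exact h5
  · have h3 : C.translateLin (b 0) k = S 0 (0, cK.symm k) := by
      simp only [S, LinearMap.coprod_apply, LinearMap.comp_apply, LinearEquiv.coe_coe, map_zero,
        zero_add]
      exact congrArg _ (cK.apply_symm_apply k).symm
    have h4 : (⟨b 0, S 0 (0, cK.symm k)⟩ : TotalSpace FA A) = C.incl ⟨m, k⟩ := by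
      rw [← h3]
      exact (C.mk_translateLin (b 0) k).trans (htr₀ k)
    have h5 : dualPair (⟨b 0, Ψ 0⟩ : DualTotal FA A) (C.incl ⟨m, k⟩) = κ k := by
      rw [← h4, dualPair_mk, hΨ₀.2]
      simp only [c, LinearMap.coprod_apply, LinearMap.comp_apply, LinearEquiv.coe_coe, map_zero,
        zero_add]
      exact congrArg _ (cK.apply_symm_apply k)
    exact h5
  · have := (htend (1, 0)).eventually huniq
    filter_upwards [this] with r hr Φ hΦ
    rw [show r • ((1, 0) : ℝ × ℝ) = (r, 0) by simp] at hr
    refine hr Φ (hΦ.proj.trans (congrArg (TotalSpace.mk m) (by simp))) (hΦ.dualProj_eq.trans hκ₁)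
      fun v => ?_
    change dualPair Φ (𝒟.addHor (𝒟.smulHor r _) (𝒟.smulHor 0 _)) = _
    rw [𝒟.smulHor_zero, h₂, 𝒟.addHor_zeroHor (by rw [projHor_smulHor, h₁]), hΦ.pair _ rfl,
      dualPair_mk]
    simp
  · have := (htend (0, 1)).eventually huniq
    filter_upwards [this] with r hr Φ hΦ
    rw [show r • ((0, 1) : ℝ × ℝ) = (0, r) by simp] at hr
    refine hr Φ (hΦ.proj.trans (congrArg (TotalSpace.mk m) (by simp))) (hΦ.dualProj_eq.trans hκ₂)
      fun v => ?_
    change dualPair Φ (𝒟.addHor (𝒟.smulHor 0 _) (𝒟.smulHor r _)) = _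
    rw [𝒟.smulHor_zero, h₁, 𝒟.zeroHor_addHor (by rw [projHor_smulHor, h₂]), hΦ.pair _ rfl,
      dualPair_mk]
    simp
  · have := (htend (1, 1)).eventually huniq
    filter_upwards [this] with r hr Φ hΦ
    rw [show r • ((1, 1) : ℝ × ℝ) = (r, r) by simp] at hr
    have hsum : Φ₃.proj = ⟨m, x₁ + x₂⟩ := h₃.proj.trans (totalAdd_mk _ _ _)
    have hh : ∀ v, 𝒟.projHor ⟨⟨m, x₁⟩, r₁ v⟩ = 𝒟.projHor ⟨⟨m, x₂⟩, r₂ v⟩ := fun v => by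
      rw [h₁, h₂]
    refine hr Φ (hΦ.proj.trans ?_) (hΦ.dualProj_eq.trans (h₃.dualProj_eq_left.trans hκ₁))
      fun v => ?_
    · rw [hsum]
      exact congrArg (TotalSpace.mk m) (smul_add r x₁ x₂)
    · change dualPair Φ (𝒟.addHor (𝒟.smulHor r _) (𝒟.smulHor r _)) = _
      rw [← 𝒟.smulHor_addHor r (hh v), hΦ.pair, h₃.pair _ _ rfl rfl (hh v), dualPair_mk,
        dualPair_mk, mul_add]
      rw [𝒟.addHor_proj (hh v), h₃.proj]

end Families

/-! ### Homogeneous functions -/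

section Homogeneous

variable {𝒟 : DoubleVectorBundle X FH H FV V FA A FA' A'} (C : 𝒟.Core FK K)
  [FiniteDimensional ℝ FA] [FiniteDimensional ℝ FK] [FiniteDimensional ℝ FV]
  [ContMDiffVectorBundle ∞ FA A (𝓘(ℝ, X).prod 𝓘(ℝ, FH))]

variable {C} in
theorem Core.IsDualSMul.eq_dualSMul {t : ℝ} (ht : t ≠ 0) {Φ Φ' : DualTotal FA A}
    (h : C.IsDualSMul t Φ Φ') : Φ' = 𝒟.dualSMul ht Φ := by
  refine dualTotal_ext h.proj fun ξ hξ => ?_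
  have hp : (𝒟.smulHor t⁻¹ ξ).proj = Φ.proj := by
    rw [smulHor_proj, hξ, h.proj, totalSMul_totalSMul, inv_mul_cancel₀ ht, totalSMul_one]
  have h1 := h.pair _ hp
  have h2 := 𝒟.dualPair_dualSMul ht Φ _ hp
  rw [smulHor_smulHor_inv _ ht] at h1 h2
  rw [h1, h2]

/-- A smooth function on `𝒜^{*V}` which is homogeneous of degree one for the scalar multiplication
of `𝒜^{*V} → K*` is linear on the fibres: along linear combinations it agrees with its derivative
at the zero of the fibre. -/
theorem Core.isDualLinear_of_homogeneous
    (f : C^∞⟮(𝓘(ℝ, X).prod 𝓘(ℝ, FH)).prod 𝓘(ℝ, FA →L[ℝ] ℝ), DualTotal FA A; ℝ⟯)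
    (hf : ∀ (t : ℝ) (ht : t ≠ 0) Φ, f (𝒟.dualSMul ht Φ) = t * f Φ) : C.IsDualLinear f := by
  have hdiff : ∀ Ψ : ℝ × ℝ → DualTotal FA A, ContMDiffAt 𝓘(ℝ, ℝ × ℝ)
      ((𝓘(ℝ, X).prod 𝓘(ℝ, FH)).prod 𝓘(ℝ, FA →L[ℝ] ℝ)) ∞ Ψ 0 →
      DifferentiableAt ℝ (fun n => f (Ψ n)) 0 := fun Ψ hΨ =>
    (f.contMDiff.contMDiffAt.comp 0 hΨ).contDiffAt.differentiableAt (by simp)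
  have hev : ∀ (Ψ : ℝ × ℝ → DualTotal FA A) (Φ : DualTotal FA A) (v : ℝ × ℝ),
      (∀ᶠ r in 𝓝 (0 : ℝ), ∀ Φ', C.IsDualSMul r Φ Φ' → Φ' = Ψ (r • v)) →
      ∀ᶠ r in 𝓝[≠] (0 : ℝ), f (Ψ (r • v)) = r * f Φ := fun Ψ Φ v h => by
    filter_upwards [h.filter_mono nhdsWithin_le_nhds, self_mem_nhdsWithin] with r hr hr0
    replace hr0 : r ≠ 0 := hr0
    rw [← hr _ (C.isDualSMul_dualSMul hr0 Φ), hf]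
  have e₁ : ∀ r : ℝ, r • ((1 : ℝ), (0 : ℝ)) = (r, 0) := fun r => by simp
  have e₂ : ∀ r : ℝ, r • ((0 : ℝ), (1 : ℝ)) = (0, r) := fun r => by simp
  have e₃ : ∀ r : ℝ, r • ((1 : ℝ), (1 : ℝ)) = (r, r) := fun r => by simp
  refine ⟨fun Φ₁ Φ₂ Φ₃ h => ?_, fun t Φ Φ' h => ?_⟩
  · have hm : Φ₁.proj.proj = Φ₂.proj.proj :=
      congrArg (fun κ : DualTotal FK K => κ.proj) h.dualProj_eq
    obtain ⟨⟨m, x₁⟩, Φ₁⟩ := Φ₁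
    obtain ⟨⟨m', x₂⟩, Φ₂⟩ := Φ₂
    obtain rfl : m = m' := hm
    obtain ⟨Ψ, hΨ, -, h₁, h₂, h₃⟩ := C.exists_dual_comb Φ₁ Φ₂ h.dualProj_eq
    have d₁ := ((hdiff Ψ hΨ).eq_zero_and_fderiv_apply (hev Ψ _ (1, 0) (by simpa only [e₁]))).2
    have d₂ := ((hdiff Ψ hΨ).eq_zero_and_fderiv_apply (hev Ψ _ (0, 1) (by simpa only [e₂]))).2
    have d₃ := ((hdiff Ψ hΨ).eq_zero_and_fderiv_apply
      (hev Ψ _ (1, 1) (by simpa only [e₃] using h₃ _ h))).2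
    have hsum : ((1 : ℝ), (1 : ℝ)) = (1, 0) + (0, 1) := by simp
    rw [hsum, map_add, d₁, d₂] at d₃
    exact d₃.symm
  · rcases eq_or_ne t 0 with rfl | ht
    · obtain ⟨⟨m, x⟩, Φ⟩ := Φ
      obtain ⟨Ψ, hΨ, -, h₁, -⟩ := C.exists_dual_comb Φ Φ rfl
      have d := ((hdiff Ψ hΨ).eq_zero_and_fderiv_apply (hev Ψ _ (1, 0) (by simpa only [e₁]))).1
      rw [h₁.self_of_nhds Φ' h, zero_mul]
      exact d
    · rw [h.eq_dualSMul ht, hf]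

/-- As `t → 0` the multiples `t Φ` in `𝒜^{*V} → K*` converge to the zero over the same point. -/
theorem Core.exists_tendsto_dualSMul (Φ : DualTotal FA A) :
    ∃ Ψ : ℝ → DualTotal FA A, C.IsDualZero (C.dualProj Φ) (Ψ 0) ∧
      Tendsto Ψ (𝓝[≠] 0) (𝓝 (Ψ 0)) ∧
      ∀ᶠ t in 𝓝[≠] (0 : ℝ), ∃ ht : t ≠ 0, Ψ t = 𝒟.dualSMul ht Φ := by
  obtain ⟨⟨m, x⟩, Φ⟩ := Φ
  obtain ⟨Ψ, hΨ, h₀, h₁, -⟩ := C.exists_dual_comb Φ Φ rfl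
  refine ⟨fun t => Ψ (t, 0), h₀, ?_, ?_⟩
  · have h2 : Tendsto (fun t : ℝ => (t, (0 : ℝ))) (𝓝 0) (𝓝 0) := by
      have : Continuous fun t : ℝ => (t, (0 : ℝ)) := by fun_prop
      exact this.tendsto 0
    exact (hΨ.continuousAt.tendsto.comp h2).mono_left nhdsWithin_le_nhds
  · filter_upwards [h₁.filter_mono nhdsWithin_le_nhds, self_mem_nhdsWithin] with t h ht
    exact ⟨ht, (h _ (C.isDualSMul_dualSMul ht _)).symm⟩

variable [IsManifold 𝓘(ℝ, X) ∞ M] [ContMDiffVectorBundle ∞ FH H 𝓘(ℝ, X)]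
  [ContMDiffVectorBundle ∞ FV V 𝓘(ℝ, X)]
  [ContMDiffVectorBundle ∞ FA' A' (𝓘(ℝ, X).prod 𝓘(ℝ, FV))] [ContMDiffVectorBundle ∞ FK K 𝓘(ℝ, X)]

theorem contMDiff_zeroHor (𝒟 : DoubleVectorBundle X FH H FV V FA A FA' A') :
    ContMDiff (𝓘(ℝ, X).prod 𝓘(ℝ, FV))
      ((𝓘(ℝ, X).prod 𝓘(ℝ, FH)).prod 𝓘(ℝ, FA)) ∞ 𝒟.zeroHor :=
  𝒟.toHor.symm.contMDiff.comp (contMDiff_zeroSection ℝ A')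

/-- The core inclusion on a fibre, as a linear map. -/
noncomputable def Core.inclLin (m : M) : K m →ₗ[ℝ] A (zeroSection FH H m) :=
  toFibre (fun k => C.incl ⟨m, k⟩) _ (fun _ => C.proj _)
    (fun k l => by rw [← C.add ⟨m, k⟩ ⟨m, l⟩ rfl, totalAdd_mk])
    (fun t k => C.smul t ⟨m, k⟩)

theorem Core.mk_inclLin (m : M) (k : K m) :
    (⟨_, C.inclLin m k⟩ : TotalSpace FA A) = C.incl ⟨m, k⟩ := mk_toFibre _

/-- Near a point of `K*` the zeros of `𝒜^{*V} → K*` exist and form a smooth family, since local frames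
of `V` and of `K` give a smooth frame of `𝒜 → H` along the zero section of `H`. -/
theorem Core.exists_isDualZero_near (κ₀ : DualTotal FK K) :
    ∃ Ψ : DualTotal FK K → DualTotal FA A,
      ContMDiffAt (𝓘(ℝ, X).prod 𝓘(ℝ, FK →L[ℝ] ℝ))
        ((𝓘(ℝ, X).prod 𝓘(ℝ, FH)).prod 𝓘(ℝ, FA →L[ℝ] ℝ)) ∞ Ψ κ₀ ∧
      ∀ᶠ κ in 𝓝 κ₀, C.IsDualZero κ (Ψ κ) := by
  let m₀ := κ₀.proj
  let eV := trivializationAt FV V m₀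
  let eK := trivializationAt FK K m₀
  have hV : m₀ ∈ eV.baseSet := FiberBundle.mem_baseSet_trivializationAt' _
  have hK : m₀ ∈ eK.baseSet := FiberBundle.mem_baseSet_trivializationAt' _
  have hproj : ContMDiffAt (𝓘(ℝ, X).prod 𝓘(ℝ, FK →L[ℝ] ℝ)) 𝓘(ℝ, X) ∞
      (fun κ : DualTotal FK K => κ.proj) κ₀ := contMDiffAt_proj _
  let b : DualTotal FK K → TotalSpace FH H := fun κ => zeroSection FH H κ.proj
  let S : ∀ κ : DualTotal FK K, FV × FK →ₗ[ℝ] A (b κ) := fun κ =>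
    (𝒟.zeroHorLin κ.proj ∘ₗ eV.symmₗ ℝ κ.proj).coprod (C.inclLin κ.proj ∘ₗ eK.symmₗ ℝ κ.proj)
  have hS : ∀ κ w, (⟨b κ, S κ w⟩ : TotalSpace FA A) = totalAdd
      (𝒟.zeroHor ⟨κ.proj, eV.symmₗ ℝ κ.proj w.1⟩) (C.incl ⟨κ.proj, eK.symmₗ ℝ κ.proj w.2⟩) :=
    fun κ w => by
      rw [← mk_zeroHorLin, ← C.mk_inclLin, totalAdd_mk]
      rfl
  let c : DualTotal FK K → (FV × FK →ₗ[ℝ] ℝ) := fun κ =>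
    κ.2.toLinearMap ∘ₗ eK.symmₗ ℝ κ.proj ∘ₗ LinearMap.snd ℝ FV FK
  obtain ⟨Ψ, hΨ, hΨ'⟩ := exists_dual_of_frame (b := b) (S := S) (c := c) (n₀ := κ₀)
    (J := 𝓘(ℝ, X).prod 𝓘(ℝ, FK →L[ℝ] ℝ)) (F := FA)
    ((contMDiff_zeroSection ℝ H).contMDiffAt.comp _ hproj)
    (fun w => by
      have h3 : (fun κ => TotalSpace.mk' FA (b κ) (S κ w)) = fun κ : DualTotal FK K => totalAdd
        (𝒟.zeroHor ⟨κ.proj, eV.symmₗ ℝ κ.proj w.1⟩)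
        (C.incl ⟨κ.proj, eK.symmₗ ℝ κ.proj w.2⟩) := funext fun κ => hS κ w
      rw [h3]
      refine ContMDiffAt.totalAdd ?_ ?_ fun κ => by rw [zeroHor_proj, C.proj]
      · exact 𝒟.contMDiff_zeroHor.contMDiffAt.comp _ ((contMDiffAt_symmₗ eV hV w.1).comp _ hproj)
      · exact C.smooth.contMDiffAt.comp _ ((contMDiffAt_symmₗ eK hK w.2).comp _ hproj))
    (by
      constructor
      · rw [injective_iff_map_eq_zero]
        intro w hw
        have h3 := hS κ₀ w
        rw [hw] at h3
        have h4 := C.eq_zero_of_totalAdd h3.symm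
        exact Prod.ext
          ((symmₗ_bijective eV hV).injective (h4.1.trans (map_zero _).symm))
          ((symmₗ_bijective eK hK).injective (h4.2.trans (map_zero _).symm))
      · intro a
        obtain ⟨v, k, h3⟩ := C.exists_eq_totalAdd m₀ ⟨b κ₀, a⟩ rfl
        obtain ⟨v', rfl⟩ := (symmₗ_bijective eV hV).surjective v
        obtain ⟨k', rfl⟩ := (symmₗ_bijective eK hK).surjective k
        exact ⟨(v', k'), TotalSpace.mk_injective (F := FA) (b κ₀) ((hS κ₀ _).trans h3)⟩)
    (fun w => ContMDiffAt.dual_apply contMDiffAt_id ((contMDiffAt_symmₗ eK hK w.2).comp _ hproj))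
  refine ⟨fun κ => ⟨b κ, Ψ κ⟩, hΨ, ?_⟩
  filter_upwards [hΨ', hproj.continuousAt.eventually (eV.open_baseSet.mem_nhds hV),
    hproj.continuousAt.eventually (eK.open_baseSet.mem_nhds hK)] with κ hκ hκV hκK
  refine ⟨rfl, fun v => ?_, fun k => ?_⟩
  · obtain ⟨w, rfl⟩ := (symmₗ_bijective eV hκV).surjective v
    have h3 : S κ (w, 0) = 𝒟.zeroHorLin κ.proj (eV.symmₗ ℝ κ.proj w) := by
      simp only [S, LinearMap.coprod_apply, LinearMap.comp_apply, map_zero, add_zero]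
    rw [← mk_zeroHorLin, dualPair_mk, ← h3, hκ.2]
    simp only [c, LinearMap.comp_apply, LinearMap.snd_apply, map_zero]
  · obtain ⟨w, rfl⟩ := (symmₗ_bijective eK hκK).surjective k
    have h3 : S κ (0, w) = C.inclLin κ.proj (eK.symmₗ ℝ κ.proj w) := by
      simp only [S, LinearMap.coprod_apply, LinearMap.comp_apply, map_zero, zero_add]
    rw [← C.mk_inclLin, dualPair_mk, ← h3, hκ.2]
    rfl

theorem Core.exists_contMDiff_isDualZero :
    ∃ s : DualTotal FK K → DualTotal FA A,
      ContMDiff (𝓘(ℝ, X).prod 𝓘(ℝ, FK →L[ℝ] ℝ))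
        ((𝓘(ℝ, X).prod 𝓘(ℝ, FH)).prod 𝓘(ℝ, FA →L[ℝ] ℝ)) ∞ s ∧ ∀ κ, C.IsDualZero κ (s κ) := by
  have h : ∀ κ : DualTotal FK K, ∃ Ψ, C.IsDualZero κ Ψ := fun κ => by
    obtain ⟨Ψ, -, hΨ⟩ := C.exists_isDualZero_near κ
    exact ⟨_, hΨ.self_of_nhds⟩
  choose s hs using h
  refine ⟨s, fun κ₀ => ?_, hs⟩
  obtain ⟨Ψ, hΨ, hΨ'⟩ := C.exists_isDualZero_near κ₀
  exact hΨ.congr_of_eventuallyEq (hΨ'.mono fun κ hκ => (hs κ).unique hκ)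

/-- A smooth function on `𝒜^{*V}` which is invariant under the scalar multiplication of
`𝒜^{*V} → K*` is the pullback of its restriction to the zero section. -/
theorem Core.exists_eq_comp_dualProj
    (f : C^∞⟮(𝓘(ℝ, X).prod 𝓘(ℝ, FH)).prod 𝓘(ℝ, FA →L[ℝ] ℝ), DualTotal FA A; ℝ⟯)
    (hf : ∀ (t : ℝ) (ht : t ≠ 0) Φ, f (𝒟.dualSMul ht Φ) = f Φ) :
    ∃ g : C^∞⟮𝓘(ℝ, X).prod 𝓘(ℝ, FK →L[ℝ] ℝ), DualTotal FK K; ℝ⟯,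
      ∀ Φ, f Φ = g (C.dualProj Φ) := by
  obtain ⟨s, hs, hs'⟩ := C.exists_contMDiff_isDualZero
  refine ⟨⟨fun κ => f (s κ), f.contMDiff.comp hs⟩, fun Φ => ?_⟩
  obtain ⟨Ψ, h₀, h₁, h₂⟩ := C.exists_tendsto_dualSMul Φ
  have h3 : Tendsto (fun t => f (Ψ t)) (𝓝[≠] 0) (𝓝 (f (Ψ 0))) :=
    (f.contMDiff.continuous.tendsto _).comp h₁
  have h4 : Tendsto (fun t => f (Ψ t)) (𝓝[≠] 0) (𝓝 (f Φ)) := by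
    refine tendsto_const_nhds.congr' (h₂.mono ?_)
    rintro t ⟨ht, h⟩
    change f Φ = f (Ψ t)
    rw [h, hf]
  rw [tendsto_nhds_unique h4 h3, h₀.unique (hs' _)]
  rfl

end Homogeneous

end Double

end DoubleVectorBundle

/-! ### Linearity over the dual of the core -/

theorem mainTheorem6
    {X : Type*} [NormedAddCommGroup X] [NormedSpace ℝ X] [FiniteDimensional ℝ X]
    {M : Type*} [TopologicalSpace M] [T2Space M] [SecondCountableTopology M]
    [ChartedSpace X M] [IsManifold 𝓘(ℝ, X) ∞ M]
    {FH : Type*} [NormedAddCommGroup FH] [NormedSpace ℝ FH] [FiniteDimensional ℝ FH]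
    {H : M → Type*} [TopologicalSpace (TotalSpace FH H)] [∀ m, TopologicalSpace (H m)]
    [∀ m, AddCommGroup (H m)] [∀ m, Module ℝ (H m)] [FiberBundle FH H] [VectorBundle ℝ FH H]
    [ContMDiffVectorBundle ∞ FH H 𝓘(ℝ, X)]
    {FV : Type*} [NormedAddCommGroup FV] [NormedSpace ℝ FV] [FiniteDimensional ℝ FV]
    {V : M → Type*} [TopologicalSpace (TotalSpace FV V)] [∀ m, TopologicalSpace (V m)]
    [∀ m, AddCommGroup (V m)] [∀ m, Module ℝ (V m)] [FiberBundle FV V] [VectorBundle ℝ FV V]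
    [ContMDiffVectorBundle ∞ FV V 𝓘(ℝ, X)]
    {FA : Type*} [NormedAddCommGroup FA] [NormedSpace ℝ FA] [FiniteDimensional ℝ FA]
    {A : TotalSpace FH H → Type*} [TopologicalSpace (TotalSpace FA A)]
    [∀ x, TopologicalSpace (A x)] [∀ x, AddCommGroup (A x)] [∀ x, Module ℝ (A x)]
    [FiberBundle FA A] [VectorBundle ℝ FA A]
    [ContMDiffVectorBundle ∞ FA A (𝓘(ℝ, X).prod 𝓘(ℝ, FH))]
    {FA' : Type*} [NormedAddCommGroup FA'] [NormedSpace ℝ FA'] [FiniteDimensional ℝ FA']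
    {A' : TotalSpace FV V → Type*} [TopologicalSpace (TotalSpace FA' A')]
    [∀ v, TopologicalSpace (A' v)] [∀ v, AddCommGroup (A' v)] [∀ v, Module ℝ (A' v)]
    [FiberBundle FA' A'] [VectorBundle ℝ FA' A']
    [ContMDiffVectorBundle ∞ FA' A' (𝓘(ℝ, X).prod 𝓘(ℝ, FV))]
    {FK : Type*} [NormedAddCommGroup FK] [NormedSpace ℝ FK] [FiniteDimensional ℝ FK]
    {K : M → Type*} [TopologicalSpace (TotalSpace FK K)] [∀ m, TopologicalSpace (K m)]
    [∀ m, AddCommGroup (K m)] [∀ m, Module ℝ (K m)] [FiberBundle FK K] [VectorBundle ℝ FK K]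
    [ContMDiffVectorBundle ∞ FK K 𝓘(ℝ, X)]
    (𝒟 : DoubleVectorBundle X FH H FV V FA A FA' A') (C : 𝒟.Core FK K)
    (L : LieAlgebroid (𝓘(ℝ, X).prod 𝓘(ℝ, FH)) FA A) (LV : LieAlgebroid 𝓘(ℝ, X) FV V)
    (h𝒟 : 𝒟.IsLAVectorBundle L LV)
    (P : PoissonStructure ((𝓘(ℝ, X).prod 𝓘(ℝ, FH)).prod 𝓘(ℝ, FA →L[ℝ] ℝ)) (DualTotal FA A))
    (hP : L.IsDualPoisson P) :
    P.IsLinear (𝓘(ℝ, X).prod 𝓘(ℝ, FK →L[ℝ] ℝ)) C.dualProj C.IsDualLinear := by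
  have hs := h𝒟.smul
  have hlin : ∀ F : C^∞⟮(𝓘(ℝ, X).prod 𝓘(ℝ, FH)).prod 𝓘(ℝ, FA →L[ℝ] ℝ), DualTotal FA A; ℝ⟯,
      C.IsDualLinear F → ∀ (t : ℝ) (ht : t ≠ 0), F.comp (𝒟.dualSMulMap hs ht) = t • F :=
    fun F hF t ht => ContMDiffMap.ext fun Φ => hF.smul t Φ _ (C.isDualSMul_dualSMul ht Φ)
  have hpull : ∀ (F : C^∞⟮(𝓘(ℝ, X).prod 𝓘(ℝ, FH)).prod 𝓘(ℝ, FA →L[ℝ] ℝ), DualTotal FA A; ℝ⟯)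
      (f : C^∞⟮𝓘(ℝ, X).prod 𝓘(ℝ, FK →L[ℝ] ℝ), DualTotal FK K; ℝ⟯),
      (∀ Φ, F Φ = f (C.dualProj Φ)) →
      ∀ (t : ℝ) (ht : t ≠ 0), F.comp (𝒟.dualSMulMap hs ht) = F :=
    fun F f hF t ht => ContMDiffMap.ext fun Φ => by
      change F (𝒟.dualSMul ht Φ) = F Φ
      rw [hF, hF, C.dualProj_dualSMul]
  -- in each case, divide `{F ∘ h_t, G ∘ h_t} = t {F, G} ∘ h_t` by `t`, or let `t` tend to `0`
  refine ⟨fun F G hF hG => ?_, fun F G g hF hG => ?_, fun F G f g hF hG => ?_⟩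
  · refine C.isDualLinear_of_homogeneous _ fun t ht Φ => mul_left_cancel₀ ht ?_
    rw [← 𝒟.bracket_comp_dualSMul hs ht hP, hlin F hF t ht, hlin G hG t ht, map_smul, map_smul]
    rfl
  · refine C.exists_eq_comp_dualProj _ fun t ht Φ => mul_left_cancel₀ ht ?_
    rw [← 𝒟.bracket_comp_dualSMul hs ht hP, hlin F hF t ht, hpull G g hG t ht, map_smul]
    rfl
  · ext Φ
    change P.bracket F G Φ = 0
    obtain ⟨Ψ, -, h₁, h₂⟩ := C.exists_tendsto_dualSMul Φ
    have h3 : Tendsto (fun t => t * P.bracket F G (Ψ t)) (𝓝[≠] 0) (𝓝 (0 * P.bracket F G (Ψ 0))) :=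
      (tendsto_id.mono_left nhdsWithin_le_nhds).mul
        (((P.bracket F G).contMDiff.continuous.tendsto _).comp h₁)
    rw [zero_mul] at h3
    refine tendsto_nhds_unique (tendsto_const_nhds.congr' (h₂.mono ?_)) h3
    rintro t ⟨ht, h⟩
    rw [h, ← 𝒟.bracket_comp_dualSMul hs ht hP, hpull F f hF t ht, hpull G g hG t ht]
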